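/- Let $T^2=S^1\times S^1$ with a fixed orientation. For a diffeomorphism $\varphi$ of $T^2$ let $T^2(\varphi)=(T^2\times[0,1])/\big((x,0)\sim(\varphi(x),1)\big)$ be the torus bundle over the circle with monodromy $\varphi$, with its natural smooth structure; if $\varphi$ preserves orientation, $T^2(\varphi)$ carries the orientation induced by the product orientation of $T^2\times[0,1]$. A space is called aspherical if it is path connected and its homotopy groups $\pi_n$ vanish for all $n\ge 2$. For every orientation-preserving diffeomorphism $\psi$ of $T^2$ there is a compact, connected, oriented, smooth, aspherical $4$-manifold $W$ with boundary such that 1. the Euler characteristic of $W$ is $\chi(W)=0$; 2. every component of $\partial W$ is aspherical, and $\partial W$ is $\pi_1$-injective, that is, for every component $C$ of $\partial W$ the inclusion $C\hookrightarrow W$ induces an injection $\pi_1(C)\to\pi_1(W)$; 3. with its boundary orientation, $\partial W$ is orientation-preservingly diffeomorphic to $$T^2(\psi^{-1})\sqcup T^2(\psi^{-1})\sqcup T^2(\psi)\sqcup T^2(\psi).$$ -/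

import Mathlib

open scoped Manifold ContDiff Topology

noncomputable section

/-! ### Orientations of smooth manifolds -/

/-- A family `v` of `n` vectors is a positive frame for the orientation `o` of `V`: it is a basis
of `V`, and this basis defines the orientation `o`. -/
def IsPositiveFrame {V : Type*} [AddCommGroup V] [Module ℝ V] {n : ℕ}
    (o : Orientation ℝ V (Fin n)) (v : Fin n → V) : Prop :=
  ∃ b : Module.Basis (Fin n) ℝ V, ⇑b = v ∧ b.orientation = o

/-- An orientation of an `n`-dimensional smooth manifold `M` (possibly with boundary): an
orientation of every tangent space, which is locally constant when it is read in charts. -/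
structure ManifoldOrientation {E H : Type*} [NormedAddCommGroup E] [NormedSpace ℝ E]
    [TopologicalSpace H] (I : ModelWithCorners ℝ E H) (M : Type*) [TopologicalSpace M]
    [ChartedSpace H M] (n : ℕ) where
  /-- The orientation of the tangent space at `x`. -/
  orient : ∀ x : M, Orientation ℝ (TangentSpace I x) (Fin n)
  locallyConstant : ∀ x₀ : M, ∃ w : Orientation ℝ E (Fin n), ∀ᶠ x in 𝓝 x₀,
    ∀ v : Fin n → TangentSpace I x, IsPositiveFrame (orient x) v →
      IsPositiveFrame w (fun i => mvfderiv I (extChartAt I x₀) x (v i))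

/-- The local diffeomorphism `f` preserves orientations: its differential maps positive frames to
positive frames. -/
def PreservesOrientation {E H E' H' : Type*} [NormedAddCommGroup E] [NormedSpace ℝ E]
    [TopologicalSpace H] {I : ModelWithCorners ℝ E H} [NormedAddCommGroup E'] [NormedSpace ℝ E']
    [TopologicalSpace H'] {I' : ModelWithCorners ℝ E' H'} {M M' : Type*} [TopologicalSpace M]
    [ChartedSpace H M] [TopologicalSpace M'] [ChartedSpace H' M'] {n : ℕ}
    (o : ManifoldOrientation I M n) (o' : ManifoldOrientation I' M' n) (f : M → M') : Prop :=
  ∀ (x : M) (v : Fin n → TangentSpace I x), IsPositiveFrame (o.orient x) v →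
    IsPositiveFrame (o'.orient (f x)) (fun i => mfderiv I I' f x (v i))

/-! ### Bundles over the circle -/

/-- The product `F × ℝ`, which carries the action of `ℤ` generated by
`(x, t) ↦ (φ x, t + 1)`. -/
def MappingTorusCover {F : Type*} [TopologicalSpace F] (_φ : F ≃ₜ F) : Type _ := F × ℝ

namespace MappingTorusCover

variable {F : Type*} [TopologicalSpace F] (φ : F ≃ₜ F)

instance : TopologicalSpace (MappingTorusCover φ) := inferInstanceAs (TopologicalSpace (F × ℝ))

instance [T2Space F] : T2Space (MappingTorusCover φ) := inferInstanceAs (T2Space (F × ℝ))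

instance [LocallyCompactSpace F] : LocallyCompactSpace (MappingTorusCover φ) :=
  inferInstanceAs (LocallyCompactSpace (F × ℝ))

instance {H : Type*} [TopologicalSpace H] [ChartedSpace H F] :
    ChartedSpace (ModelProd H ℝ) (MappingTorusCover φ) :=
  inferInstanceAs (ChartedSpace (ModelProd H ℝ) (F × ℝ))

/-- The action `n +ᵥ (x, t) = (φⁿ x, t + n)` of `ℤ`. -/
instance : AddAction ℤ (MappingTorusCover φ) where
  vadd n p := ((φ ^ n) p.1, p.2 + n)
  zero_vadd p := by
    show ((φ ^ (0 : ℤ)) p.1, p.2 + ((0 : ℤ) : ℝ)) = p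
    exact Prod.ext rfl (by simp)
  add_vadd m n p := by
    show ((φ ^ (m + n)) p.1, p.2 + ((m + n : ℤ) : ℝ))
      = ((φ ^ m) ((φ ^ n) p.1), p.2 + (n : ℝ) + (m : ℝ))
    rw [zpow_add]
    refine Prod.ext rfl ?_
    push_cast
    ring

theorem vadd_def (n : ℤ) (p : MappingTorusCover φ) :
    n +ᵥ p = ((φ ^ n) p.1, p.2 + (n : ℝ)) := rfl

instance : ContinuousConstVAdd ℤ (MappingTorusCover φ) where
  continuous_const_vadd n := by
    have h : Continuous fun p : F × ℝ => ((φ ^ n) p.1, p.2 + (n : ℝ)) := by fun_prop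
    exact h

instance : IsCancelVAdd ℤ (MappingTorusCover φ) where
  left_cancel' _ _ _ h := vadd_left_cancel _ h
  right_cancel' a b p h := by
    have h2 : p.2 + (a : ℝ) = p.2 + (b : ℝ) := congrArg Prod.snd h
    exact_mod_cast add_left_cancel h2

instance : ProperlyDiscontinuousVAdd ℤ (MappingTorusCover φ) where
  finite_disjoint_inter_image {K L} hK hL := by
    have hc : Continuous fun p : MappingTorusCover φ => p.2 := continuous_snd (X := F) (Y := ℝ)
    obtain ⟨a, ha⟩ := (hK.image hc).isBounded.exists_norm_le
    obtain ⟨b, hb⟩ := (hL.image hc).isBounded.exists_norm_le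
    obtain ⟨N, hN⟩ := exists_nat_ge (a + b)
    refine (Set.finite_Icc (-(N : ℤ)) N).subset ?_
    rintro n ⟨_, ⟨p, hp, rfl⟩, hq⟩
    have h1 : |p.2| ≤ a := ha _ ⟨p, hp, rfl⟩
    have h2 : |p.2 + (n : ℝ)| ≤ b := hb _ ⟨_, hq, rfl⟩
    rw [abs_le] at h1 h2
    constructor
    · have h : (-(N : ℝ)) ≤ n := by linarith
      exact_mod_cast h
    · have h : (n : ℝ) ≤ N := by linarith
      exact_mod_cast h

end MappingTorusCover

/-- The bundle `F(φ)` over the circle with monodromy `φ`: the quotient of `F × ℝ` by the action of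
`ℤ` generated by `(x, t) ↦ (φ x, t + 1)`, that is, `F × [0, 1]` with `(x, 0)` identified with
`(φ x, 1)`. If `F` is a smooth manifold and `φ` a diffeomorphism, then its charts, which come from
Mathlib's instance on orbit spaces, are those of `F × ℝ`, so that `F × ℝ → F(φ)` is a smooth
covering. -/
abbrev MappingTorus {F : Type*} [TopologicalSpace F] (φ : F ≃ₜ F) : Type _ :=
  AddAction.orbitRel.Quotient ℤ (MappingTorusCover φ)

/-- The quotient map `F × ℝ → F(φ)`. -/
def MappingTorus.proj {F : Type*} [TopologicalSpace F] (φ : F ≃ₜ F) (p : F × ℝ) :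
    MappingTorus φ :=
  Quotient.mk (AddAction.orbitRel ℤ (MappingTorusCover φ)) p

theorem Diffeomorph.contMDiff_zpow {E H F : Type*} [NormedAddCommGroup E] [NormedSpace ℝ E]
    [TopologicalSpace H] {I : ModelWithCorners ℝ E H} [TopologicalSpace F] [ChartedSpace H F]
    (φ : Diffeomorph I I F F ∞) (n : ℤ) :
    ContMDiff I I ∞ (φ.toHomeomorph ^ n : F ≃ₜ F) := by
  have hnat : ∀ (χ : Diffeomorph I I F F ∞) (k : ℕ),
      ContMDiff I I ∞ (χ.toHomeomorph ^ k : F ≃ₜ F) := by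
    intro χ k
    induction k with
    | zero => simpa using! contMDiff_id
    | succ k ih =>
      rw [pow_succ]
      exact ih.comp χ.contMDiff
  cases n with
  | ofNat k => simpa using hnat φ k
  | negSucc k =>
    rw [zpow_negSucc, ← inv_pow]
    exact hnat φ.symm (k+1)

/-- The bundle `F(φ)` of a diffeomorphism `φ` is a smooth manifold. -/
theorem MappingTorus.isManifold {E H F : Type*} [NormedAddCommGroup E] [NormedSpace ℝ E]
    [TopologicalSpace H] {I : ModelWithCorners ℝ E H} [TopologicalSpace F] [ChartedSpace H F]
    [T2Space F] [LocallyCompactSpace F] [IsManifold I ∞ F] (φ : Diffeomorph I I F F ∞) :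
    IsManifold (I.prod 𝓘(ℝ, ℝ)) ∞ (MappingTorus φ.toHomeomorph) := by
  have : IsManifold (I.prod 𝓘(ℝ, ℝ)) ∞ (MappingTorusCover φ.toHomeomorph) :=
    inferInstanceAs (IsManifold (I.prod 𝓘(ℝ, ℝ)) ∞ (F × ℝ))
  set J := I.prod 𝓘(ℝ, ℝ)
  set C := MappingTorusCover φ.toHomeomorph
  have hdeck : ∀ n : ℤ, ContMDiff J J ∞ (fun p : C => n +ᵥ p) := by
    intro n
    have : ContMDiff J J ∞ (fun p : F × ℝ => ((φ.toHomeomorph ^ n : F ≃ₜ F) p.1, p.2 + (n:ℝ))) := by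
      refine ((Diffeomorph.contMDiff_zpow φ n).comp contMDiff_fst).prodMk ?_
      exact ((contDiff_id.add contDiff_const).contMDiff (f := fun t : ℝ => t + (n:ℝ))).comp contMDiff_snd
    exact this
  have hloc : IsLocalHomeomorph (Quotient.mk (AddAction.orbitRel ℤ C)) :=
    (isAddQuotientCoveringMap_quotientMk_of_properlyDiscontinuousVAdd (G := ℤ) (E := C)).isCoveringMap.isLocalHomeomorph
  have key : ∀ q x : C, Quotient.mk (AddAction.orbitRel ℤ C) x ∈ (hloc.localInverseAt q).source →
      ContMDiffAt J J ∞ (fun y : C => hloc.localInverseAt q (Quotient.mk _ y)) x := by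
    intro q x hx
    have h1 : Quotient.mk (AddAction.orbitRel ℤ C) (hloc.localInverseAt q (Quotient.mk _ x)) = Quotient.mk _ x :=
      hloc.apply_localInverseAt_of_mem hx
    obtain ⟨n, hn⟩ := Quotient.exact h1
    have hn : n +ᵥ x = hloc.localInverseAt q (Quotient.mk _ x) := hn
    have ht : n +ᵥ x ∈ (hloc.localInverseAt q).target := by
      rw [hn]; exact (hloc.localInverseAt q).map_source hx
    refine (hdeck n x).congr_of_eventuallyEq ?_
    have e1 : ∀ᶠ y in 𝓝 x, n +ᵥ y ∈ (hloc.localInverseAt q).target :=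
      (continuous_const_vadd n).continuousAt.preimage_mem_nhds ((hloc.localInverseAt q).open_target.mem_nhds ht)
    have e2 : ∀ᶠ y in 𝓝 x, Quotient.mk (AddAction.orbitRel ℤ C) y ∈ (hloc.localInverseAt q).source :=
      (hloc.continuous).continuousAt.preimage_mem_nhds ((hloc.localInverseAt q).open_source.mem_nhds hx)
    filter_upwards [e1, e2] with y hy1 hy2
    refine hloc.injOn_localInverseAt_target ((hloc.localInverseAt q).map_source hy2) hy1 ?_
    rw [hloc.apply_localInverseAt_of_mem hy2]
    exact (Quotient.sound ⟨n, rfl⟩ : Quotient.mk (AddAction.orbitRel ℤ C) (n +ᵥ y) = Quotient.mk _ y).symm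
  have hs : ∀ p q : C, ContMDiffOn J J ∞
      (((hloc.localInverseAt p).trans (chartAt (ModelProd H ℝ) p)).symm ≫ₕ
        ((hloc.localInverseAt q).trans (chartAt (ModelProd H ℝ) q)))
      (((hloc.localInverseAt p).trans (chartAt (ModelProd H ℝ) p)).symm ≫ₕ
        ((hloc.localInverseAt q).trans (chartAt (ModelProd H ℝ) q))).source := by
    intro p q z hz
    simp only [OpenPartialHomeomorph.trans_source, OpenPartialHomeomorph.symm_source,
      OpenPartialHomeomorph.trans_target, Set.mem_inter_iff, Set.mem_preimage,
      OpenPartialHomeomorph.coe_trans_symm, Function.comp_apply, hloc.localInverseAt_symm] at hz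
    obtain ⟨⟨hz1, -⟩, hz3, hz4⟩ := hz
    have a1 : ContMDiffAt J J ∞ (chartAt (ModelProd H ℝ) p).symm z :=
      (contMDiffOn_chart_symm (I := J) (M := C)).contMDiffAt
        ((chartAt (ModelProd H ℝ) p).open_target.mem_nhds hz1)
    have a2 := key q _ hz3
    have a3 := (contMDiffOn_chart (I := J) (n := ∞) (x := q)).contMDiffAt
        ((chartAt (ModelProd H ℝ) q).open_source.mem_nhds hz4)
    have a4 := ContMDiffAt.comp z a3 (ContMDiffAt.comp z a2 a1)
    refine (a4.congr_of_eventuallyEq (.of_forall fun y => ?_)).contMDiffWithinAt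
    simp [hloc.localInverseAt_symm]
  refine isManifold_of_contDiffOn _ _ _ ?_
  rintro e e' ⟨p', rfl⟩ ⟨q', rfl⟩
  have h2 := (contMDiffOn_iff.1 (hs (Exists.choose Quotient.mk_surjective.hasRightInverse p')
    (Exists.choose Quotient.mk_surjective.hasRightInverse q'))).2
  by_cases hH : Nonempty (ModelProd H ℝ)
  · obtain ⟨z⟩ := hH
    have h3 := h2 z z
    have hz : chartAt (ModelProd H ℝ) z = OpenPartialHomeomorph.refl _ := by
      exact chartAt_self_eq
    simp only [mfld_simps, extChartAt] at h3 ⊢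
    rw [hz] at h3
    simp only [mfld_simps, Function.comp_assoc] at h3 ⊢
    rw [Set.inter_comm]
    exact h3
  · exact fun x hx => (hH ⟨J.symm x⟩).elim

/-- `o'` is the orientation of `F(φ)` induced by the product orientation of `F × ℝ`, where `F` is
oriented by `o`: if `v` is a positive frame of `F` at `x` then `(v, ∂/∂t)` is mapped to a positive
frame of `F(φ)` by the differential of the quotient map at `(x, t)`. -/
def MappingTorus.IsProductOrientation {E H F : Type*} [NormedAddCommGroup E] [NormedSpace ℝ E]
    [TopologicalSpace H] {I : ModelWithCorners ℝ E H} [TopologicalSpace F] [ChartedSpace H F]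
    [T2Space F] [LocallyCompactSpace F] {n : ℕ} (o : ManifoldOrientation I F n) (φ : F ≃ₜ F)
    (o' : ManifoldOrientation (I.prod 𝓘(ℝ, ℝ)) (MappingTorus φ) (n + 1)) : Prop :=
  ∀ (x : F) (t : ℝ) (v : Fin n → TangentSpace I x), IsPositiveFrame (o.orient x) v →
    IsPositiveFrame (o'.orient (MappingTorus.proj φ (x, t)))
      (Fin.snoc (α := fun _ => TangentSpace (I.prod 𝓘(ℝ, ℝ)) (MappingTorus.proj φ (x, t)))
        (fun i => mfderiv (I.prod 𝓘(ℝ, ℝ)) (I.prod 𝓘(ℝ, ℝ)) (MappingTorus.proj φ) (x, t)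
          ((v i, (0 : ℝ)) : E × ℝ))
        (mfderiv (I.prod 𝓘(ℝ, ℝ)) (I.prod 𝓘(ℝ, ℝ)) (MappingTorus.proj φ) (x, t)
          (((0 : E), (1 : ℝ)) : E × ℝ)))

/-! ### Oriented boundary -/

/-- A tangent vector at a boundary point `y` of an `(m + 1)`-dimensional manifold with boundary
points outwards: its `0`-th coordinate in a chart with values in the half space `{z | 0 ≤ z 0}` is
negative. -/
def IsOutward {m : ℕ} {W : Type*} [TopologicalSpace W]
    [ChartedSpace (EuclideanHalfSpace (m + 1)) W] (y : W) (w : TangentSpace (𝓡∂ (m + 1)) y) :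
    Prop :=
  (mvfderiv (𝓡∂ (m + 1)) (extChartAt (𝓡∂ (m + 1)) y) y w) 0 < 0

/-- The map `e : N → W` to the boundary of the oriented manifold `W` is orientation-preserving,
where the boundary is oriented by the "outward vector first" convention. -/
def PreservesBoundaryOrientation {E H N : Type*} [NormedAddCommGroup E] [NormedSpace ℝ E]
    [TopologicalSpace H] {I : ModelWithCorners ℝ E H} [TopologicalSpace N] [ChartedSpace H N]
    {m : ℕ} {W : Type*} [TopologicalSpace W] [ChartedSpace (EuclideanHalfSpace (m + 1)) W]
    (oN : ManifoldOrientation I N m) (oW : ManifoldOrientation (𝓡∂ (m + 1)) W (m + 1))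
    (e : N → W) : Prop :=
  ∀ (y : N) (v : Fin m → TangentSpace I y) (w : TangentSpace (𝓡∂ (m + 1)) (e y)),
    IsPositiveFrame (oN.orient y) v → IsOutward (e y) w →
      IsPositiveFrame (oW.orient (e y))
        (Fin.cons (α := fun _ => TangentSpace (𝓡∂ (m + 1)) (e y)) w
          (fun i => mfderiv I (𝓡∂ (m + 1)) e y (v i)))

/-- The boundary of the oriented manifold `W` is the disjoint union of the oriented manifolds
`N i`, up to orientation-preserving diffeomorphism: there are smooth embeddings of the `N i` with
disjoint images that cover exactly the boundary of `W`, and they preserve orientations. -/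
def IsOrientedBoundary {ι E H : Type*} [NormedAddCommGroup E] [NormedSpace ℝ E]
    [TopologicalSpace H] {I : ModelWithCorners ℝ E H} {N : ι → Type*}
    [∀ i, TopologicalSpace (N i)] [∀ i, ChartedSpace H (N i)] {m : ℕ} {W : Type*}
    [TopologicalSpace W] [ChartedSpace (EuclideanHalfSpace (m + 1)) W]
    (oN : ∀ i, ManifoldOrientation I (N i) m)
    (oW : ManifoldOrientation (𝓡∂ (m + 1)) W (m + 1)) : Prop :=
  ∃ e : ∀ i, N i → W,
    (∀ i, Manifold.IsSmoothEmbedding I (𝓡∂ (m + 1)) ∞ (e i)) ∧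
    (Pairwise fun i j => Disjoint (Set.range (e i)) (Set.range (e j))) ∧
    (⋃ i, Set.range (e i)) = (𝓡∂ (m + 1)).boundary W ∧
    ∀ i, PreservesBoundaryOrientation (oN i) oW (e i)

/-! ### Homotopy and homology -/

/-- All path components of `X` are aspherical: the homotopy groups `π_n(X, x)`, `n ≥ 2`, vanish for
all base points `x`. -/
def HasAsphericalComponents (X : Type*) [TopologicalSpace X] : Prop :=
  ∀ n : ℕ, 2 ≤ n → ∀ x : X, Subsingleton (HomotopyGroup.Pi n X x)

/-- `X` is aspherical: it is path connected and its higher homotopy groups vanish. -/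
def IsAspherical (X : Type*) [TopologicalSpace X] : Prop :=
  PathConnectedSpace X ∧ HasAsphericalComponents X

/-- The subspace `A` of `X` is `π₁`-injective: the inclusion of each component of `A` induces an
injection of fundamental groups. -/
def IsPi1Injective {X : Type*} [TopologicalSpace X] (A : Set X) : Prop :=
  ∀ a : A, Function.Injective
    (FundamentalGroup.map (⟨Subtype.val, continuous_subtype_val⟩ : C(A, X)) a)

/-- The singular homology `H_i(X; ℚ)`. -/
abbrev rationalHomology (X : Type) [TopologicalSpace X] (i : ℕ) : ModuleCat.{0} ℚ :=
  ((AlgebraicTopology.singularHomologyFunctor (ModuleCat.{0} ℚ) i).obj (ModuleCat.of ℚ ℚ)).obj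
    (TopCat.of X)

/-- The Euler characteristic of `X` is defined and equal to `χ`: the rational homology of `X` is
finite dimensional, and `χ` is the alternating sum of the Betti numbers. -/
def HasEulerCharacteristic (X : Type) [TopologicalSpace X] (χ : ℤ) : Prop :=
  (∀ i, Module.Finite ℚ (rationalHomology X i)) ∧
  ∃ N : ℕ, (∀ i, N ≤ i → Subsingleton (rationalHomology X i)) ∧
    ∑ i ∈ Finset.range N, (-1 : ℤ) ^ i * (Module.finrank ℚ (rationalHomology X i) : ℤ) = χ

/-! ### The torus -/

/-- The torus `T² = S¹ × S¹`. -/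
abbrev Torus : Type := Circle × Circle

/-- The model of the torus with its standard smooth structure. -/
abbrev torusModel := (𝓡 1).prod (𝓡 1)

end

noncomputable section

/-! ### Homotopy groups, coverings and products -/

open scoped unitInterval

theorem hasAsphericalComponents_iff_homotopic_const {X : Type*} [TopologicalSpace X] :
    HasAsphericalComponents X ↔ ∀ n : ℕ, 2 ≤ n → ∀ (x : X) (f : GenLoop (Fin n) X x),
      GenLoop.Homotopic f GenLoop.const := by
  refine forall₃_congr fun n _ x => ⟨fun h f => ?_, fun h => ⟨?_⟩⟩
  · exact Quotient.exact (h.elim (Quotient.mk _ f) (Quotient.mk _ GenLoop.const))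
  · rintro ⟨f⟩ ⟨g⟩
    exact Quotient.sound ((h f).trans (h g).symm)

theorem Cube.isPreconnected_boundary {n : ℕ} (hn : 2 ≤ n) :
    IsPreconnected (Cube.boundary (Fin n)) := by
  have hface : ∀ (i : Fin n) (ε : I),
      IsPreconnected (Set.range fun y : Fin n → I => Function.update y i ε) := fun i ε =>
    isPreconnected_range (by fun_prop)
  have key : ∀ y ∈ Cube.boundary (Fin n), ∃ t ⊆ Cube.boundary (Fin n),
      (0 : Fin n → I) ∈ t ∧ y ∈ t ∧ IsPreconnected t := by
    rintro y ⟨i, hi⟩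
    obtain ⟨j, hj⟩ : ∃ j : Fin n, j ≠ i := by
      have : Nontrivial (Fin n) := Fin.nontrivial_iff_two_le.2 hn
      exact exists_ne i
    refine ⟨(Set.range fun z : Fin n → I => Function.update z i (y i)) ∪
      (Set.range fun z : Fin n → I => Function.update z j 0), ?_, ?_, ?_, ?_⟩
    · rintro _ (⟨z, rfl⟩ | ⟨z, rfl⟩)
      · exact ⟨i, by simpa using hi⟩
      · exact ⟨j, by simp⟩
    · exact Or.inr ⟨0, by simp⟩
    · exact Or.inl ⟨y, by simp⟩
    · refine (hface i _).union (Function.update (Function.update (0 : Fin n → I) i (y i)) j 0) ?_ ?_ (hface j 0)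
      · exact ⟨Function.update (0 : Fin n → I) j 0, by
          simp only [Function.update_comm hj]⟩
      · exact ⟨_, rfl⟩
  refine isPreconnected_of_forall (0 : Fin n → I) fun y hy => ?_
  obtain ⟨t, h1, h2, h3, h4⟩ := key y hy
  exact ⟨t, h1, h2, h3, h4⟩

theorem IsCoveringMap.exists_lift_of_contractibleSpace {E X A : Type*} [TopologicalSpace E]
    [TopologicalSpace X] [TopologicalSpace A] [ContractibleSpace A] {p : E → X}
    (hp : IsCoveringMap p) (hs : Function.Surjective p) (f : C(A, X)) :
    ∃ g : C(A, E), ∀ a, p (g a) = f a := by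
  obtain ⟨a₀, ⟨H⟩⟩ := id_nullhomotopic A
  obtain ⟨e, he⟩ := hs (f a₀)
  let F : C(I × A, X) := f.comp H.symm.toContinuousMap
  have h0 : ∀ a, F (0, a) = p (ContinuousMap.const A e a) := fun a => by
    simp [F, he]
  refine ⟨(hp.liftHomotopy F (ContinuousMap.const A e) h0).comp
    ((ContinuousMap.const A 1).prodMk (ContinuousMap.id A)), fun a => ?_⟩
  have := congr_fun (hp.liftHomotopy_lifts F (ContinuousMap.const A e) h0) (1, a)
  simpa [F] using this

instance cube_contractibleSpace (n : ℕ) : ContractibleSpace (Fin n → I) := by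
  rw [contractible_iff_id_nullhomotopic]
  refine ⟨0, ⟨⟨⟨fun p i => unitInterval.symm p.1 * p.2 i, by fun_prop⟩, fun x => ?_, fun x => ?_⟩⟩⟩
  · ext i; simp
  · ext i; simp

theorem HasAsphericalComponents.of_isCoveringMap {E X : Type*} [TopologicalSpace E]
    [TopologicalSpace X] {p : E → X} (hE : HasAsphericalComponents E)
    (hp : IsCoveringMap p) (hs : Function.Surjective p) : HasAsphericalComponents X := by
  rw [hasAsphericalComponents_iff_homotopic_const] at hE ⊢
  intro n hn x f
  obtain ⟨g, hg⟩ := hp.exists_lift_of_contractibleSpace hs (f : C(Fin n → I, X))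
  have h0 : (0 : Fin n → I) ∈ Cube.boundary (Fin n) := ⟨⟨0, by omega⟩, by simp⟩
  have hgb : ∀ y ∈ Cube.boundary (Fin n), g y = g 0 := fun y hy =>
    hp.constOn_of_comp (Cube.isPreconnected_boundary hn) g.continuous.continuousOn
      (fun a ha b hb => by
        show p (g a) = p (g b)
        rw [hg, hg]; exact (f.2 a ha).trans (f.2 b hb).symm) hy h0
  obtain ⟨H⟩ := hE n hn (g 0) ⟨g, hgb⟩
  have hH := ContinuousMap.HomotopyRel.compContinuousMap H ⟨p, hp.continuous⟩
  have e1 : (⟨p, hp.continuous⟩ : C(E, X)).comp g = f.1 := by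
    ext y; exact hg y
  have e2 : (⟨p, hp.continuous⟩ : C(E, X)).comp (GenLoop.const (N := Fin n) (x := g 0)).1
      = (GenLoop.const (N := Fin n) (x := x)).1 := by
    ext y; exact (hg 0).trans (f.2 0 h0)
  exact ⟨hH.cast e1 e2⟩

theorem HasAsphericalComponents.prod {X Y : Type*} [TopologicalSpace X] [TopologicalSpace Y]
    (hX : HasAsphericalComponents X) (hY : HasAsphericalComponents Y) :
    HasAsphericalComponents (X × Y) := by
  rw [hasAsphericalComponents_iff_homotopic_const] at hX hY ⊢
  rintro n hn ⟨x, y⟩ f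
  obtain ⟨H₁⟩ := hX n hn x ⟨ContinuousMap.fst.comp f.1, fun z hz => congrArg Prod.fst (f.2 z hz)⟩
  obtain ⟨H₂⟩ := hY n hn y ⟨ContinuousMap.snd.comp f.1, fun z hz => congrArg Prod.snd (f.2 z hz)⟩
  exact ⟨(ContinuousMap.HomotopyRel.prod H₁ H₂).cast rfl rfl⟩

/-- A subspace `range e i` of `Y` that is open and closed contains every cube that meets it. -/
theorem HasAsphericalComponents.of_isClopen_range {ι : Type*} {N : ι → Type*} {Y : Type*}
    [∀ i, TopologicalSpace (N i)] [TopologicalSpace Y] (hN : ∀ i, HasAsphericalComponents (N i))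
    (e : ∀ i, N i → Y) (he : ∀ i, Topology.IsEmbedding (e i)) (hc : ∀ i, IsClopen (Set.range (e i)))
    (hU : ∀ y, ∃ i, y ∈ Set.range (e i)) : HasAsphericalComponents Y := by
  simp only [hasAsphericalComponents_iff_homotopic_const] at hN ⊢
  intro n hn y f
  obtain ⟨i, x, rfl⟩ := hU y
  have h0 : (0 : Fin n → I) ∈ Cube.boundary (Fin n) := ⟨⟨0, by omega⟩, by simp⟩
  have hr : ∀ z, f.1 z ∈ Set.range (e i) := fun z => by
    have h1 : IsClopen (f.1 ⁻¹' Set.range (e i)) := (hc i).preimage f.1.continuous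
    have h2 := h1.eq_univ ⟨0, by
      exact ⟨x, (f.2 0 h0).symm⟩⟩
    exact Set.eq_univ_iff_forall.1 h2 z
  choose g hg using hr
  have hgc : Continuous g := (he i).continuous_iff.2 (by
    have : e i ∘ g = f.1 := funext hg
    rw [this]; exact f.1.continuous)
  obtain ⟨H⟩ := hN i n hn x ⟨⟨g, hgc⟩, fun z hz => (he i).injective ((hg z).trans (f.2 z hz))⟩
  have hH := ContinuousMap.HomotopyRel.compContinuousMap H ⟨e i, (he i).continuous⟩
  exact ⟨hH.cast (ContinuousMap.ext fun z => hg z) rfl⟩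

theorem HasAsphericalComponents.of_contractibleSpace {X : Type*} [TopologicalSpace X]
    [ContractibleSpace X] : HasAsphericalComponents X := by
  rw [hasAsphericalComponents_iff_homotopic_const]
  intro n hn x f
  obtain ⟨p, ⟨H⟩⟩ := id_nullhomotopic X
  have : NeZero n := ⟨by omega⟩
  have hne : (Finset.univ : Finset (Fin n)).Nonempty := Finset.univ_nonempty
  -- the distance of a point of the cube to the boundary
  let d : (Fin n → I) → ℝ := fun y => Finset.univ.inf' hne fun i => min (y i : ℝ) (1 - y i)
  have hd : Continuous d := by
    refine Continuous.finset_inf'_apply hne fun i _ => ?_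
    fun_prop
  have hd0 : ∀ y, 0 ≤ d y := fun y => by
    refine Finset.le_inf' _ _ fun i _ => le_min (y i).2.1 (by linarith [(y i).2.2])
  have hdb : ∀ y ∈ Cube.boundary (Fin n), d y = 0 := fun y ⟨i, hi⟩ => by
    refine le_antisymm ?_ (hd0 y)
    refine (Finset.inf'_le _ (Finset.mem_univ i)).trans ?_
    rcases hi with hi | hi <;> simp [hi]
  let F₁ : I × (Fin n → I) → (Fin n → I) := fun q i =>
    Set.projIcc (0 : ℝ) 1 zero_le_one (((q.2 i : ℝ) - 1 / 2) / (1 - q.1 / 2) + 1 / 2)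
  have hpos : ∀ s : I, (0 : ℝ) < 1 - s / 2 := fun s => by linarith [s.2.2]
  have hF₁ : Continuous F₁ := by
    refine continuous_pi fun i => continuous_projIcc.comp ?_
    refine Continuous.add (Continuous.div (by fun_prop) (by fun_prop) fun q => (hpos q.1).ne') ?_
    fun_prop
  let θ : I × (Fin n → I) → I := fun q => Set.projIcc (0 : ℝ) 1 zero_le_one (min q.1 (4 * d q.2))
  have hθ : Continuous θ := continuous_projIcc.comp (by fun_prop)
  have hclip : ∀ (s : I) (y : Fin n → I), 4 * d y ≤ s → F₁ (s, y) ∈ Cube.boundary (Fin n) := by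
    intro s y hsy
    obtain ⟨i, -, hi⟩ := Finset.exists_mem_eq_inf' hne fun i => min (y i : ℝ) (1 - y i)
    change d y = _ at hi
    refine ⟨i, ?_⟩
    rcases min_choice (y i : ℝ) (1 - y i) with h | h
    · left
      refine Set.projIcc_of_le_left _ ?_
      have : ((y i : ℝ) - 1 / 2) / (1 - s / 2) ≤ -1 / 2 := by
        rw [div_le_iff₀ (hpos s)]
        linarith
      show ((y i : ℝ) - 1 / 2) / (1 - s / 2) + 1 / 2 ≤ 0
      linarith
    · right
      refine Set.projIcc_of_right_le _ ?_
      have : 1 / 2 ≤ ((y i : ℝ) - 1 / 2) / (1 - s / 2) := by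
        rw [le_div_iff₀ (hpos s)]
        linarith
      show 1 ≤ ((y i : ℝ) - 1 / 2) / (1 - s / 2) + 1 / 2
      linarith
  have hθb : ∀ (s : I) (y), y ∈ Cube.boundary (Fin n) → θ (s, y) = 0 := fun s y hy => by
    simp only [θ, hdb y hy, mul_zero]
    exact Set.projIcc_of_le_left _ (min_le_right _ _)
  have hFb : ∀ (s : I) (y), y ∈ Cube.boundary (Fin n) → F₁ (s, y) ∈ Cube.boundary (Fin n) :=
    fun s y hy => hclip s y (by rw [hdb y hy, mul_zero]; exact s.2.1)
  -- pull `f` along the contraction of `X`, surrounded by the track of the base point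
  let G : C(Fin n → I, X) :=
    ⟨fun y => H (θ (1, y), x), by fun_prop⟩
  have step₁ : f.1.HomotopicRel G (Cube.boundary (Fin n)) := by
    refine ⟨⟨⟨⟨fun q => H (θ q, f.1 (F₁ q)), by fun_prop⟩, fun y => ?_, fun y => ?_⟩, ?_⟩⟩
    · have h1 : θ (0, y) = 0 := Set.projIcc_of_le_left _ (min_le_left _ _)
      have h2 : F₁ (0, y) = y := by
        ext i
        simp only [F₁, Set.Icc.coe_zero, zero_div, sub_zero, div_one, sub_add_cancel]
        rw [Set.projIcc_val]
      simp [h1, h2]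
    · show H (θ (1, y), f.1 (F₁ (1, y))) = H (θ (1, y), x)
      by_cases h : 4 * d y ≤ 1
      · rw [f.2 _ (hclip 1 y (by simpa using h))]
      · have : θ (1, y) = 1 := Set.projIcc_of_right_le _ (le_min (by simp) (not_le.1 h).le)
        rw [this]; simp
    · intro s y hy
      show H (θ (s, y), f.1 (F₁ (s, y))) = f.1 y
      rw [hθb s y hy, f.2 _ (hFb s y hy), f.2 y hy]; simp
  have step₂ : G.HomotopicRel (GenLoop.const (N := Fin n) (x := x)).1 (Cube.boundary (Fin n)) := by
    refine ⟨⟨⟨⟨fun q => H (unitInterval.symm q.1 * θ (1, q.2), x), by fun_prop⟩,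
      fun y => ?_, fun y => ?_⟩, ?_⟩⟩
    · simp [G]
    · simp [GenLoop.const]
    · intro s y hy
      show H (unitInterval.symm s * θ (1, y), x) = H (θ (1, y), x)
      rw [hθb 1 y hy]; simp
  exact step₁.trans step₂

end

noncomputable section

/-! ### Chains on the Cayley graph of a free group -/

namespace FreeGroup

variable {S : Type*}

/-- The automorphism `(c, g) ↦ (c + [(g, s)], s g)` of chains with a marked vertex. -/
def chainStep (s : S) :
    Equiv.Perm ((FreeGroup S × S →₀ ℤ) × FreeGroup S) where
  toFun c := (c.1 + Finsupp.single (c.2, s) 1, of s * c.2)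
  invFun c := (c.1 - Finsupp.single ((of s)⁻¹ * c.2, s) 1, (of s)⁻¹ * c.2)
  left_inv c := by simp
  right_inv c := by simp

/-- The chain in the Cayley graph with edges `(g, s)` from `g` to `s g` that joins `1` to `g`. -/
def pathChain (g : FreeGroup S) : FreeGroup S × S →₀ ℤ :=
  (lift chainStep g (0, 1)).1

theorem lift_chainStep_apply (g : FreeGroup S) :
    lift (chainStep (S := S)) g (0, 1) = (pathChain g, g) := by
  refine Prod.ext rfl ?_
  have h : ∀ (g : FreeGroup S) c, (lift (chainStep (S := S)) g c).2 = g * c.2 := by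
    intro g
    induction g using FreeGroup.induction_on with
    | C1 => simp
    | of s => intro c; simp [chainStep]
    | inv_of s ih =>
      intro c
      rw [_root_.map_inv, lift_apply_of]
      rfl
    | mul x y hx hy => intro c; rw [_root_.map_mul, Equiv.Perm.mul_apply, hx, hy, mul_assoc]
  simpa using h g (0, 1)

@[simp] theorem pathChain_one : pathChain (1 : FreeGroup S) = 0 := by simp [pathChain]

theorem pathChain_of_mul (s : S) (g : FreeGroup S) :
    pathChain (of s * g) = pathChain g + Finsupp.single (g, s) 1 := by
  rw [pathChain, _root_.map_mul, Equiv.Perm.mul_apply, lift_chainStep_apply, lift_apply_of]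
  rfl

theorem pathChain_inv_of_mul (s : S) (g : FreeGroup S) :
    pathChain ((of s)⁻¹ * g) = pathChain g - Finsupp.single ((of s)⁻¹ * g, s) 1 := by
  have h := pathChain_of_mul s ((of s)⁻¹ * g)
  rw [mul_inv_cancel_left] at h
  rw [h]; abel

theorem induction_mul_left {P : FreeGroup S → Prop} (h1 : P 1)
    (hof : ∀ s g, P g → P (of s * g)) (hinv : ∀ s g, P g → P ((of s)⁻¹ * g)) (g : FreeGroup S) :
    P g := by
  have h : ∀ x : FreeGroup S, ∀ y, P y → P (x * y) := by
    intro x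
    induction x using FreeGroup.induction_on with
    | C1 => intro y hy; simpa using hy
    | of s => exact hof s
    | inv_of s ih => exact hinv s
    | mul x y hx hy => intro z hz; rw [mul_assoc]; exact hx _ (hy _ hz)
  simpa using h g 1 h1

/-- The boundary of `pathChain g` is `[g] - [1]`. -/
theorem pathChain_sum_sub {M : Type*} [AddCommGroup M] (u : FreeGroup S → M) (g : FreeGroup S) :
    ((pathChain g).sum fun e n => n • (u (of e.2 * e.1) - u e.1)) = u g - u 1 := by
  have h0 : ∀ e : FreeGroup S × S, (0 : ℤ) • (u (of e.2 * e.1) - u e.1) = 0 := fun e => zero_smul _ _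
  have hadd : ∀ (e : FreeGroup S × S) (m n : ℤ), (m + n) • (u (of e.2 * e.1) - u e.1) =
      m • (u (of e.2 * e.1) - u e.1) + n • (u (of e.2 * e.1) - u e.1) := fun e m n => add_smul _ _ _
  have hsub : ∀ (e : FreeGroup S × S) (m n : ℤ), (m - n) • (u (of e.2 * e.1) - u e.1) =
      m • (u (of e.2 * e.1) - u e.1) - n • (u (of e.2 * e.1) - u e.1) := fun e m n => sub_smul _ _ _
  induction g using induction_mul_left with
  | h1 => simp
  | hof s g ih =>
    rw [pathChain_of_mul, Finsupp.sum_add_index' h0 hadd, ih, Finsupp.sum_single_index (h0 _)]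
    simp
  | hinv s g ih =>
    rw [pathChain_inv_of_mul, Finsupp.sum_sub_index hsub, ih, Finsupp.sum_single_index (h0 _)]
    simp

end FreeGroup

/-! ### Homology of the quotient by a free action of a free group -/

open CategoryTheory AlgebraicTopology Limits Simplicial

/-- The singular chain complex with rational coefficients. -/
abbrev rationalChains (X : Type) [TopologicalSpace X] : ChainComplex (ModuleCat.{0} ℚ) ℕ :=
  (TopCat.toSSet.obj (TopCat.of X)).chainComplex (ModuleCat.of ℚ ℚ)

/-- The map on singular chains induced by a continuous map. -/
abbrev rationalChainsMap {X Y : Type} [TopologicalSpace X] [TopologicalSpace Y] (f : C(X, Y)) :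
    rationalChains X ⟶ rationalChains Y :=
  SSet.chainComplexMap (TopCat.toSSet.map (TopCat.ofHom f)) (ModuleCat.of ℚ ℚ)

/-- The standard simplex. -/
abbrev TopSimplex (n : ℕ) := stdSimplex ℝ (Fin (n + 1))

/-- The generator of the singular chains given by a singular simplex. -/
def simplexGen {X : Type} [TopologicalSpace X] {n : ℕ} (σ : C(TopSimplex n, X)) :
    ModuleCat.of ℚ ℚ ⟶ (rationalChains X).X n :=
  SSet.ιChainComplex _ (((TopCat.of X).toSSetObjEquiv (.op ⦋n⦌)).symm σ)

theorem simplexGen_map {X Y : Type} [TopologicalSpace X] [TopologicalSpace Y] (f : C(X, Y)) {n : ℕ}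
    (σ : C(TopSimplex n, X)) :
    simplexGen σ ≫ (rationalChainsMap f).f n = simplexGen (f.comp σ) := by
  rw [simplexGen, SSet.ι_chainComplexMap_f]
  rfl

theorem simplexGen_hom_ext {X : Type} [TopologicalSpace X] {n : ℕ} {M : ModuleCat.{0} ℚ}
    {f g : (rationalChains X).X n ⟶ M} (h : ∀ σ : C(TopSimplex n, X),
      simplexGen σ ≫ f = simplexGen σ ≫ g) : f = g := by
  refine SSet.chainComplex_hom_ext fun x => ?_
  have := h ((TopCat.of X).toSSetObjEquiv (.op ⦋n⦌) x)
  simpa only [simplexGen, Equiv.symm_apply_apply] using this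

/-- The map out of the singular chains with prescribed values on the generators. -/
def simplexDesc {X : Type} [TopologicalSpace X] {n : ℕ} {M : ModuleCat.{0} ℚ}
    (u : C(TopSimplex n, X) → (ModuleCat.of ℚ ℚ ⟶ M)) : (rationalChains X).X n ⟶ M :=
  Cofan.IsColimit.desc (SSet.isColimitChainComplexXCofan _ _ n)
    fun x => u ((TopCat.of X).toSSetObjEquiv (.op ⦋n⦌) x)

theorem simplexGen_desc {X : Type} [TopologicalSpace X] {n : ℕ} {M : ModuleCat.{0} ℚ}
    (u : C(TopSimplex n, X) → (ModuleCat.of ℚ ℚ ⟶ M)) (σ : C(TopSimplex n, X)) :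
    simplexGen σ ≫ simplexDesc u = u σ := by
  have := Cofan.IsColimit.fac (SSet.isColimitChainComplexXCofan (TopCat.toSSet.obj (TopCat.of X))
    (ModuleCat.of ℚ ℚ) n) (fun x => u ((TopCat.of X).toSSetObjEquiv (.op ⦋n⦌) x))
    (((TopCat.of X).toSSetObjEquiv (.op ⦋n⦌)).symm σ)
  simp only [Equiv.apply_symm_apply] at this
  exact this

/-- `p : X → Y` is the quotient by a free action of `G` for which singular simplices lift, uniquely
up to `G`. -/
structure IsSimplexTorsor (G : Type*) {X Y : Type*} [Group G] [TopologicalSpace X]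
    [TopologicalSpace Y] [MulAction G X] [ContinuousConstSMul G X] (p : C(X, Y)) : Prop where
  exists_lift : ∀ (n : ℕ) (τ : C(TopSimplex n, Y)), ∃ σ : C(TopSimplex n, X), p.comp σ = τ
  exists_smul : ∀ (n : ℕ) (σ σ' : C(TopSimplex n, X)), p.comp σ = p.comp σ' → ∃ g : G, g • σ = σ'
  map_smul : ∀ (g : G) (x : X), p (g • x) = p x
  free : ∀ (g : G) (x : X), g • x = x → g = 1

section FreeQuotient

variable {S X Y : Type} [TopologicalSpace S] [DiscreteTopology S] [TopologicalSpace X]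
  [TopologicalSpace Y] [MulAction (FreeGroup S) X] [ContinuousConstSMul (FreeGroup S) X]

variable (S X) in
/-- The map `(x, s) ↦ s x`. -/
def generatorAct : C(X × S, X) where
  toFun q := FreeGroup.of q.2 • q.1
  continuous_toFun := by
    refine continuous_prod_of_discrete_right.2 fun s => ?_
    exact continuous_const_smul (FreeGroup.of s)

variable (p : C(X, Y)) (hp : IsSimplexTorsor (FreeGroup S) p)

/-- The sequence of singular chains of the quotient by a free action of a free group. -/
def freeQuotientComplex (hp : IsSimplexTorsor (FreeGroup S) p) :
    ShortComplex (ChainComplex (ModuleCat.{0} ℚ) ℕ) where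
  X₁ := rationalChains (X × S)
  X₂ := rationalChains X
  X₃ := rationalChains Y
  f := rationalChainsMap (generatorAct S X) - rationalChainsMap ContinuousMap.fst
  g := rationalChainsMap p
  zero := by
    ext n : 1
    refine simplexGen_hom_ext fun σ => ?_
    simp only [HomologicalComplex.comp_f, HomologicalComplex.sub_f_apply, Preadditive.sub_comp,
      Preadditive.comp_sub, ← Category.assoc, simplexGen_map, HomologicalComplex.zero_f, comp_zero]
    rw [sub_eq_zero]
    congr 1
    ext a
    exact hp.map_smul _ _

theorem freeQuotientComplex_shortExact : (freeQuotientComplex p hp).ShortExact := by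
  refine HomologicalComplex.shortExact_of_degreewise_shortExact _ fun n => ?_
  refine ShortComplex.Splitting.shortExact ?_
  choose lft hlft using hp.exists_lift n
  have hsm : ∀ σ : C(TopSimplex n, X), ∃ g : FreeGroup S, g • lft (p.comp σ) = σ := fun σ =>
    hp.exists_smul n _ _ (hlft _)
  choose γ hγ using hsm
  let a₀ : TopSimplex n := Classical.arbitrary _
  have hfree : ∀ (g h : FreeGroup S) (σ : C(TopSimplex n, X)), g • σ = h • σ → g = h := by
    intro g h σ e
    have e1 : (h⁻¹ * g) • σ a₀ = σ a₀ := by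
      rw [mul_smul]
      have := congrArg (fun ρ : C(TopSimplex n, X) => ρ a₀) e
      simp only [ContinuousMap.smul_apply] at this
      rw [this, inv_smul_smul]
    exact (inv_mul_eq_one.1 (hp.free _ _ e1)).symm
  have hpsm : ∀ (g : FreeGroup S) (σ : C(TopSimplex n, X)), p.comp (g • σ) = p.comp σ :=
    fun g σ => ContinuousMap.ext fun a => hp.map_smul g (σ a)
  have hγsm : ∀ (g : FreeGroup S) (σ : C(TopSimplex n, X)), γ (g • σ) = g * γ σ := by
    intro g σ
    refine hfree _ _ (lft (p.comp σ)) ?_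
    rw [mul_smul, hγ σ]
    have := hγ (g • σ)
    rwa [hpsm] at this
  let T : C(TopSimplex n, X) → S → C(TopSimplex n, X × S) := fun σ s =>
    σ.prodMk (ContinuousMap.const _ s)
  have hT : ∀ ρ : C(TopSimplex n, X × S), ∃ σ s, ρ = T σ s := fun ρ => by
    refine ⟨ContinuousMap.fst.comp ρ, (ρ a₀).2, ContinuousMap.ext fun a => Prod.ext rfl ?_⟩
    have : PreconnectedSpace (TopSimplex n) := inferInstance
    exact PreconnectedSpace.constant this (f := fun a => (ρ a).2) (by fun_prop)
  let R : C(TopSimplex n, X) → (ModuleCat.of ℚ ℚ ⟶ (rationalChains (X × S)).X n) := fun σ =>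
    (FreeGroup.pathChain (γ σ)).sum fun e m =>
      m • simplexGen (T (e.1 • lft (p.comp σ)) e.2)
  let F : (rationalChains (X × S)).X n ⟶ (rationalChains X).X n :=
    (rationalChainsMap (generatorAct S X)).f n - (rationalChainsMap ContinuousMap.fst).f n
  let P : (rationalChains X).X n ⟶ (rationalChains Y).X n := (rationalChainsMap p).f n
  have hf : ∀ σ s, simplexGen (T σ s) ≫ F =
      simplexGen (FreeGroup.of s • σ) - simplexGen σ := by
    intro σ s
    rw [Preadditive.comp_sub, simplexGen_map, simplexGen_map]
    rfl
  have hg : ∀ σ, simplexGen σ ≫ P = simplexGen (p.comp σ) :=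
    fun σ => simplexGen_map p σ
  let L : (rationalChains Y).X n ⟶ (rationalChains X).X n :=
    simplexDesc fun τ => simplexGen (lft τ)
  have f_r : F ≫ simplexDesc R = 𝟙 _ := by
    refine simplexGen_hom_ext fun ρ => ?_
    obtain ⟨σ, s, rfl⟩ := hT ρ
    rw [← Category.assoc, hf, Preadditive.sub_comp, simplexGen_desc, simplexGen_desc]
    simp only [R]
    have h0 : ∀ e : FreeGroup S × S,
        (0 : ℤ) • simplexGen (T (e.1 • lft (p.comp σ)) e.2) = 0 := fun e => zero_smul _ _
    have hadd : ∀ (e : FreeGroup S × S) (m m' : ℤ),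
        (m + m') • simplexGen (T (e.1 • lft (p.comp σ)) e.2) =
          m • simplexGen (T (e.1 • lft (p.comp σ)) e.2) +
            m' • simplexGen (T (e.1 • lft (p.comp σ)) e.2) := fun e m m' => add_smul _ _ _
    rw [hpsm, hγsm, FreeGroup.pathChain_of_mul, Finsupp.sum_add_index' h0 hadd,
      Finsupp.sum_single_index (h0 _), one_smul, add_sub_cancel_left, hγ, Category.comp_id]
  have s_g : L ≫ P = 𝟙 _ := by
    refine simplexGen_hom_ext fun τ => ?_
    rw [← Category.assoc, simplexGen_desc, hg, hlft, Category.comp_id]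
  have hid : simplexDesc R ≫ F + P ≫ L = 𝟙 _ := by
    refine simplexGen_hom_ext fun σ => ?_
    rw [Preadditive.comp_add, ← Category.assoc, ← Category.assoc, simplexGen_desc, hg,
      simplexGen_desc]
    simp only [R, Finsupp.sum, Preadditive.sum_comp, Preadditive.zsmul_comp, hf, ← mul_smul]
    have := FreeGroup.pathChain_sum_sub
      (fun g => simplexGen (g • lft (p.comp σ))) (γ σ)
    simp only [Finsupp.sum] at this
    rw [this, hγ, one_smul, sub_add_cancel, Category.comp_id]
  exact { r := simplexDesc R, s := L, f_r := f_r, s_g := s_g, id := hid }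

end FreeQuotient

end

noncomputable section

open CategoryTheory AlgebraicTopology Limits Simplicial

/-! ### Euler characteristics in short exact sequences -/

/-- The long exact homology sequence of a short exact sequence of complexes of vector spaces, as a
relation between dimensions: `r i` is the rank of the map `H_i(X₁) → H_i(X₂)`. -/
theorem finrank_homology_of_shortExact {K : ShortComplex (ChainComplex (ModuleCat.{0} ℚ) ℕ)}
    (hK : K.ShortExact) (h₁ : ∀ i, Module.Finite ℚ (K.X₁.homology i))
    (h₂ : ∀ i, Module.Finite ℚ (K.X₂.homology i)) :
    ∃ r : ℕ → ℕ, (∀ i, r i ≤ Module.finrank ℚ (K.X₁.homology i)) ∧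
      (∀ i, r i ≤ Module.finrank ℚ (K.X₂.homology i)) ∧
      (∀ i, Module.Finite ℚ (K.X₃.homology i)) ∧
      (Module.finrank ℚ (K.X₃.homology 0) + r 0 = Module.finrank ℚ (K.X₂.homology 0)) ∧
      ∀ i, Module.finrank ℚ (K.X₃.homology (i + 1)) + r (i + 1) + r i =
        Module.finrank ℚ (K.X₂.homology (i + 1)) + Module.finrank ℚ (K.X₁.homology i) := by
  let f := fun i => (HomologicalComplex.homologyMap K.f i).hom
  let g := fun i => (HomologicalComplex.homologyMap K.g i).hom
  have e₂ : ∀ i, LinearMap.range (f i) = LinearMap.ker (g i) := fun i =>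
    (hK.homology_exact₂ i).moduleCat_range_eq_ker
  have hrel : ∀ i, (ComplexShape.down ℕ).Rel (i + 1) i := fun i => rfl
  let δ := fun i => (hK.δ (i + 1) i (hrel i)).hom
  have e₁ : ∀ i, LinearMap.range (δ i) = LinearMap.ker (f i) := fun i =>
    (hK.homology_exact₁ (i + 1) i (hrel i)).moduleCat_range_eq_ker
  have e₃ : ∀ i, LinearMap.range (g (i + 1)) = LinearMap.ker (δ i) := fun i =>
    (hK.homology_exact₃ (i + 1) i (hrel i)).moduleCat_range_eq_ker
  have e₀ : Function.Surjective (g 0) := by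
    have hepi : Epi K.g := hK.epi_g
    have h0 : Epi (K.g.f 0) := inferInstance
    have i₂ : IsIso (K.X₂.iCycles 0) := K.X₂.isIso_iCycles 0 0 (by simp) (K.X₂.shape _ _ (by simp))
    have i₃ : IsIso (K.X₃.iCycles 0) := K.X₃.isIso_iCycles 0 0 (by simp) (K.X₃.shape _ _ (by simp))
    have h1 : Epi (HomologicalComplex.cyclesMap K.g 0) := by
      have : Epi (HomologicalComplex.cyclesMap K.g 0 ≫ K.X₃.iCycles 0) := by
        rw [HomologicalComplex.cyclesMap_i]
        exact epi_comp _ _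
      rw [show HomologicalComplex.cyclesMap K.g 0 =
        (HomologicalComplex.cyclesMap K.g 0 ≫ K.X₃.iCycles 0) ≫ inv (K.X₃.iCycles 0) by
          rw [Category.assoc, IsIso.hom_inv_id, Category.comp_id]]
      exact epi_comp _ _
    have h3 : Epi (K.X₂.homologyπ 0 ≫ HomologicalComplex.homologyMap K.g 0) := by
      rw [HomologicalComplex.homologyπ_naturality]
      exact epi_comp _ _
    have h4 : Epi (HomologicalComplex.homologyMap K.g 0) :=
      epi_of_epi (K.X₂.homologyπ 0) (HomologicalComplex.homologyMap K.g 0)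
    exact (ModuleCat.epi_iff_surjective _).1 h4
  have hfin : ∀ i, Module.Finite ℚ (K.X₃.homology i) := by
    intro i
    cases i with
    | zero => exact Module.Finite.of_surjective (g 0) e₀
    | succ i =>
      have a : Module.Finite ℚ (LinearMap.ker (δ i)) := by
        rw [← e₃]; infer_instance
      have b : Module.Finite ℚ (LinearMap.range (δ i)) := inferInstance
      have : Module.Finite ℚ (_ ⧸ LinearMap.ker (δ i)) :=
        Module.Finite.equiv (δ i).quotKerEquivRange.symm
      exact Module.Finite.of_submodule_quotient (LinearMap.ker (δ i))
  refine ⟨fun i => Module.finrank ℚ (LinearMap.range (f i)), fun i => ?_, fun i => ?_, hfin, ?_,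
    fun i => ?_⟩
  · exact LinearMap.finrank_range_le (f i)
  · exact Submodule.finrank_le _
  · have h := (g 0).finrank_range_add_finrank_ker
    rw [LinearMap.range_eq_top.2 e₀, finrank_top] at h
    show _ + Module.finrank ℚ (LinearMap.range (f 0)) = _
    rw [e₂ 0]
    exact h
  · have h1 := (g (i + 1)).finrank_range_add_finrank_ker
    have h2 := (δ i).finrank_range_add_finrank_ker
    have h3 := (f i).finrank_range_add_finrank_ker
    have s1 : Module.finrank ℚ (LinearMap.range (g (i + 1))) = Module.finrank ℚ (LinearMap.ker (δ i)) := by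
      rw [e₃ i]
    have s2 : Module.finrank ℚ (LinearMap.range (δ i)) = Module.finrank ℚ (LinearMap.ker (f i)) := by
      rw [e₁ i]
    have s3 : Module.finrank ℚ (LinearMap.range (f (i + 1))) =
        Module.finrank ℚ (LinearMap.ker (g (i + 1))) := by rw [e₂ (i + 1)]
    show _ + Module.finrank ℚ (LinearMap.range (f (i + 1))) +
      Module.finrank ℚ (LinearMap.range (f i)) = _
    change _ = Module.finrank ℚ (K.X₂.homology (i + 1)) at h1
    change _ = Module.finrank ℚ (K.X₃.homology (i + 1)) at h2
    change _ = Module.finrank ℚ (K.X₁.homology i) at h3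
    omega

theorem HasEulerCharacteristic.of_linearEquiv {X Y : Type} [TopologicalSpace X]
    [TopologicalSpace Y] {χ : ℤ} (h : HasEulerCharacteristic X χ)
    (e : ∀ i, Nonempty (rationalHomology X i ≃ₗ[ℚ] rationalHomology Y i)) :
    HasEulerCharacteristic Y χ := by
  obtain ⟨hf, N, hN, hs⟩ := h
  refine ⟨fun i => ?_, N, fun i hi => ?_, ?_⟩
  · have := hf i
    exact Module.Finite.equiv (e i).some
  · have := hN i hi
    exact (e i).some.symm.injective.subsingleton
  · rw [← hs]
    refine Finset.sum_congr rfl fun i _ => ?_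
    rw [(e i).some.finrank_eq]

theorem HasEulerCharacteristic.of_homotopyEquiv {X Y : Type} [TopologicalSpace X]
    [TopologicalSpace Y] {χ : ℤ} (h : HasEulerCharacteristic X χ)
    (e : ContinuousMap.HomotopyEquiv X Y) : HasEulerCharacteristic Y χ := by
  refine h.of_linearEquiv fun i => ⟨?_⟩
  let F := (singularHomologyFunctor (ModuleCat.{0} ℚ) i).obj (ModuleCat.of ℚ ℚ)
  have key : ∀ {A B : Type} [TopologicalSpace A] [TopologicalSpace B] (f g : C(A, B)),
      f.Homotopic g → F.map (TopCat.ofHom f) = F.map (TopCat.ofHom g) := by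
    rintro A B _ _ f g ⟨H⟩
    exact TopCat.Homotopy.congr_homologyMap_singularChainComplexFunctor
      (f := TopCat.ofHom f) (g := TopCat.ofHom g) H _ i
  have h1 : F.map (TopCat.ofHom e.toFun) ≫ F.map (TopCat.ofHom e.invFun) = 𝟙 _ := by
    rw [← F.map_comp, ← F.map_id]
    exact key _ _ e.left_inv
  have h2 : F.map (TopCat.ofHom e.invFun) ≫ F.map (TopCat.ofHom e.toFun) = 𝟙 _ := by
    rw [← F.map_comp, ← F.map_id]
    exact key _ _ e.right_inv
  exact (Iso.mk _ _ h1 h2).toLinearEquiv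

/-- Both the homology and the Euler characteristic of the quotient by a free action of a free group
are controlled by those of the total space. -/
theorem HasEulerCharacteristic.of_isSimplexTorsor {S X Y : Type} [TopologicalSpace S]
    [DiscreteTopology S] [TopologicalSpace X] [TopologicalSpace Y] [MulAction (FreeGroup S) X]
    [ContinuousConstSMul (FreeGroup S) X] {p : C(X, Y)} (hp : IsSimplexTorsor (FreeGroup S) p)
    {χ₁ χ₂ : ℤ} (h₁ : HasEulerCharacteristic (X × S) χ₁) (h₂ : HasEulerCharacteristic X χ₂) :
    HasEulerCharacteristic Y (χ₂ - χ₁) := by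
  obtain ⟨f₁, N₁, z₁, s₁⟩ := h₁
  obtain ⟨f₂, N₂, z₂, s₂⟩ := h₂
  obtain ⟨r, hr₁, hr₂, hfin, h0, hsucc⟩ :=
    finrank_homology_of_shortExact (freeQuotientComplex_shortExact p hp) f₁ f₂
  change ∀ i, r i ≤ Module.finrank ℚ (rationalHomology (X × S) i) at hr₁
  change ∀ i, r i ≤ Module.finrank ℚ (rationalHomology X i) at hr₂
  change ∀ i, Module.Finite ℚ (rationalHomology Y i) at hfin
  change Module.finrank ℚ (rationalHomology Y 0) + _ =
    Module.finrank ℚ (rationalHomology X 0) at h0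
  change ∀ i, Module.finrank ℚ (rationalHomology Y (i + 1)) + _ + _ =
    Module.finrank ℚ (rationalHomology X (i + 1)) +
      Module.finrank ℚ (rationalHomology (X × S) i) at hsucc
  obtain ⟨b₁, hd₁⟩ : ∃ b : ℕ → ℕ, ∀ i, Module.finrank ℚ (rationalHomology (X × S) i) = b i :=
    ⟨_, fun _ => rfl⟩
  obtain ⟨b₂, hd₂⟩ : ∃ b : ℕ → ℕ, ∀ i, Module.finrank ℚ (rationalHomology X i) = b i :=
    ⟨_, fun _ => rfl⟩
  obtain ⟨b₃, hd₃⟩ : ∃ b : ℕ → ℕ, ∀ i, Module.finrank ℚ (rationalHomology Y i) = b i :=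
    ⟨_, fun _ => rfl⟩
  have hz₁ : ∀ i, N₁ ≤ i → b₁ i = 0 := fun i hi => by
    rw [← hd₁]; have := z₁ i hi; exact Module.finrank_zero_of_subsingleton
  have hz₂ : ∀ i, N₂ ≤ i → b₂ i = 0 := fun i hi => by
    rw [← hd₂]; have := z₂ i hi; exact Module.finrank_zero_of_subsingleton
  simp only [hd₁, hd₂, hd₃] at hr₁ hr₂ h0 hsucc s₁ s₂
  have hpart : ∀ N : ℕ, ∑ i ∈ Finset.range (N + 1), (-1 : ℤ) ^ i * (b₃ i : ℤ) =
      ∑ i ∈ Finset.range (N + 1), (-1 : ℤ) ^ i * (b₂ i : ℤ) -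
        ∑ i ∈ Finset.range N, (-1 : ℤ) ^ i * (b₁ i : ℤ) - (-1 : ℤ) ^ N * r N := by
    intro N
    induction N with
    | zero => simp; omega
    | succ N ih =>
      rw [Finset.sum_range_succ, ih, Finset.sum_range_succ _ (N + 1),
        Finset.sum_range_succ _ N, Finset.sum_range_succ (fun i => (-1 : ℤ) ^ i * (b₁ i : ℤ)) N]
      have := hsucc N
      have h3 : (b₃ (N + 1) : ℤ) = b₂ (N + 1) + b₁ N - r (N + 1) - r N := by omega
      rw [h3, pow_succ]
      ring
  have hext : ∀ (b : ℕ → ℕ) (N M : ℕ), N ≤ M → (∀ i, N ≤ i → b i = 0) →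
      ∑ i ∈ Finset.range M, (-1 : ℤ) ^ i * (b i : ℤ) =
        ∑ i ∈ Finset.range N, (-1 : ℤ) ^ i * (b i : ℤ) := by
    intro b N M hNM hb
    refine (Finset.sum_subset (Finset.range_mono hNM) fun i _ hi => ?_).symm
    rw [hb i (by simpa using hi)]; simp
  refine ⟨hfin, N₁ + N₂ + 1, fun i hi => ?_, ?_⟩
  · have : b₃ i = 0 := by
      obtain ⟨j, rfl⟩ : ∃ j, i = j + 1 := ⟨i - 1, by omega⟩
      have := hsucc j
      rw [hz₁ j (by omega), hz₂ (j + 1) (by omega)] at this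
      omega
    rw [← hd₃] at this
    have hf := hfin i
    exact Module.finrank_zero_iff.1 this
  · simp only [hd₃]
    rw [hpart, hext b₂ N₂ _ (by omega) hz₂, hext b₁ N₁ _ (by omega) hz₁, s₁, s₂]
    have : r (N₁ + N₂) = 0 := by
      have := hr₁ (N₁ + N₂)
      rw [hz₁ _ (by omega)] at this
      omega
    rw [this]; simp

theorem HasEulerCharacteristic.exists_of_discrete (D : Type) [TopologicalSpace D]
    [DiscreteTopology D] [Finite D] : ∃ χ, HasEulerCharacteristic D χ := by
  refine ⟨_, fun i => ?_, 1, fun i hi => ?_, rfl⟩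
  · by_cases hi : i = 0
    · subst hi
      have := Fintype.ofFinite D
      classical
      let e := singularHomologyFunctorZeroOfTotallyDisconnectedSpace (ModuleCat.{0} ℚ)
        (ModuleCat.of ℚ ℚ) (TopCat.of D) ≪≫ ModuleCat.coprodIsoDirectSum
          (fun _ : D => ModuleCat.of ℚ ℚ)
      have : Module.Finite ℚ (DirectSum D fun _ : D => ℚ) :=
        inferInstanceAs (Module.Finite ℚ (Π₀ _ : D, ℚ))
      exact Module.Finite.equiv e.toLinearEquiv.symm
    · have := ModuleCat.subsingleton_of_isZero
        (isZero_singularHomologyFunctor_of_totallyDisconnectedSpace (ModuleCat.{0} ℚ) i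
          (ModuleCat.of ℚ ℚ) (TopCat.of D) hi)
      change Subsingleton (rationalHomology D i) at this
      infer_instance
  · exact ModuleCat.subsingleton_of_isZero
      (isZero_singularHomologyFunctor_of_totallyDisconnectedSpace (ModuleCat.{0} ℚ) i
        (ModuleCat.of ℚ ℚ) (TopCat.of D) (by omega))

instance topSimplex_contractibleSpace (n : ℕ) : ContractibleSpace (TopSimplex n) :=
  (convex_stdSimplex ℝ (Fin (n + 1))).contractibleSpace ⟨_, single_mem_stdSimplex ℝ 0⟩

theorem IsSimplexTorsor.of_isLocallyInjective {G X Y : Type*} [Group G] [TopologicalSpace X]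
    [T2Space X] [TopologicalSpace Y] [MulAction G X] [ContinuousConstSMul G X] (p : C(X, Y))
    (hl : ∀ (n : ℕ) (τ : C(TopSimplex n, Y)), ∃ σ : C(TopSimplex n, X), p.comp σ = τ)
    (hi : IsLocallyInjective p) (hs : ∀ (g : G) (x : X), p (g • x) = p x)
    (hf : ∀ x y, p x = p y → ∃ g : G, g • x = y) (hfree : ∀ (g : G) (x : X), g • x = x → g = 1) :
    IsSimplexTorsor G p where
  exists_lift := hl
  exists_smul n σ σ' h := by
    let a₀ : TopSimplex n := Classical.arbitrary _
    obtain ⟨g, hg⟩ := hf (σ a₀) (σ' a₀) (congrArg (fun f : C(TopSimplex n, Y) => f a₀) h)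
    refine ⟨g, DFunLike.coe_injective ?_⟩
    refine (T2Space.isSeparatedMap p).eq_of_comp_eq hi (map_continuous _) σ'.continuous ?_ a₀ hg
    funext a
    exact (hs g (σ a)).trans (congrArg (fun f : C(TopSimplex n, Y) => f a) h)
  map_smul := hs
  free := hfree

/-- The product of `p` with a space on which the group acts trivially. -/
theorem IsSimplexTorsor.prod_trivial {G X Y D : Type*} [Group G] [TopologicalSpace X]
    [TopologicalSpace Y] [TopologicalSpace D] [MulAction G X] [ContinuousConstSMul G X]
    [MulAction G D] [ContinuousConstSMul G D] (hD : ∀ (g : G) (d : D), g • d = d)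
    {p : C(X, Y)} (hp : IsSimplexTorsor G p) :
    IsSimplexTorsor G (p.prodMap (ContinuousMap.id D)) where
  exists_lift n τ := by
    obtain ⟨σ, hσ⟩ := hp.exists_lift n (ContinuousMap.fst.comp τ)
    exact ⟨σ.prodMk (ContinuousMap.snd.comp τ), ContinuousMap.ext fun a =>
      Prod.ext (congrArg (fun f : C(TopSimplex n, Y) => f a) hσ) rfl⟩
  exists_smul n σ σ' h := by
    obtain ⟨g, hg⟩ := hp.exists_smul n (ContinuousMap.fst.comp σ) (ContinuousMap.fst.comp σ')
      (ContinuousMap.ext fun a =>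
        congrArg (fun f : C(TopSimplex n, Y × D) => (f a).1) h)
    refine ⟨g, ContinuousMap.ext fun a => Prod.ext
      (congrArg (fun f : C(TopSimplex n, X) => f a) hg) ?_⟩
    exact (hD g _).trans (congrArg (fun f : C(TopSimplex n, Y × D) => (f a).2) h)
  map_smul g x := Prod.ext (hp.map_smul g x.1) (hD g x.2)
  free g x h := hp.free g x.1 (congrArg Prod.fst h)

/-- Stable version of "finite total homology": it holds for the products with all finite sets. -/
def HasFiniteHomology (X : Type) [TopologicalSpace X] : Prop :=
  ∀ (D : Type) [TopologicalSpace D] [DiscreteTopology D] [Finite D],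
    ∃ χ, HasEulerCharacteristic (X × D) χ

/-- Stable version of "the Euler characteristic vanishes". -/
def HasVanishingEuler (X : Type) [TopologicalSpace X] : Prop :=
  ∀ (D : Type) [TopologicalSpace D] [DiscreteTopology D] [Finite D],
    HasEulerCharacteristic (X × D) 0

theorem HasVanishingEuler.hasFiniteHomology {X : Type} [TopologicalSpace X]
    (h : HasVanishingEuler X) : HasFiniteHomology X := fun D _ _ _ => ⟨0, h D⟩

theorem HasVanishingEuler.hasEulerCharacteristic {X : Type} [TopologicalSpace X]
    (h : HasVanishingEuler X) : HasEulerCharacteristic X 0 :=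
  (h Unit).of_homotopyEquiv (Homeomorph.prodUnique X Unit).toHomotopyEquiv

theorem HasVanishingEuler.of_homotopyEquiv {X Y : Type} [TopologicalSpace X] [TopologicalSpace Y]
    (h : HasVanishingEuler X) (e : ContinuousMap.HomotopyEquiv X Y) : HasVanishingEuler Y :=
  fun D _ _ _ => (h D).of_homotopyEquiv (e.prodCongr (.refl D))

theorem HasFiniteHomology.of_homotopyEquiv {X Y : Type} [TopologicalSpace X] [TopologicalSpace Y]
    (h : HasFiniteHomology X) (e : ContinuousMap.HomotopyEquiv X Y) : HasFiniteHomology Y :=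
  fun D _ _ _ => ⟨_, (h D).choose_spec.of_homotopyEquiv (e.prodCongr (.refl D))⟩

theorem HasFiniteHomology.of_discrete (D : Type) [TopologicalSpace D] [DiscreteTopology D]
    [Finite D] : HasFiniteHomology D := fun D' _ _ _ =>
  HasEulerCharacteristic.exists_of_discrete (D × D')

section

variable {S X Y : Type} [TopologicalSpace S] [DiscreteTopology S] [TopologicalSpace X]
  [TopologicalSpace Y] [MulAction (FreeGroup S) X] [ContinuousConstSMul (FreeGroup S) X]

theorem HasEulerCharacteristic.prod_of_isSimplexTorsor {D : Type} [TopologicalSpace D]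
    {p : C(X, Y)} (hp : IsSimplexTorsor (FreeGroup S) p) {χ₁ χ₂ : ℤ}
    (h₁ : HasEulerCharacteristic (X × (D × S)) χ₁) (h₂ : HasEulerCharacteristic (X × D) χ₂) :
    HasEulerCharacteristic (Y × D) (χ₂ - χ₁) := by
  let _ : MulAction (FreeGroup S) D :=
    { smul := fun _ d => d, one_smul := fun _ => rfl, mul_smul := fun _ _ _ => rfl }
  have : ContinuousConstSMul (FreeGroup S) D := ⟨fun _ => continuous_id⟩
  exact HasEulerCharacteristic.of_isSimplexTorsor (hp.prod_trivial (D := D) fun _ _ => rfl)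
    (h₁.of_homotopyEquiv (Homeomorph.prodAssoc X D S).symm.toHomotopyEquiv) h₂

theorem HasVanishingEuler.of_isSimplexTorsor [Finite S] {p : C(X, Y)}
    (hp : IsSimplexTorsor (FreeGroup S) p) (h : HasVanishingEuler X) : HasVanishingEuler Y :=
  fun D _ _ _ => by
    simpa using HasEulerCharacteristic.prod_of_isSimplexTorsor hp (h (D × S)) (h D)

/-- The Euler characteristic of the quotient by a free action of an infinite cyclic group
vanishes. -/
theorem HasVanishingEuler.of_isSimplexTorsor_of_unique [Unique S] {p : C(X, Y)}
    (hp : IsSimplexTorsor (FreeGroup S) p) (h : HasFiniteHomology X) : HasVanishingEuler Y :=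
  fun D _ _ _ => by
    obtain ⟨χ, hχ⟩ := h D
    have := hχ.of_homotopyEquiv
      ((Homeomorph.refl X).prodCongr (Homeomorph.prodUnique D S).symm).toHomotopyEquiv
    simpa using HasEulerCharacteristic.prod_of_isSimplexTorsor hp this hχ

end

end

noncomputable section

/-! ### The Cayley tree of a free group -/

namespace FreeGroup

set_option linter.unusedSectionVars false

variable {S : Type*}

/-- The homomorphism to the integers that maps all generators to `1`. -/
def height (g : FreeGroup S) : ℤ := Multiplicative.toAdd (lift (fun _ => Multiplicative.ofAdd 1) g)

@[simp] theorem height_one : height (1 : FreeGroup S) = 0 := by simp [height]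

@[simp] theorem height_mul (g g' : FreeGroup S) : height (g * g') = height g + height g' := by
  simp [height]

@[simp] theorem height_inv (g : FreeGroup S) : height g⁻¹ = -height g := by simp [height]

@[simp] theorem height_of (s : S) : height (of s) = 1 := by simp [height]

@[simp] theorem height_zpow (g : FreeGroup S) (n : ℤ) : height (g ^ n) = n * height g := by
  simp [height]

theorem induction_mul_right {P : FreeGroup S → Prop} (h1 : P 1)
    (hof : ∀ s g, P g → P (g * of s)) (hinv : ∀ s g, P g → P (g * (of s)⁻¹)) (g : FreeGroup S) :
    P g := by
  have h : ∀ x : FreeGroup S, P x⁻¹ := fun x => induction_mul_left (P := fun x => P x⁻¹)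
    (by simpa using h1) (fun s g hg => by simpa using hinv s _ hg)
    (fun s g hg => by simpa using hof s _ hg) x
  simpa using h g⁻¹

variable [DecidableEq S]

theorem even_norm_add_height (w : FreeGroup S) : Even ((norm w : ℤ) + height w) := by
  have h : ∀ L : List (S × Bool), Even ((L.length : ℤ) + height (mk L)) := by
    intro L
    induction L with
    | nil => simp [← one_eq_mk]
    | cons x L ih =>
      have : mk (x :: L) = mk [x] * mk L := by simp
      rw [this, height_mul]
      have h1 : height (mk [x]) = 1 ∨ height (mk [x]) = -1 := by
        obtain ⟨s, b⟩ := x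
        cases b
        · right
          have : mk [(s, false)] = (of s)⁻¹ := rfl
          simp [this]
        · left; exact height_of s
      rw [Int.even_iff] at ih ⊢
      simp only [List.length_cons]
      push_cast
      omega
  have := h w.toWord
  rwa [mk_toWord] at this

theorem norm_mul_of (w : FreeGroup S) (s : S) :
    norm (w * of s) = norm w + 1 ∨ norm w = norm (w * of s) + 1 := by
  have h1 := norm_mul_le w (of s)
  have h2 := norm_mul_le (w * of s) (of s)⁻¹
  rw [mul_inv_cancel_right, norm_inv_eq] at h2
  rw [norm_of] at h1 h2
  have h3 := even_norm_add_height w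
  have h4 := even_norm_add_height (w * of s)
  rw [height_mul, height_of] at h4
  rw [Int.even_iff] at h3 h4
  omega

theorem norm_induction {P : FreeGroup S → Prop} (h1 : P 1)
    (hof : ∀ w s, norm (w * of s) = norm w + 1 → P w → P (w * of s))
    (hinv : ∀ w s, norm (w * (of s)⁻¹) = norm w + 1 → P w → P (w * (of s)⁻¹)) (w : FreeGroup S) :
    P w := by
  induction hn : norm w generalizing w with
  | zero => rw [norm_eq_zero.1 hn]; exact h1
  | succ n ih =>
    have hne : w.toWord ≠ [] := by
      intro h
      rw [norm, h] at hn
      simp at hn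
    obtain ⟨L, ⟨s, b⟩, hL⟩ : ∃ L x, w.toWord = L ++ [x] :=
      ⟨_, _, (List.dropLast_append_getLast hne).symm⟩
    have hw : w = mk L * mk [(s, b)] := by rw [mul_mk, ← hL, mk_toWord]
    have hu : norm (mk L) ≤ n := by
      refine norm_mk_le.trans ?_
      have : norm w = L.length + 1 := by rw [norm, hL]; simp
      omega
    cases b with
    | false =>
      have hw : w = mk L * (of s)⁻¹ := hw
      have h2 := norm_mul_le (mk L) (of s)⁻¹
      rw [← hw, norm_inv_eq, norm_of] at h2
      rw [hw]
      exact hinv _ _ (by rw [← hw]; omega) (ih _ (by omega))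
    | true =>
      have hw : w = mk L * of s := hw
      have h2 := norm_mul_le (mk L) (of s)
      rw [← hw, norm_of] at h2
      rw [hw]
      exact hof _ _ (by rw [← hw]; omega) (ih _ (by omega))

/-- The vertex `w` of the Cayley tree, as the `1`-chain from `1` to `w`. -/
def treeVertex (w : FreeGroup S) : FreeGroup S × S → ℝ := fun e =>
  -((pathChain w⁻¹ ((e.1 * of e.2)⁻¹, e.2) : ℤ) : ℝ)

theorem treeVertex_one : treeVertex (1 : FreeGroup S) = 0 := by
  funext e; simp [treeVertex]

theorem treeVertex_mul_of (w : FreeGroup S) (s : S) :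
    treeVertex (w * of s) = treeVertex w + Pi.single (w, s) 1 := by
  funext ⟨v, s'⟩
  have h := pathChain_of_mul s (w * of s)⁻¹
  rw [show of s * (w * of s)⁻¹ = w⁻¹ by group] at h
  simp only [treeVertex, h, Pi.add_apply, Finsupp.add_apply, Pi.single_apply,
    Finsupp.single_apply, Prod.mk.injEq]
  have : ((w * of s)⁻¹ = (v * of s')⁻¹ ∧ s = s') ↔ (v = w ∧ s' = s) := by
    constructor
    · rintro ⟨h, rfl⟩; exact ⟨(mul_right_cancel (inv_injective h)).symm, rfl⟩
    · rintro ⟨rfl, rfl⟩; exact ⟨rfl, rfl⟩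
  simp only [this]
  split_ifs <;> push_cast <;> ring

theorem treeVertex_mul_of_inv (w : FreeGroup S) (s : S) :
    treeVertex (w * (of s)⁻¹) = treeVertex w - Pi.single (w * (of s)⁻¹, s) 1 := by
  have h := treeVertex_mul_of (w * (of s)⁻¹) s
  rw [inv_mul_cancel_right] at h
  rw [h]; abel

theorem exists_treeVertex_eq_intCast (w : FreeGroup S) (e : FreeGroup S × S) :
    ∃ n : ℤ, treeVertex w e = n := ⟨-pathChain w⁻¹ ((e.1 * of e.2)⁻¹, e.2), by simp [treeVertex]⟩

/-- The distance from `1` to the edge `e` of the Cayley tree. -/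
def depth (e : FreeGroup S × S) : ℕ := min (norm e.1) (norm (e.1 * of e.2))

theorem depth_of_norm_mul_of {w : FreeGroup S} {s : S} (h : norm (w * of s) = norm w + 1) :
    depth (w, s) = norm w := by simp [depth, h]

theorem depth_of_norm_mul_of_inv {w : FreeGroup S} {s : S}
    (h : norm (w * (of s)⁻¹) = norm w + 1) : depth (w * (of s)⁻¹, s) = norm w := by
  simp [depth, h]

theorem depth_one_left (s : S) : depth ((1 : FreeGroup S), s) = 0 := by simp [depth]

theorem depth_of_inv (s : S) : depth ((of s)⁻¹, s) = 0 := by simp [depth]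

theorem treeVertex_eq_zero_of_depth (w : FreeGroup S) :
    ∀ e, norm w ≤ depth e → treeVertex w e = 0 := by
  induction w using norm_induction with
  | h1 => intro e _; rw [treeVertex_one]; rfl
  | hof w s h ih =>
    intro e he
    have : e ≠ (w, s) := by rintro rfl; rw [depth_of_norm_mul_of h] at he; omega
    rw [treeVertex_mul_of, Pi.add_apply, ih e (by omega), Pi.single_eq_of_ne this, add_zero]
  | hinv w s h ih =>
    intro e he
    have : e ≠ (w * (of s)⁻¹, s) := by
      rintro rfl; rw [depth_of_norm_mul_of_inv h] at he; omega
    rw [treeVertex_mul_of_inv, Pi.sub_apply, ih e (by omega), Pi.single_eq_of_ne this, sub_zero]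

theorem abs_treeVertex_le (w : FreeGroup S) : ∀ e, |treeVertex w e| ≤ 1 := by
  induction w using norm_induction with
  | h1 => intro e; rw [treeVertex_one]; simp
  | hof w s h ih =>
    intro e
    rw [treeVertex_mul_of, Pi.add_apply]
    by_cases he : e = (w, s)
    · rw [treeVertex_eq_zero_of_depth w e (by rw [he, depth_of_norm_mul_of h]), he]; simp
    · rw [Pi.single_eq_of_ne he, add_zero]; exact ih e
  | hinv w s h ih =>
    intro e
    rw [treeVertex_mul_of_inv, Pi.sub_apply]
    by_cases he : e = (w * (of s)⁻¹, s)
    · rw [treeVertex_eq_zero_of_depth w e (by rw [he, depth_of_norm_mul_of_inv h]), he]; simp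
    · rw [Pi.single_eq_of_ne he, sub_zero]; exact ih e

theorem exists_one_le_abs_treeVertex (w : FreeGroup S) (hw : w ≠ 1) :
    ∃ s : S, 1 ≤ |treeVertex w (1, s)| ∨ 1 ≤ |treeVertex w ((of s)⁻¹, s)| := by
  induction w using norm_induction with
  | h1 => exact absurd rfl hw
  | hof w s h ih =>
    by_cases h1 : w = 1
    · subst h1
      refine ⟨s, Or.inl ?_⟩
      rw [treeVertex_mul_of, treeVertex_one]; simp
    · obtain ⟨s', hs'⟩ := ih h1
      have hn : norm w ≠ 0 := fun h => h1 (norm_eq_zero.1 h)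
      have hd := depth_of_norm_mul_of h
      have e1 : ((1 : FreeGroup S), s') ≠ (w, s) := fun h => by
        rw [← h, depth_one_left] at hd; omega
      have e2 : ((of s')⁻¹, s') ≠ (w, s) := fun h => by
        rw [← h, depth_of_inv] at hd; omega
      refine ⟨s', ?_⟩
      rw [treeVertex_mul_of, Pi.add_apply, Pi.add_apply, Pi.single_eq_of_ne e1,
        Pi.single_eq_of_ne e2, add_zero, add_zero]
      exact hs'
  | hinv w s h ih =>
    by_cases h1 : w = 1
    · subst h1
      refine ⟨s, Or.inr ?_⟩
      rw [treeVertex_mul_of_inv, treeVertex_one]; simp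
    · obtain ⟨s', hs'⟩ := ih h1
      have hn : norm w ≠ 0 := fun h => h1 (norm_eq_zero.1 h)
      have hd := depth_of_norm_mul_of_inv h
      have e1 : ((1 : FreeGroup S), s') ≠ (w * (of s)⁻¹, s) := fun h => by
        rw [← h, depth_one_left] at hd; omega
      have e2 : ((of s')⁻¹, s') ≠ (w * (of s)⁻¹, s) := fun h => by
        rw [← h, depth_of_inv] at hd; omega
      refine ⟨s', ?_⟩
      rw [treeVertex_mul_of_inv, Pi.sub_apply, Pi.sub_apply, Pi.single_eq_of_ne e1,
        Pi.single_eq_of_ne e2, sub_zero, sub_zero]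
      exact hs'

theorem finite_support_treeVertex (w : FreeGroup S) : (Function.support (treeVertex w)).Finite := by
  have hs : ∀ (e : FreeGroup S × S) (x : ℝ), (Function.support (Pi.single e x)).Finite :=
    fun e x => (Set.finite_singleton e).subset Pi.support_single_subset
  induction w using induction_mul_right with
  | h1 => simp [treeVertex_one]
  | hof s w ih =>
    rw [treeVertex_mul_of]
    exact (ih.union (hs _ _)).subset (Function.support_add _ _)
  | hinv s w ih =>
    rw [treeVertex_mul_of_inv]
    exact (ih.union (hs _ _)).subset (Function.support_sub _ _)

theorem finsum_single (e : FreeGroup S × S) (x : ℝ) : ∑ᶠ e', (Pi.single e x : _ → ℝ) e' = x := by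
  rw [finsum_eq_single _ e fun e' h => Pi.single_eq_of_ne h _, Pi.single_eq_same]

theorem finsum_treeVertex_add_single (w : FreeGroup S) (e : FreeGroup S × S) (x : ℝ) :
    ∑ᶠ e', (treeVertex w + Pi.single e x : FreeGroup S × S → ℝ) e' = ∑ᶠ e', treeVertex w e' + x := by
  simp only [Pi.add_apply]
  rw [finsum_add_distrib (finite_support_treeVertex w)
    ((Set.finite_singleton e).subset Pi.support_single_subset), finsum_single]

theorem finsum_treeVertex (w : FreeGroup S) : ∑ᶠ e, treeVertex w e = height w := by
  have h1 : ∀ w s, ∑ᶠ e, treeVertex (w * of s : FreeGroup S) e = ∑ᶠ e, treeVertex w e + 1 := by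
    intro w s
    rw [treeVertex_mul_of, finsum_treeVertex_add_single]
  induction w using induction_mul_right with
  | h1 => simp [treeVertex_one]
  | hof s w ih => rw [h1, ih]; simp
  | hinv s w ih =>
    have := h1 (w * (of s)⁻¹) s
    rw [inv_mul_cancel_right, ih] at this
    simp; linarith

/-- The action of a free group on chains whose orbit of `0` is the set of vertices of the tree. -/
def treeAct (g : FreeGroup S) (c : FreeGroup S × S → ℝ) : FreeGroup S × S → ℝ :=
  fun e => treeVertex g e + c (g⁻¹ * e.1, e.2)

theorem treeAct_add (g : FreeGroup S) (c d : FreeGroup S × S → ℝ) :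
    treeAct g (c + d) = treeAct g c + fun e => d (g⁻¹ * e.1, e.2) := by
  funext e; simp [treeAct, add_assoc]

theorem single_translate (g w : FreeGroup S) (s : S) (x : ℝ) :
    (fun e : FreeGroup S × S => (Pi.single (w, s) x : _ → ℝ) (g⁻¹ * e.1, e.2)) =
      Pi.single (g * w, s) x := by
  funext ⟨v, s'⟩
  simp only [Pi.single_apply, Prod.mk.injEq, inv_mul_eq_iff_eq_mul]

theorem treeAct_treeVertex (g w : FreeGroup S) : treeAct g (treeVertex w) = treeVertex (g * w) := by
  have h1 : ∀ w s, treeAct g (treeVertex (w * of s)) =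
      treeAct g (treeVertex w) + Pi.single (g * w, s) 1 := by
    intro w s
    rw [treeVertex_mul_of, treeAct_add, single_translate]
  induction w using induction_mul_right with
  | h1 => funext e; simp [treeAct, treeVertex_one]
  | hof s w ih => rw [h1, ih, ← treeVertex_mul_of, mul_assoc]
  | hinv s w ih =>
    have := h1 (w * (of s)⁻¹) s
    rw [inv_mul_cancel_right, ih, ← mul_assoc] at this
    rw [← mul_assoc, treeVertex_mul_of_inv (g * w), this]; abel

theorem treeAct_one (c : FreeGroup S × S → ℝ) : treeAct 1 c = c := by
  funext e; simp [treeAct, treeVertex_one]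

theorem treeAct_mul (g h : FreeGroup S) (c : FreeGroup S × S → ℝ) :
    treeAct (g * h) c = treeAct g (treeAct h c) := by
  funext e
  have := congr_fun (treeAct_treeVertex g h) e
  simp only [treeAct] at this ⊢
  rw [← this, mul_inv_rev, mul_assoc]; ring

theorem continuous_treeAct (g : FreeGroup S) : Continuous (treeAct g) :=
  continuous_pi fun _ => continuous_const.add (continuous_apply _)

/-- The point at distance `t` from `w` on the edge from `w` to `w * s`. -/
def treePoint (w : FreeGroup S) (s : S) (t : ℝ) : FreeGroup S × S → ℝ :=
  treeVertex w + Pi.single (w, s) t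

theorem treePoint_zero (w : FreeGroup S) (s : S) : treePoint w s 0 = treeVertex w := by
  simp [treePoint]

theorem treePoint_one (w : FreeGroup S) (s : S) : treePoint w s 1 = treeVertex (w * of s) := by
  rw [treePoint, treeVertex_mul_of]

theorem treeAct_treePoint (g w : FreeGroup S) (s : S) (t : ℝ) :
    treeAct g (treePoint w s t) = treePoint (g * w) s t := by
  rw [treePoint, treeAct_add, single_translate, treeAct_treeVertex, treePoint]

/-- The Cayley tree of a free group. -/
def cayleyTree (S : Type*) [DecidableEq S] : Set (FreeGroup S × S → ℝ) :=
  {c | ∃ w s, ∃ t ∈ Set.Icc (0 : ℝ) 1, c = treePoint w s t}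

theorem treeAct_mem (g : FreeGroup S) {c : FreeGroup S × S → ℝ} (hc : c ∈ cayleyTree S) :
    treeAct g c ∈ cayleyTree S := by
  obtain ⟨w, s, t, ht, rfl⟩ := hc
  exact ⟨g * w, s, t, ht, treeAct_treePoint g w s t⟩

theorem treeVertex_mem [Nonempty S] (w : FreeGroup S) : treeVertex w ∈ cayleyTree S :=
  ⟨w, Classical.arbitrary S, 0, by simp, (treePoint_zero _ _).symm⟩

theorem treeVertex_sub_single (w : FreeGroup S) (s : S) (t : ℝ) :
    treeVertex w - Pi.single (w * (of s)⁻¹, s) t = treePoint (w * (of s)⁻¹) s (1 - t) := by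
  rw [treePoint, treeVertex_mul_of_inv, Pi.single_sub]; abel

theorem exists_lt_one_of_mem {c : FreeGroup S × S → ℝ} (hc : c ∈ cayleyTree S) :
    ∃ w s, ∃ t ∈ Set.Ico (0 : ℝ) 1, c = treePoint w s t := by
  obtain ⟨w, s, t, ⟨h0, h1⟩, rfl⟩ := hc
  rcases h1.lt_or_eq with h1 | rfl
  · exact ⟨w, s, t, ⟨h0, h1⟩, rfl⟩
  · exact ⟨w * of s, s, 0, by simp, by rw [treePoint_one, treePoint_zero]⟩

theorem exists_rooted_of_mem {c : FreeGroup S × S → ℝ} (hc : c ∈ cayleyTree S) :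
    ∃ w s, ∃ t ∈ Set.Icc (0 : ℝ) 1,
      (norm (w * of s) = norm w + 1 ∧ c = treePoint w s t) ∨
      (norm (w * (of s)⁻¹) = norm w + 1 ∧ c = treeVertex w - Pi.single (w * (of s)⁻¹, s) t) := by
  obtain ⟨w, s, t, ht, rfl⟩ := hc
  rcases norm_mul_of w s with h | h
  · exact ⟨w, s, t, ht, Or.inl ⟨h, rfl⟩⟩
  · refine ⟨w * of s, s, 1 - t, ⟨by linarith [ht.2], by linarith [ht.1]⟩, Or.inr ?_⟩
    rw [treeVertex_sub_single, mul_inv_cancel_right, sub_sub_cancel]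
    exact ⟨h, rfl⟩

/-- The point at signed height difference `t ∈ (-1, 1)` from `w` on an edge of type `s`. -/
def treeNear (w : FreeGroup S) (s : S) (t : ℝ) : FreeGroup S × S → ℝ :=
  treeVertex w + Pi.single (w, s) (max t 0) - Pi.single (w * (of s)⁻¹, s) (max (-t) 0)

theorem treeNear_of_nonneg (w : FreeGroup S) (s : S) {t : ℝ} (h : 0 ≤ t) :
    treeNear w s t = treePoint w s t := by simp [treeNear, h, treePoint]

theorem treeNear_of_nonpos (w : FreeGroup S) (s : S) {t : ℝ} (h : t ≤ 0) :
    treeNear w s t = treePoint (w * (of s)⁻¹) s (1 + t) := by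
  rw [← sub_neg_eq_add, ← treeVertex_sub_single]; simp [treeNear, h]

theorem treeNear_mem (w : FreeGroup S) (s : S) {t : ℝ} (h1 : -1 < t) (h2 : t < 1) :
    treeNear w s t ∈ cayleyTree S := by
  rcases le_total 0 t with h | h
  · exact ⟨w, s, t, ⟨h, h2.le⟩, treeNear_of_nonneg w s h⟩
  · exact ⟨_, s, 1 + t, ⟨by linarith, by linarith⟩, treeNear_of_nonpos w s h⟩

theorem treeAct_treeNear (g w : FreeGroup S) (s : S) (t : ℝ) :
    treeAct g (treeNear w s t) = treeNear (g * w) s t := by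
  rcases le_total 0 t with h | h
  · rw [treeNear_of_nonneg _ _ h, treeNear_of_nonneg _ _ h, treeAct_treePoint]
  · rw [treeNear_of_nonpos _ _ h, treeNear_of_nonpos _ _ h, treeAct_treePoint, mul_assoc]

/-- The chains that are close to the vertex `w` on all edges that contain it. -/
def openStar (w : FreeGroup S) : Set (FreeGroup S × S → ℝ) :=
  {c | ∀ s, |c (w, s) - treeVertex w (w, s)| < 1 ∧
    |c (w * (of s)⁻¹, s) - treeVertex w (w * (of s)⁻¹, s)| < 1}

theorem isOpen_openStar [Finite S] (w : FreeGroup S) : IsOpen (openStar w) := by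
  have : openStar w = ⋂ s : S, ({c | |c (w, s) - treeVertex w (w, s)| < 1} ∩
    {c | |c (w * (of s)⁻¹, s) - treeVertex w (w * (of s)⁻¹, s)| < 1}) := by
    ext c; simp [openStar]
  rw [this]
  exact isOpen_iInter_of_finite fun s =>
    (isOpen_lt (by fun_prop) (by fun_prop)).inter (isOpen_lt (by fun_prop) (by fun_prop))

theorem treeAct_mem_openStar (g w : FreeGroup S) {c : FreeGroup S × S → ℝ}
    (hc : c ∈ openStar w) : treeAct g c ∈ openStar (g * w) := by
  intro s
  rw [← treeAct_treeVertex]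
  simp only [treeAct, add_sub_add_left_eq_sub, mul_assoc, inv_mul_cancel_left]
  exact hc s

theorem edge_ne (w : FreeGroup S) (s s' : S) : (w, s) ≠ (w * (of s')⁻¹, s') := by
  intro h
  have := congrArg height (Prod.ext_iff.1 h).1
  simp at this

theorem treeNear_apply_left (w : FreeGroup S) (s s' : S) (t : ℝ) :
    treeNear w s t (w, s') - treeVertex w (w, s') = if s' = s then max t 0 else 0 := by
  simp only [treeNear, Pi.add_apply, Pi.sub_apply, Pi.single_eq_of_ne (edge_ne w s' s)]
  simp [Pi.single_apply]

theorem treeNear_apply_right (w : FreeGroup S) (s s' : S) (t : ℝ) :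
    treeNear w s t (w * (of s')⁻¹, s') - treeVertex w (w * (of s')⁻¹, s') =
      if s' = s then -max (-t) 0 else 0 := by
  simp only [treeNear, Pi.add_apply, Pi.sub_apply, Pi.single_eq_of_ne (edge_ne w s s').symm]
  by_cases h : s' = s
  · subst h; simp
  · simp [h]

theorem treeNear_mem_openStar (w : FreeGroup S) (s : S) {t : ℝ} (h1 : -1 < t) (h2 : t < 1) :
    treeNear w s t ∈ openStar w := by
  intro s'
  rw [treeNear_apply_left, treeNear_apply_right]
  split_ifs
  · rw [abs_neg, abs_of_nonneg (le_max_right _ _), abs_of_nonneg (le_max_right _ _)]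
    constructor <;> simp <;> linarith
  · simp

theorem eq_of_treeVertex_mem_openStar {v w : FreeGroup S} (h : treeVertex v ∈ openStar w) :
    v = w := by
  have h1 := treeAct_mem_openStar w⁻¹ w h
  rw [treeAct_treeVertex, inv_mul_cancel] at h1
  by_contra hne
  obtain ⟨s, hs⟩ := exists_one_le_abs_treeVertex (w⁻¹ * v)
    fun h => hne (inv_mul_eq_one.1 h).symm
  have := h1 s
  rw [treeVertex_one] at this
  simp only [Pi.zero_apply, sub_zero, one_mul] at this
  rcases hs with hs | hs
  · exact absurd this.1 (not_lt.2 hs)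
  · exact absurd this.2 (not_lt.2 hs)

theorem exists_eq_treeNear_of_mem_openStar {c : FreeGroup S × S → ℝ} (hc : c ∈ cayleyTree S)
    {w : FreeGroup S} (h : c ∈ openStar w) :
    ∃ s, ∃ t, -1 < t ∧ t < 1 ∧ c = treeNear w s t := by
  suffices H : ∀ c ∈ cayleyTree S, c ∈ openStar (1 : FreeGroup S) →
      ∃ s, ∃ t, -1 < t ∧ t < 1 ∧ c = treeNear 1 s t by
    have h1 := treeAct_mem_openStar w⁻¹ w h
    rw [inv_mul_cancel] at h1
    obtain ⟨s, t, ht1, ht2, h2⟩ := H _ (treeAct_mem w⁻¹ hc) h1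
    refine ⟨s, t, ht1, ht2, ?_⟩
    have := congrArg (treeAct w) h2
    rwa [treeAct_treeNear, mul_one, ← treeAct_mul, mul_inv_cancel, treeAct_one] at this
  intro c hc h
  have key : ∀ (v : FreeGroup S) (e : FreeGroup S × S) (x : ℝ), depth e = norm v →
      c = treeVertex v + Pi.single e x → v = 1 := by
    rintro v e x he rfl
    by_contra hne
    have hn : norm v ≠ 0 := fun h => hne (norm_eq_zero.1 h)
    obtain ⟨s, hs⟩ := exists_one_le_abs_treeVertex v hne
    have e1 : ((1 : FreeGroup S), s) ≠ e := by
      rintro rfl; rw [depth_one_left] at he; omega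
    have e2 : ((of s)⁻¹, s) ≠ e := by
      rintro rfl; rw [depth_of_inv] at he; omega
    have := h s
    rw [treeVertex_one, one_mul] at this
    simp only [Pi.zero_apply, sub_zero, Pi.add_apply, Pi.single_eq_of_ne e1,
      Pi.single_eq_of_ne e2, add_zero] at this
    rcases hs with hs | hs
    · exact absurd this.1 (not_lt.2 hs)
    · exact absurd this.2 (not_lt.2 hs)
  obtain ⟨v, s, t, ⟨ht0, ht1⟩, ⟨hn, hc⟩ | ⟨hn, hc⟩⟩ := exists_rooted_of_mem hc
  · obtain rfl := key v _ t (depth_of_norm_mul_of hn) hc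
    have h1 := (h s).1
    rw [hc, treePoint] at h1
    simp only [Pi.add_apply, Pi.single_eq_same, add_sub_cancel_left, abs_of_nonneg ht0] at h1
    exact ⟨s, t, by linarith, h1, by rw [treeNear_of_nonneg _ _ ht0, hc]⟩
  · obtain rfl := key v _ (-t) (depth_of_norm_mul_of_inv hn)
      (by rw [hc, Pi.single_neg, sub_eq_add_neg])
    have h1 := (h s).2
    rw [hc] at h1
    simp only [Pi.sub_apply, Pi.single_eq_same, sub_sub_cancel_left, abs_neg,
      abs_of_nonneg ht0] at h1
    refine ⟨s, -t, by linarith, by linarith, ?_⟩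
    rw [treeNear_of_nonpos _ _ (by linarith), hc, treeVertex_sub_single, sub_eq_add_neg]

theorem treePoint_mem_openStar (w : FreeGroup S) (s : S) {t : ℝ} (h0 : 0 ≤ t) (h1 : t < 1) :
    treePoint w s t ∈ openStar w := by
  rw [← treeNear_of_nonneg w s h0]
  exact treeNear_mem_openStar w s (by linarith) h1

theorem exists_mem_openStar {c : FreeGroup S × S → ℝ} (hc : c ∈ cayleyTree S) :
    ∃ w, c ∈ openStar w := by
  obtain ⟨w, s, t, ht, rfl⟩ := exists_lt_one_of_mem hc
  exact ⟨w, treePoint_mem_openStar w s ht.1 ht.2⟩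

/-! #### Functions on the tree -/

/-- The height function on the tree. -/
def treeHeight (c : FreeGroup S × S → ℝ) : ℝ := ∑ᶠ e, c e

theorem treeHeight_treePoint (w : FreeGroup S) (s : S) (t : ℝ) :
    treeHeight (treePoint w s t) = height w + t := by
  rw [treeHeight, treePoint, finsum_treeVertex_add_single, finsum_treeVertex]

theorem treeHeight_treeNear (w : FreeGroup S) (s : S) (t : ℝ) :
    treeHeight (treeNear w s t) = height w + t := by
  rcases le_total 0 t with h | h
  · rw [treeNear_of_nonneg _ _ h, treeHeight_treePoint]
  · rw [treeNear_of_nonpos _ _ h, treeHeight_treePoint]; simp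

/-- The function on the tree which is a multiple of `|sin|` on each edge. -/
def treeWave (κ : FreeGroup S × S → ℝ) (c : FreeGroup S × S → ℝ) : ℝ :=
  ∑ᶠ e, κ e * |Real.sin (Real.pi * c e)|

theorem abs_sin_pi_treeVertex_add (w : FreeGroup S) (e : FreeGroup S × S) (x : ℝ) :
    |Real.sin (Real.pi * (treeVertex w e + x))| = |Real.sin (Real.pi * x)| := by
  obtain ⟨n, hn⟩ := exists_treeVertex_eq_intCast w e
  rw [hn, mul_add, add_comm, mul_comm Real.pi (n : ℝ), Real.sin_add_int_mul_pi, abs_mul]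
  simp [abs_zpow]

theorem treeWave_treePoint (κ : FreeGroup S × S → ℝ) (w : FreeGroup S) (s : S) (t : ℝ) :
    treeWave κ (treePoint w s t) = κ (w, s) * |Real.sin (Real.pi * t)| := by
  rw [treeWave, finsum_eq_single _ (w, s)]
  · simp only [treePoint, Pi.add_apply, abs_sin_pi_treeVertex_add, Pi.single_eq_same]
  · intro e he
    simp only [treePoint, Pi.add_apply, abs_sin_pi_treeVertex_add, Pi.single_eq_of_ne he]
    simp

theorem treeHeight_eq_of_mem_openStar [Fintype S] {c : FreeGroup S × S → ℝ}
    (hc : c ∈ cayleyTree S) {w : FreeGroup S} (h : c ∈ openStar w) :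
    treeHeight c = height w + ∑ s, (c (w, s) - treeVertex w (w, s)) +
      ∑ s, (c (w * (of s)⁻¹, s) - treeVertex w (w * (of s)⁻¹, s)) := by
  obtain ⟨s, t, -, -, rfl⟩ := exists_eq_treeNear_of_mem_openStar hc h
  simp only [treeHeight_treeNear, treeNear_apply_left, treeNear_apply_right, Finset.sum_ite_eq',
    Finset.mem_univ, if_true]
  rcases le_total 0 t with h | h <;> simp [h]

theorem treeWave_eq_of_mem_openStar [Fintype S] (κ : FreeGroup S × S → ℝ)
    {c : FreeGroup S × S → ℝ} (hc : c ∈ cayleyTree S) {w : FreeGroup S} (h : c ∈ openStar w) :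
    treeWave κ c = ∑ s, κ (w, s) * |Real.sin (Real.pi * (c (w, s) - treeVertex w (w, s)))| +
      ∑ s, κ (w * (of s)⁻¹, s) *
        |Real.sin (Real.pi * (c (w * (of s)⁻¹, s) - treeVertex w (w * (of s)⁻¹, s)))| := by
  obtain ⟨s, t, -, -, rfl⟩ := exists_eq_treeNear_of_mem_openStar hc h
  simp only [treeNear_apply_left, treeNear_apply_right]
  rw [Finset.sum_eq_single s (by intro b _ hb; simp [hb]) (by simp),
    Finset.sum_eq_single s (by intro b _ hb; simp [hb]) (by simp), if_pos rfl, if_pos rfl]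
  rcases le_total 0 t with h | h
  · rw [treeNear_of_nonneg _ _ h, treeWave_treePoint]; simp [h]
  · rw [treeNear_of_nonpos _ _ h, treeWave_treePoint]
    have : |Real.sin (Real.pi * (1 + t))| = |Real.sin (Real.pi * t)| := by
      rw [mul_add, mul_one, add_comm, Real.sin_add_pi, abs_neg]
    simp [h, this]

theorem continuousOn_treeHeight [Finite S] : ContinuousOn (treeHeight (S := S)) (cayleyTree S) := by
  have := Fintype.ofFinite S
  intro c hc
  obtain ⟨w, hw⟩ := exists_mem_openStar hc
  refine ContinuousWithinAt.congr_of_eventuallyEq (f := fun c => (height w : ℝ) +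
    ∑ s, (c (w, s) - treeVertex w (w, s)) +
      ∑ s, (c (w * (of s)⁻¹, s) - treeVertex w (w * (of s)⁻¹, s)))
    (Continuous.continuousWithinAt (by fun_prop)) ?_ (treeHeight_eq_of_mem_openStar hc hw)
  filter_upwards [self_mem_nhdsWithin, mem_nhdsWithin_of_mem_nhds
    ((isOpen_openStar w).mem_nhds hw)] with d hd hdw
  exact treeHeight_eq_of_mem_openStar hd hdw

theorem continuousOn_treeWave [Finite S] (κ : FreeGroup S × S → ℝ) :
    ContinuousOn (treeWave κ) (cayleyTree S) := by
  have := Fintype.ofFinite S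
  intro c hc
  obtain ⟨w, hw⟩ := exists_mem_openStar hc
  have hcont : ∀ (e : FreeGroup S × S) (x y : ℝ), Continuous fun c : FreeGroup S × S → ℝ =>
      x * |Real.sin (Real.pi * (c e - y))| := fun e x y =>
    continuous_const.mul (Real.continuous_sin.comp (continuous_const.mul
      ((continuous_apply e).sub continuous_const))).abs
  refine ContinuousWithinAt.congr_of_eventuallyEq (Continuous.continuousWithinAt
    ((continuous_finsetSum _ fun s _ => hcont (w, s) (κ (w, s)) (treeVertex w (w, s))).add
      (continuous_finsetSum _ fun s _ => hcont (w * (of s)⁻¹, s) (κ (w * (of s)⁻¹, s))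
        (treeVertex w (w * (of s)⁻¹, s))))) ?_ (treeWave_eq_of_mem_openStar κ hc hw)
  filter_upwards [self_mem_nhdsWithin, mem_nhdsWithin_of_mem_nhds
    ((isOpen_openStar w).mem_nhds hw)] with d hd hdw
  exact treeWave_eq_of_mem_openStar κ hd hdw

/-! #### Contraction of the tree -/

/-- The bound at time `t` for the coefficients of edges of depth `n`: it decreases from `1` to `0`
between the times `1 / (n + 2)` and `1 / (n + 1)`. -/
def treeBound (n : ℕ) (t : ℝ) : ℝ :=
  max 0 (min 1 ((1 / ((n : ℝ) + 1) - t) * ((n + 1) * (n + 2))))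

theorem treeBound_nonneg (n : ℕ) (t : ℝ) : 0 ≤ treeBound n t := le_max_left _ _

theorem treeBound_eq_one {n : ℕ} {t : ℝ} (h : t ≤ 1 / ((n : ℝ) + 2)) : treeBound n t = 1 := by
  have h0 : (0 : ℝ) < (n + 1) * (n + 2) := by positivity
  have : 1 ≤ (1 / ((n : ℝ) + 1) - t) * ((n + 1) * (n + 2)) := by
    calc (1 : ℝ) = (1 / ((n : ℝ) + 1) - 1 / ((n : ℝ) + 2)) * ((n + 1) * (n + 2)) := by
          field_simp; ring
      _ ≤ _ := by gcongr
  rw [treeBound, min_eq_left this]; simp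

theorem treeBound_eq_zero {n : ℕ} {t : ℝ} (h : 1 / ((n : ℝ) + 1) ≤ t) : treeBound n t = 0 := by
  have h0 : (0 : ℝ) ≤ (n + 1) * (n + 2) := by positivity
  rw [treeBound, max_eq_left]
  exact (min_le_right _ _).trans (mul_nonpos_of_nonpos_of_nonneg (by linarith) h0)

/-- The contraction of the tree. -/
def treeContract (t : ℝ) (c : FreeGroup S × S → ℝ) : FreeGroup S × S → ℝ := fun e =>
  max (-treeBound (depth e) t) (min (treeBound (depth e) t) (c e))

theorem continuous_treeContract :
    Continuous fun p : ℝ × (FreeGroup S × S → ℝ) => treeContract p.1 p.2 := by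
  unfold treeContract treeBound
  fun_prop

theorem clamp_of_abs_le {b x : ℝ} (h : |x| ≤ b) : max (-b) (min b x) = x := by
  rw [min_eq_right (abs_le.1 h).2, max_eq_right (abs_le.1 h).1]

theorem treeContract_add_single {t : ℝ} {v : FreeGroup S} {e : FreeGroup S × S}
    (he : depth e = norm v) (x : ℝ) :
    (t ≤ 1 / ((norm v : ℝ) + 1) → treeContract t (treeVertex v + Pi.single e x) =
      treeVertex v + Pi.single e
        (max (-treeBound (depth e) t) (min (treeBound (depth e) t) x))) ∧
    (1 / ((norm v : ℝ) + 1) ≤ t → treeContract t (treeVertex v + Pi.single e x) =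
      treeContract t (treeVertex v)) := by
  have h0 := treeVertex_eq_zero_of_depth v e he.ge
  constructor
  · intro ht
    funext e'
    by_cases h : e' = e
    · subst h
      simp [treeContract, h0]
    · simp only [treeContract, Pi.add_apply, Pi.single_eq_of_ne h, add_zero]
      by_cases hd : norm v ≤ depth e'
      · rw [treeVertex_eq_zero_of_depth v e' hd]
        exact clamp_of_abs_le (by simpa using treeBound_nonneg _ _)
      · refine clamp_of_abs_le ((abs_treeVertex_le v e').trans (treeBound_eq_one ?_).ge)
        refine ht.trans (one_div_le_one_div_of_le (by positivity) ?_)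
        have : depth e' + 1 ≤ norm v := by omega
        have : ((depth e' : ℕ) : ℝ) + 1 ≤ norm v := by exact_mod_cast this
        linarith
  · intro ht
    funext e'
    by_cases h : e' = e
    · subst h
      rw [← he] at ht
      simp [treeContract, treeBound_eq_zero ht]
    · simp only [treeContract, Pi.add_apply, Pi.single_eq_of_ne h, add_zero]

theorem treeContract_treeVertex_mem [Nonempty S] (t : ℝ) (w : FreeGroup S) :
    treeContract t (treeVertex w) ∈ cayleyTree S := by
  induction w using norm_induction with
  | h1 =>
    have : treeContract t (treeVertex (1 : FreeGroup S)) = treeVertex 1 := by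
      funext e
      rw [treeVertex_one]
      exact clamp_of_abs_le (by simpa using treeBound_nonneg _ _)
    rw [this]; exact treeVertex_mem _
  | hof w s h ih =>
    rw [treeVertex_mul_of]
    obtain ⟨h1, h2⟩ := treeContract_add_single (t := t) (depth_of_norm_mul_of h) 1
    rcases le_total t (1 / ((norm w : ℝ) + 1)) with ht | ht
    · rw [h1 ht]
      refine ⟨w, s, _, ⟨?_, ?_⟩, rfl⟩
      · exact le_max_of_le_right (le_min (treeBound_nonneg _ _) zero_le_one)
      · exact max_le (by linarith [treeBound_nonneg (depth (w, s)) t]) (min_le_right _ _)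
    · rw [h2 ht]; exact ih
  | hinv w s h ih =>
    rw [treeVertex_mul_of_inv, sub_eq_add_neg, ← Pi.single_neg]
    obtain ⟨h1, h2⟩ := treeContract_add_single (t := t) (depth_of_norm_mul_of_inv h) (-1)
    rcases le_total t (1 / ((norm w : ℝ) + 1)) with ht | ht
    · rw [h1 ht]
      set x := max (-treeBound (depth (w * (of s)⁻¹, s)) t)
        (min (treeBound (depth (w * (of s)⁻¹, s)) t) (-1))
      have hb := treeBound_nonneg (depth (w * (of s)⁻¹, s)) t
      have hx0 : x ≤ 0 := max_le (by linarith) ((min_le_right _ _).trans (by norm_num))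
      have hx1 : -1 ≤ x := le_max_of_le_right (le_min (by linarith) le_rfl)
      rw [← neg_neg x, Pi.single_neg, ← sub_eq_add_neg, treeVertex_sub_single]
      exact ⟨_, s, _, ⟨by linarith, by linarith⟩, rfl⟩
    · rw [h2 ht]; exact ih

theorem treeContract_mem [Nonempty S] (t : ℝ) {c : FreeGroup S × S → ℝ} (hc : c ∈ cayleyTree S) :
    treeContract t c ∈ cayleyTree S := by
  obtain ⟨w, s, x, ⟨hx0, hx1⟩, ⟨h, rfl⟩ | ⟨h, rfl⟩⟩ := exists_rooted_of_mem hc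
  · obtain ⟨h1, h2⟩ := treeContract_add_single (t := t) (depth_of_norm_mul_of h) x
    rw [treePoint]
    rcases le_total t (1 / ((norm w : ℝ) + 1)) with ht | ht
    · rw [h1 ht]
      refine ⟨w, s, _, ⟨?_, ?_⟩, rfl⟩
      · exact le_max_of_le_right (le_min (treeBound_nonneg _ _) hx0)
      · exact max_le (by linarith [treeBound_nonneg (depth (w, s)) t])
          ((min_le_right _ _).trans hx1)
    · rw [h2 ht]; exact treeContract_treeVertex_mem t w
  · obtain ⟨h1, h2⟩ := treeContract_add_single (t := t) (depth_of_norm_mul_of_inv h) (-x)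
    rw [sub_eq_add_neg, ← Pi.single_neg]
    rcases le_total t (1 / ((norm w : ℝ) + 1)) with ht | ht
    · rw [h1 ht]
      set y := max (-treeBound (depth (w * (of s)⁻¹, s)) t)
        (min (treeBound (depth (w * (of s)⁻¹, s)) t) (-x))
      have hb := treeBound_nonneg (depth (w * (of s)⁻¹, s)) t
      have hy0 : y ≤ 0 := max_le (by linarith) ((min_le_right _ _).trans (by linarith))
      have hy1 : -1 ≤ y := le_max_of_le_right (le_min (by linarith) (by linarith))
      rw [← neg_neg y, Pi.single_neg, ← sub_eq_add_neg, treeVertex_sub_single]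
      exact ⟨_, s, _, ⟨by linarith, by linarith⟩, rfl⟩
    · rw [h2 ht]; exact treeContract_treeVertex_mem t w

theorem treeContract_zero {c : FreeGroup S × S → ℝ} (hc : c ∈ cayleyTree S) :
    treeContract 0 c = c := by
  have hb : ∀ n, treeBound n 0 = 1 := fun n => treeBound_eq_one (by positivity)
  obtain ⟨w, s, x, ⟨hx0, hx1⟩, h⟩ := exists_rooted_of_mem hc
  have key : ∀ e y, depth e = norm w → |y| ≤ 1 → c = treeVertex w + Pi.single e y →
      treeContract 0 c = c := by
    rintro e y he hy rfl
    rw [(treeContract_add_single he y).1 (by positivity), hb, clamp_of_abs_le hy]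
  have hx : |x| ≤ 1 := abs_le.2 ⟨by linarith, hx1⟩
  obtain ⟨h, hc⟩ | ⟨h, hc⟩ := h
  · exact key _ x (depth_of_norm_mul_of h) hx hc
  · refine key _ (-x) (depth_of_norm_mul_of_inv h) (by rwa [abs_neg]) ?_
    rw [hc, Pi.single_neg, sub_eq_add_neg]

theorem treeContract_one (c : FreeGroup S × S → ℝ) : treeContract 1 c = treeVertex 1 := by
  funext e
  rw [treeContract, treeBound_eq_zero, treeVertex_one]
  · simp
  · rw [div_le_one (by positivity)]; simp

instance [Nonempty S] : ContractibleSpace (cayleyTree S) := by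
  refine (contractible_iff_id_nullhomotopic _).2 ⟨⟨treeVertex 1, treeVertex_mem _⟩, ⟨?_⟩⟩
  exact
    { toFun := fun p => ⟨treeContract (p.1 : ℝ) p.2.1, treeContract_mem _ p.2.2⟩
      continuous_toFun := by
        refine Continuous.subtype_mk ?_ _
        exact continuous_treeContract.comp ((continuous_subtype_val.comp continuous_fst).prodMk
          (continuous_subtype_val.comp continuous_snd))
      map_zero_left := fun c => Subtype.ext (by simpa using treeContract_zero c.2)
      map_one_left := fun c => Subtype.ext (by simpa using treeContract_one c.1) }

end FreeGroup

end

noncomputable section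

/-! ### The strip `a b = sin (π h)` -/

/-- The infinite cyclic cover of a sphere with four holes. -/
def saddleStrip : Set (ℝ × ℝ × ℝ) :=
  {p | p.1 * p.2.1 = Real.sin (Real.pi * p.2.2) ∧ |p.1| ≤ 2 ∧ |p.2.1| ≤ 2}

theorem abs_neg_one_zpow_mul (n : ℤ) (x : ℝ) : |(-1 : ℝ) ^ n * x| = |x| := by
  rw [abs_mul, abs_zpow]; simp

theorem sin_pi_mul_add_int (h : ℝ) (n : ℤ) :
    Real.sin (Real.pi * (h + n)) = (-1) ^ n * Real.sin (Real.pi * h) := by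
  rw [mul_add, mul_comm Real.pi (n : ℝ), Real.sin_add_int_mul_pi]

theorem neg_one_zpow_mul_self (n : ℤ) : (-1 : ℝ) ^ n * (-1 : ℝ) ^ n = 1 := by
  rw [← zpow_add₀ (by norm_num), Even.neg_one_zpow ⟨n, rfl⟩]

theorem eq_intCast_of_sin_pi_mul_eq_zero {h : ℝ} {k : ℤ} (h0 : Real.sin (Real.pi * h) = 0)
    (hk : |h - k| < 1) : h = k := by
  obtain ⟨n, hn⟩ := Real.sin_eq_zero_iff.1 h0
  have h1 : (n : ℝ) = h := mul_right_cancel₀ Real.pi_ne_zero (by rw [hn, mul_comm])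
  rw [← h1] at hk ⊢
  have : |n - k| < 1 := by exact_mod_cast hk
  have : n - k = 0 := Int.abs_lt_one_iff.1 this
  rw [sub_eq_zero.1 this]

/-- The action of `ℤ` on the strip that is generated by `(a, b, h) ↦ (a, -b, h + 1)`. -/
instance : AddAction ℤ saddleStrip where
  vadd n p := ⟨(p.1.1, (-1) ^ n * p.1.2.1, p.1.2.2 + n), by
    obtain ⟨⟨a, b, h⟩, h1, h2, h3⟩ := p
    refine ⟨?_, h2, ?_⟩
    · show a * ((-1) ^ n * b) = _
      rw [sin_pi_mul_add_int, ← h1]; ring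
    · show |(-1) ^ n * b| ≤ 2
      rw [abs_neg_one_zpow_mul]; exact h3⟩
  zero_vadd p := by
    refine Subtype.ext (Prod.ext rfl (Prod.ext ?_ ?_))
    · show (-1 : ℝ) ^ (0 : ℤ) * p.1.2.1 = p.1.2.1
      simp
    · show p.1.2.2 + ((0 : ℤ) : ℝ) = p.1.2.2
      simp
  add_vadd m n p := by
    refine Subtype.ext (Prod.ext rfl (Prod.ext ?_ ?_))
    · show (-1 : ℝ) ^ (m + n) * p.1.2.1 = (-1) ^ m * ((-1) ^ n * p.1.2.1)
      rw [zpow_add₀ (by norm_num), mul_assoc]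
    · show p.1.2.2 + ((m + n : ℤ) : ℝ) = p.1.2.2 + n + m
      push_cast; ring

theorem saddleStrip.vadd_coe (n : ℤ) (p : saddleStrip) :
    ((n +ᵥ p : saddleStrip) : ℝ × ℝ × ℝ) = (p.1.1, (-1) ^ n * p.1.2.1, p.1.2.2 + n) := rfl

instance : ContinuousConstVAdd ℤ saddleStrip where
  continuous_const_vadd n := by
    refine Continuous.subtype_mk (f := fun p : saddleStrip =>
      (p.1.1, (-1 : ℝ) ^ n * p.1.2.1, p.1.2.2 + n)) ?_ _
    fun_prop

/-! ### The universal cover of the strip -/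

/-- The sign of a real number, with the convention that `0` has sign `-1`. -/
def lsign (x : ℝ) : ℝ := if x ≤ 0 then -1 else 1

theorem lsign_mul_abs (x : ℝ) : lsign x * |x| = x := by
  unfold lsign
  split_ifs with h
  · rw [abs_of_nonpos h]; ring
  · rw [abs_of_pos (not_le.1 h)]; ring

theorem abs_lsign (x : ℝ) : |lsign x| = 1 := by
  unfold lsign; split_ifs <;> simp

theorem lsign_mul_self_nonneg (x : ℝ) : 0 ≤ lsign x * x := by
  unfold lsign; split_ifs with h
  · linarith
  · linarith

theorem lsign_eq_of_mul_pos {x y : ℝ} (h : 0 < x * y) : lsign x = lsign y := by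
  rcases pos_and_pos_or_neg_and_neg_of_mul_pos h with ⟨hx, hy⟩ | ⟨hx, hy⟩
  · simp [lsign, hx.not_ge, hy.not_ge]
  · simp [lsign, hx.le, hy.le]

theorem continuous_lsign_mul {X : Type*} [TopologicalSpace X] {f F : X → ℝ} (hf : Continuous f)
    (hF : Continuous F) (h : ∀ x, f x = 0 → F x = 0) : Continuous fun x => lsign (f x) * F x := by
  have : (fun x => lsign (f x) * F x) = fun x => if f x ≤ 0 then - F x else F x := by
    funext x; unfold lsign; split_ifs <;> ring
  rw [this]
  exact Continuous.if_le hF.neg hF hf continuous_const fun x hx => by rw [h x hx]; simp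

namespace FreeGroup

/-- The edge weights of the two types of edges. -/
def typeSign (s : Bool) : ℝ := if s then 1 else -1

theorem abs_typeSign (s : Bool) : |typeSign s| = 1 := by cases s <;> simp [typeSign]

theorem eq_of_mul_typeSign_nonneg {a : ℝ} {s : Bool} (ha : a ≠ 0) (h : 0 ≤ a * typeSign s) :
    s = !decide (a ≤ 0) := by
  cases s
  · simp [typeSign] at h; simp [h]
  · simp [typeSign] at h; simpa using lt_of_le_of_ne h ha.symm

theorem treeHeight_treeAct {S : Type*} [DecidableEq S] (g : FreeGroup S)
    {c : FreeGroup S × S → ℝ} (hc : c ∈ cayleyTree S) :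
    treeHeight (treeAct g c) = treeHeight c + height g := by
  obtain ⟨w, s, t, -, rfl⟩ := hc
  rw [treeAct_treePoint, treeHeight_treePoint, treeHeight_treePoint]
  push_cast [height_mul]; ring

theorem treeWave_treeAct {S : Type*} [DecidableEq S] (κ : S → ℝ) (g : FreeGroup S)
    {c : FreeGroup S × S → ℝ} (hc : c ∈ cayleyTree S) :
    treeWave (fun e => κ e.2) (treeAct g c) = treeWave (fun e => κ e.2) c := by
  obtain ⟨w, s, t, -, rfl⟩ := hc
  rw [treeAct_treePoint, treeWave_treePoint, treeWave_treePoint]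

theorem treeWave_treeNear {S : Type*} [DecidableEq S] (κ : S → ℝ) (w : FreeGroup S) (s : S)
    (t : ℝ) : treeWave (fun e => κ e.2) (treeNear w s t) = κ s * |Real.sin (Real.pi * t)| := by
  rcases le_total 0 t with h | h
  · rw [treeNear_of_nonneg _ _ h, treeWave_treePoint]
  · rw [treeNear_of_nonpos _ _ h, treeWave_treePoint, mul_add, mul_one, add_comm,
      Real.sin_add_pi, abs_neg]

/-- The wave on the tree of `Bool` whose sign is that of the type of the edge. -/
def typeWave (c : FreeGroup Bool × Bool → ℝ) : ℝ := treeWave (fun e => typeSign e.2) c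

/-- The universal cover of the strip: points `(a, b, c)` with `c` on the tree such that
`(a, b)` lies on the branch of the hyperbola that is prescribed by `c`. -/
def stripCover : Set (ℝ × ℝ × (FreeGroup Bool × Bool → ℝ)) :=
  {p | p.2.2 ∈ cayleyTree Bool ∧ p.1 * p.2.1 = Real.sin (Real.pi * treeHeight p.2.2) ∧
    |p.1| ≤ 2 ∧ |p.2.1| ≤ 2 ∧ 0 ≤ p.1 * typeWave p.2.2}

theorem abs_typeWave {c : FreeGroup Bool × Bool → ℝ} (hc : c ∈ cayleyTree Bool) :
    |typeWave c| = |Real.sin (Real.pi * treeHeight c)| := by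
  obtain ⟨w, s, t, -, rfl⟩ := hc
  rw [typeWave, treeWave_treePoint, treeHeight_treePoint, abs_mul, abs_typeSign, one_mul, abs_abs,
    add_comm, sin_pi_mul_add_int, abs_neg_one_zpow_mul]

/-- The wave on the tree whose sign is that of the second coordinate on the strip. -/
def dualWave (c : FreeGroup Bool × Bool → ℝ) : ℝ :=
  treeWave (fun e => (-1) ^ (height e.1) * typeSign e.2) c

theorem abs_dualWave {c : FreeGroup Bool × Bool → ℝ} (hc : c ∈ cayleyTree Bool) :
    |dualWave c| = |Real.sin (Real.pi * treeHeight c)| := by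
  obtain ⟨w, s, t, -, rfl⟩ := hc
  rw [dualWave, treeWave_treePoint, treeHeight_treePoint, abs_mul, abs_neg_one_zpow_mul,
    abs_typeSign, one_mul, abs_abs, add_comm, sin_pi_mul_add_int, abs_neg_one_zpow_mul]

theorem typeWave_mul_dualWave {c : FreeGroup Bool × Bool → ℝ} (hc : c ∈ cayleyTree Bool) :
    typeWave c * dualWave c =
      |Real.sin (Real.pi * treeHeight c)| * Real.sin (Real.pi * treeHeight c) := by
  obtain ⟨w, s, t, ⟨h0, h1⟩, rfl⟩ := hc
  have hs : 0 ≤ Real.sin (Real.pi * t) :=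
    Real.sin_nonneg_of_nonneg_of_le_pi (by positivity) (by nlinarith [Real.pi_pos])
  have h2 : typeSign s * typeSign s = 1 := by cases s <;> simp [typeSign]
  rw [typeWave, dualWave, treeWave_treePoint, treeWave_treePoint, treeHeight_treePoint, add_comm,
    sin_pi_mul_add_int, abs_neg_one_zpow_mul, abs_of_nonneg hs]
  linear_combination (-1 : ℝ) ^ (height w) * (Real.sin (Real.pi * t)) ^ 2 * h2

theorem continuous_stripHeight : Continuous fun p : stripCover => treeHeight p.1.2.2 :=
  continuousOn_treeHeight.comp_continuous (by fun_prop) fun p => p.2.1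

/-- The covering map of the strip. -/
def stripProj : C(stripCover, saddleStrip) where
  toFun p := ⟨(p.1.1, p.1.2.1, treeHeight p.1.2.2), p.2.2.1, p.2.2.2.1, p.2.2.2.2.1⟩
  continuous_toFun := by
    have := continuous_stripHeight
    fun_prop

theorem typeSign_not_decide (a : ℝ) : typeSign (!decide (a ≤ 0)) = lsign a := by
  by_cases h : a ≤ 0 <;> simp [typeSign, lsign, h]

theorem treeNear_mem_stripCover {a b h : ℝ} (hp : (a, b, h) ∈ saddleStrip) {k : ℤ}
    (hk : |h - k| < 1) {w : FreeGroup Bool} (hw : height w = k) :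
    (a, b, treeNear w (!decide (a ≤ 0)) (h - k)) ∈ stripCover := by
  obtain ⟨h1, h2, h3⟩ := hp
  rw [abs_lt] at hk
  refine ⟨treeNear_mem _ _ hk.1 hk.2, ?_, h2, h3, ?_⟩
  · show a * b = _
    rw [treeHeight_treeNear, hw, add_sub_cancel]; exact h1
  · show 0 ≤ a * _
    rw [typeWave, treeWave_treeNear, typeSign_not_decide, ← mul_assoc, mul_comm a]
    exact mul_nonneg (lsign_mul_self_nonneg a) (abs_nonneg _)

theorem eq_treeNear_of_mem_stripCover {a b : ℝ} {c : FreeGroup Bool × Bool → ℝ}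
    (hp : (a, b, c) ∈ stripCover) {w : FreeGroup Bool} (hc : c ∈ openStar w) :
    c = treeNear w (!decide (a ≤ 0)) (treeHeight c - height w) := by
  obtain ⟨h1, h2, -, -, h5⟩ := hp
  obtain ⟨s, t, ht1, ht2, rfl⟩ := exists_eq_treeNear_of_mem_openStar h1 hc
  simp only [treeHeight_treeNear, typeWave, treeWave_treeNear, add_sub_cancel_left] at h2 h5 ⊢
  by_cases h0 : t = 0
  · subst h0; simp [treeNear]
  · have hs : Real.sin (Real.pi * t) ≠ 0 := fun h => h0 (by
      simpa using eq_intCast_of_sin_pi_mul_eq_zero (k := 0) h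
        (by simpa using abs_lt.2 ⟨ht1, ht2⟩))
    have ha : a ≠ 0 := by
      rintro rfl
      rw [zero_mul, add_comm, sin_pi_mul_add_int] at h2
      rcases mul_eq_zero.1 h2.symm with h | h
      · exact zpow_ne_zero _ (by norm_num) h
      · exact hs h
    have := eq_of_mul_typeSign_nonneg (s := s) ha (nonneg_of_mul_nonneg_left
      (by rwa [← mul_assoc] at h5) (abs_pos.2 hs))
    rw [← this]

theorem exists_mem_openStar_of_height {c : FreeGroup Bool × Bool → ℝ} (hc : c ∈ cayleyTree Bool)
    {k : ℤ} (hk : |treeHeight c - k| < 1) : ∃ w, height w = k ∧ c ∈ openStar w := by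
  obtain ⟨w, s, t, ⟨h0, h1⟩, rfl⟩ := exists_lt_one_of_mem hc
  rw [treeHeight_treePoint, abs_lt] at hk
  have e1 : ((height w : ℤ) : ℝ) < (k + 1 : ℤ) := by push_cast; linarith
  have e2 : ((k - 2 : ℤ) : ℝ) < (height w : ℤ) := by push_cast; linarith
  rw [Int.cast_lt] at e1 e2
  obtain h | h : height w = k ∨ height w = k - 1 := by omega
  · exact ⟨w, h, treePoint_mem_openStar w s h0 h1⟩
  · refine ⟨w * of s, by simp [h], ?_⟩
    rw [h] at hk
    push_cast at hk
    have := treeNear_mem_openStar (w * of s) s (t := t - 1) (by linarith) (by linarith)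
    rwa [treeNear_of_nonpos _ _ (by linarith), mul_inv_cancel_right, add_sub_cancel] at this

theorem eq_of_mem_openStar_of_height {c : FreeGroup Bool × Bool → ℝ} {a b : ℝ}
    (hp : (a, b, c) ∈ stripCover) {v w : FreeGroup Bool} (hv : c ∈ openStar v)
    (hw : c ∈ openStar w) (h : height v = height w) : v = w := by
  have e1 := eq_treeNear_of_mem_stripCover hp hv
  have e2 := eq_treeNear_of_mem_stripCover hp hw
  obtain ⟨s, t, ht1, ht2, hc⟩ := exists_eq_treeNear_of_mem_openStar hp.1 hv
  change c = _ at hc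
  have ht : treeHeight c - height v = t := by rw [hc, treeHeight_treeNear]; ring
  rw [← h] at e2
  rw [ht] at e1 e2
  have hN : ∀ (u : FreeGroup Bool) s e, min t 0 ≤ treeNear u s t e - treeVertex u e ∧
      treeNear u s t e - treeVertex u e ≤ max t 0 := by
    intro u s e
    rcases le_total 0 t with h0 | h0
    · rw [treeNear_of_nonneg _ _ h0, treePoint, Pi.add_apply, add_sub_cancel_left, Pi.single_apply]
      split_ifs <;> simp [h0]
    · rw [← neg_neg t, treeNear_of_nonpos _ _ (by simpa using h0), ← sub_eq_add_neg,
        ← treeVertex_sub_single, Pi.sub_apply, sub_sub_cancel_left, Pi.single_apply, neg_neg]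
      split_ifs <;> simp [h0]
  refine eq_of_treeVertex_mem_openStar fun s' => ?_
  have key : ∀ e, |treeVertex v e - treeVertex w e| < 1 := by
    intro e
    obtain ⟨a1, a2⟩ := hN v (!decide (a ≤ 0)) e
    obtain ⟨b1, b2⟩ := hN w (!decide (a ≤ 0)) e
    rw [← e1] at a1 a2
    rw [← e2] at b1 b2
    rw [abs_lt]
    rcases le_total 0 t with h0 | h0
    · simp only [h0, max_eq_left, min_eq_right] at a1 a2 b1 b2
      constructor <;> linarith
    · simp only [h0, max_eq_right, min_eq_left] at a1 a2 b1 b2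
      constructor <;> linarith
  exact ⟨key _, key _⟩

theorem continuous_treeNear_strip (w : FreeGroup Bool) (k : ℤ) :
    Continuous fun p : {p : saddleStrip | |p.1.2.2 - k| < 1} =>
      treeNear w (!decide (p.1.1.1 ≤ 0)) (p.1.1.2.2 - k) := by
  have h1 : (fun p : {p : saddleStrip | |p.1.2.2 - k| < 1} =>
      treeNear w (!decide (p.1.1.1 ≤ 0)) (p.1.1.2.2 - k)) = fun p =>
      if p.1.1.1 ≤ 0 then treeNear w false (p.1.1.2.2 - k) else
        treeNear w true (p.1.1.2.2 - k) := by
    funext p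
    split_ifs with h <;> simp [h]
  have h2 : ∀ s, Continuous fun t => treeNear w s t := by
    intro s
    unfold treeNear
    have h3 : Continuous fun t : ℝ => max t 0 := by fun_prop
    have h4 : Continuous fun t : ℝ => max (-t) 0 := by fun_prop
    have hs : ∀ e, Continuous fun x : ℝ => (Pi.single e x : FreeGroup Bool × Bool → ℝ) :=
      fun e => continuous_single (A := fun _ => ℝ) e
    exact (continuous_const.add ((hs _).comp h3)).sub ((hs _).comp h4)
  have h5 : Continuous fun p : {p : saddleStrip | |p.1.2.2 - k| < 1} => p.1.1.2.2 - k := by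
    fun_prop
  rw [h1]
  refine Continuous.if_le ((h2 _).comp h5) ((h2 _).comp h5) (by fun_prop) continuous_const ?_
  rintro ⟨⟨⟨a, b, h⟩, hp⟩, hk⟩ (h0 : a = 0)
  subst h0
  have h3 : h = k := eq_intCast_of_sin_pi_mul_eq_zero (by rw [← hp.1]; simp) hk
  simp [h3, treeNear]

theorem isCoveringMap_stripProj : IsCoveringMap stripProj := by
  intro σ₀
  let k : ℤ := round σ₀.1.2.2
  let U : Set saddleStrip := {p | |p.1.2.2 - k| < 1}
  have hU : IsOpen U := isOpen_lt (by fun_prop) continuous_const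
  have hk : |σ₀.1.2.2 - k| < 1 := (abs_sub_round _).trans_lt (by norm_num)
  let I := {w : FreeGroup Bool // height w = k}
  let _ : TopologicalSpace I := ⊥
  have : DiscreteTopology I := ⟨rfl⟩
  have hex : ∀ e : stripProj ⁻¹' U, ∃ w : I, e.1.1.2.2 ∈ openStar w.1 := fun e => by
    obtain ⟨w, h1, h2⟩ := exists_mem_openStar_of_height e.1.2.1 e.2
    exact ⟨⟨w, h1⟩, h2⟩
  choose idx hidx using hex
  have huniq : ∀ (e : stripProj ⁻¹' U) (w : I), e.1.1.2.2 ∈ openStar w.1 → idx e = w :=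
    fun e w h => Subtype.ext (eq_of_mem_openStar_of_height e.1.2 (hidx e) h
      ((idx e).2.trans w.2.symm))
  let H : stripProj ⁻¹' U ≃ₜ U × I :=
    { toFun := fun e => (⟨stripProj e.1, e.2⟩, idx e)
      invFun := fun p => ⟨⟨(p.1.1.1.1, p.1.1.1.2.1,
          treeNear p.2.1 (!decide (p.1.1.1.1 ≤ 0)) (p.1.1.1.2.2 - k)),
          treeNear_mem_stripCover p.1.1.2 p.1.2 p.2.2⟩, by
        show |treeHeight _ - (k : ℝ)| < 1
        rw [treeHeight_treeNear, p.2.2, add_sub_cancel]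
        exact p.1.2⟩
      left_inv := fun e => by
        refine Subtype.ext (Subtype.ext (Prod.ext rfl (Prod.ext rfl ?_)))
        have := eq_treeNear_of_mem_stripCover e.1.2 (hidx e)
        rw [(idx e).2] at this
        exact this.symm
      right_inv := fun p => by
        refine Prod.ext (Subtype.ext (Subtype.ext (Prod.ext rfl (Prod.ext rfl ?_)))) ?_
        · show treeHeight _ = _
          rw [treeHeight_treeNear, p.2.2, add_sub_cancel]
        · apply huniq
          have : |p.1.1.1.2.2 - (k : ℝ)| < 1 := p.1.2
          rw [abs_lt] at this
          exact treeNear_mem_openStar _ _ this.1 this.2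
      continuous_toFun := by
        refine Continuous.prodMk (by fun_prop) (continuous_discrete_rng.2 fun w => ?_)
        have : idx ⁻¹' {w} = {e | e.1.1.2.2 ∈ openStar w.1} := by
          ext e
          exact ⟨fun h => h ▸ hidx e, huniq e w⟩
        rw [this]
        exact (isOpen_openStar w.1).preimage (by fun_prop)
      continuous_invFun := by
        refine Continuous.subtype_mk (Continuous.subtype_mk ?_ _) _
        rw [continuous_prod_of_discrete_right]
        intro w
        exact Continuous.prodMk (by fun_prop)
          (Continuous.prodMk (by fun_prop) (continuous_treeNear_strip w.1 k)) }
  exact IsEvenlyCovered.to_isEvenlyCovered_preimage (I := I)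
    ⟨inferInstance, U, hk, hU, hU.preimage stripProj.continuous, H, fun x => rfl⟩

theorem stripProj_surjective : Function.Surjective stripProj := by
  rintro ⟨⟨a, b, h⟩, hp⟩
  have hk : |h - round h| < 1 := (abs_sub_round h).trans_lt (by norm_num)
  have hw : height (of true ^ (round h)) = round h := by simp
  refine ⟨⟨_, treeNear_mem_stripCover hp hk hw⟩, Subtype.ext (Prod.ext rfl (Prod.ext rfl ?_))⟩
  show treeHeight _ = _
  rw [treeHeight_treeNear, hw, add_sub_cancel]

/-! #### Contractibility -/

theorem wave_mem_stripCover {c : FreeGroup Bool × Bool → ℝ} (hc : c ∈ cayleyTree Bool) :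
    (lsign (typeWave c) * √|typeWave c|, lsign (dualWave c) * √|dualWave c|, c) ∈ stripCover := by
  have hb : ∀ x, |x| = |Real.sin (Real.pi * treeHeight c)| → |lsign x * √(|x|)| ≤ 2 := by
    intro x hx
    rw [abs_mul, abs_lsign, one_mul, hx, abs_of_nonneg (Real.sqrt_nonneg _), Real.sqrt_le_left
      (by norm_num)]
    exact (Real.abs_sin_le_one _).trans (by norm_num)
  refine ⟨hc, ?_, hb _ (abs_typeWave hc), hb _ (abs_dualWave hc), ?_⟩
  · show lsign (typeWave c) * √|typeWave c| * (lsign (dualWave c) * √|dualWave c|) =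
      Real.sin (Real.pi * treeHeight c)
    have h := typeWave_mul_dualWave hc
    rw [← lsign_mul_abs (typeWave c), ← lsign_mul_abs (dualWave c), abs_typeWave hc,
      abs_dualWave hc] at h
    rw [abs_typeWave hc, abs_dualWave hc]
    set f := Real.sin (Real.pi * treeHeight c)
    have h1 : √|f| * √|f| = |f| := Real.mul_self_sqrt (abs_nonneg _)
    by_cases h0 : |f| = 0
    · simp [abs_eq_zero.1 h0]
    · refine mul_left_cancel₀ h0 ?_
      rw [← h]
      linear_combination (|f| * lsign (typeWave c) * lsign (dualWave c)) * h1
  · show 0 ≤ lsign (typeWave c) * √|typeWave c| * typeWave c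
    have := mul_nonneg (lsign_mul_self_nonneg (typeWave c)) (Real.sqrt_nonneg |typeWave c|)
    linarith

/-- The product of the absolute values is preserved by `(a, b) ↦ (hyperbolaMap t a b,
hyperbolaMap t b a)`, and the difference of the absolute values is multiplied by `1 - t`. -/
def hyperbolaMap (t a b : ℝ) : ℝ :=
  ((1 - t) * (|a| - |b|) + √(((1 - t) * (|a| - |b|)) ^ 2 + 4 * (|a| * |b|))) / 2

theorem hyperbolaMap_nonneg (t a b : ℝ) : 0 ≤ hyperbolaMap t a b := by
  unfold hyperbolaMap
  set d := (1 - t) * (|a| - |b|)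
  have h : |d| ≤ √(d ^ 2 + 4 * (|a| * |b|)) :=
    Real.abs_le_sqrt (by have := mul_nonneg (abs_nonneg a) (abs_nonneg b); linarith)
  linarith [neg_abs_le d]

theorem hyperbolaMap_mul (t a b : ℝ) : hyperbolaMap t a b * hyperbolaMap t b a = |a| * |b| := by
  unfold hyperbolaMap
  set d := (1 - t) * (|a| - |b|)
  have e1 : (1 - t) * (|b| - |a|) = -d := by ring
  rw [e1, neg_sq, mul_comm |b| |a|]
  have h1 : √(d ^ 2 + 4 * (|a| * |b|)) * √(d ^ 2 + 4 * (|a| * |b|)) = d ^ 2 + 4 * (|a| * |b|) :=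
    Real.mul_self_sqrt (by positivity)
  linear_combination h1 / 4

theorem hyperbolaMap_le {t a b : ℝ} (h0 : 0 ≤ t) (h1 : t ≤ 1) :
    hyperbolaMap t a b ≤ max |a| |b| := by
  unfold hyperbolaMap
  set d := (1 - t) * (|a| - |b|)
  have h2 : |d| ≤ |(|a| - |b|)| := by
    rw [abs_mul, abs_of_nonneg (by linarith : 0 ≤ 1 - t)]
    nlinarith [abs_nonneg (|a| - |b|)]
  have h3 : √(d ^ 2 + 4 * (|a| * |b|)) ≤ |a| + |b| := by
    rw [Real.sqrt_le_left (by positivity)]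
    have := sq_le_sq.2 h2
    nlinarith
  have h4 := le_abs_self d
  have h5 : |a| + |b| + |(|a| - |b|)| = 2 * max |a| |b| := by
    rcases le_total |a| |b| with h | h
    · rw [max_eq_right h, abs_of_nonpos (sub_nonpos.2 h)]; ring
    · rw [max_eq_left h, abs_of_nonneg (sub_nonneg.2 h)]; ring
  linarith

theorem hyperbolaMap_of_left_eq_zero {t b : ℝ} (h1 : t ≤ 1) : hyperbolaMap t 0 b = 0 := by
  unfold hyperbolaMap
  have : (1 - t) * (|0| - |b|) ≤ 0 := by
    rw [abs_zero, zero_sub]; nlinarith [abs_nonneg b]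
  rw [abs_zero, zero_mul, mul_zero, add_zero, Real.sqrt_sq_eq_abs]
  rw [abs_zero] at this
  rw [abs_of_nonpos this]; ring

theorem hyperbolaMap_zero (a b : ℝ) : hyperbolaMap 0 a b = |a| := by
  unfold hyperbolaMap
  have : ((1 - 0) * (|a| - |b|)) ^ 2 + 4 * (|a| * |b|) = (|a| + |b|) ^ 2 := by ring
  rw [this, Real.sqrt_sq (by positivity)]; ring

theorem hyperbolaMap_one (a b : ℝ) : hyperbolaMap 1 a b = √(|a * b|) := by
  unfold hyperbolaMap
  rw [sub_self, zero_mul, zero_add, abs_mul]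
  have : (0 : ℝ) ^ 2 + 4 * (|a| * |b|) = 2 ^ 2 * (|a| * |b|) := by ring
  rw [this, Real.sqrt_mul (by norm_num), Real.sqrt_sq (by norm_num)]; ring

theorem hyperbola_mem_stripCover {t : ℝ} (h0 : 0 ≤ t) (h1 : t ≤ 1) {a b : ℝ}
    {c : FreeGroup Bool × Bool → ℝ} (hp : (a, b, c) ∈ stripCover) :
    (lsign a * hyperbolaMap t a b, lsign b * hyperbolaMap t b a, c) ∈ stripCover := by
  obtain ⟨p1, p2, p3, p4, p5⟩ := hp
  refine ⟨p1, ?_, ?_, ?_, ?_⟩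
  · show lsign a * hyperbolaMap t a b * (lsign b * hyperbolaMap t b a) = _
    rw [← p2]
    calc _ = (lsign a * lsign b) * (hyperbolaMap t a b * hyperbolaMap t b a) := by ring
      _ = (lsign a * |a|) * (lsign b * |b|) := by rw [hyperbolaMap_mul]; ring
      _ = a * b := by rw [lsign_mul_abs, lsign_mul_abs]
  · show |lsign a * hyperbolaMap t a b| ≤ 2
    rw [abs_mul, abs_lsign, one_mul, abs_of_nonneg (hyperbolaMap_nonneg _ _ _)]
    exact (hyperbolaMap_le h0 h1).trans (max_le p3 p4)
  · show |lsign b * hyperbolaMap t b a| ≤ 2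
    rw [abs_mul, abs_lsign, one_mul, abs_of_nonneg (hyperbolaMap_nonneg _ _ _)]
    exact (hyperbolaMap_le h0 h1).trans (max_le p4 p3)
  · show 0 ≤ lsign a * hyperbolaMap t a b * typeWave c
    by_cases ha : a = 0
    · rw [ha, hyperbolaMap_of_left_eq_zero h1]; simp
    · have : 0 ≤ lsign a * typeWave c := by
        have h2 : 0 ≤ |a| * (lsign a * typeWave c) := by
          rw [← mul_assoc, mul_comm |a|, lsign_mul_abs]; exact p5
        exact nonneg_of_mul_nonneg_right h2 (abs_pos.2 ha)
      have := mul_nonneg this (hyperbolaMap_nonneg t a b)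
      linarith

theorem lsign_mul_sqrt_eq {a b : ℝ} {c : FreeGroup Bool × Bool → ℝ}
    (hp : (a, b, c) ∈ stripCover) :
    lsign a * √|a * b| = lsign (typeWave c) * √|typeWave c| ∧
    lsign b * √|a * b| = lsign (dualWave c) * √|dualWave c| := by
  obtain ⟨p1, p2, p3, p4, p5⟩ := hp
  change a * b = Real.sin (Real.pi * treeHeight c) at p2
  change 0 ≤ a * typeWave c at p5
  have h1 := abs_typeWave p1
  have h2 := abs_dualWave p1
  have h3 := typeWave_mul_dualWave p1
  change |typeWave c| = |Real.sin (Real.pi * treeHeight c)| at h1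
  change |dualWave c| = |Real.sin (Real.pi * treeHeight c)| at h2
  change typeWave c * dualWave c =
    |Real.sin (Real.pi * treeHeight c)| * Real.sin (Real.pi * treeHeight c) at h3
  rw [← p2] at h1 h2 h3
  rw [h1, h2]
  by_cases h0 : a * b = 0
  · simp [h0]
  · have hw : typeWave c ≠ 0 := by rw [← abs_ne_zero, h1]; exact abs_ne_zero.2 h0
    have ha : a ≠ 0 := left_ne_zero_of_mul h0
    have hs : 0 < a * typeWave c := lt_of_le_of_ne p5 (mul_ne_zero ha hw).symm
    refine ⟨by rw [lsign_eq_of_mul_pos hs], ?_⟩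
    have hb : 0 < b * dualWave c := by
      have h4 : 0 < (a * typeWave c) * (b * dualWave c) := by
        have : (a * typeWave c) * (b * dualWave c) = |a * b| * (a * b) ^ 2 := by
          linear_combination a * b * h3
        rw [this]; positivity
      exact (pos_iff_pos_of_mul_pos h4).1 hs
    rw [lsign_eq_of_mul_pos hb]

theorem continuous_hyperbolaMap {X : Type*} [TopologicalSpace X] {t a b : X → ℝ}
    (ht : Continuous t) (ha : Continuous a) (hb : Continuous b) :
    Continuous fun x => hyperbolaMap (t x) (a x) (b x) := by
  unfold hyperbolaMap; fun_prop

/-- The strip cover is homotopy equivalent to the tree. -/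
def stripCoverHomotopyEquiv : ContinuousMap.HomotopyEquiv stripCover (cayleyTree Bool) where
  toFun := ⟨fun p => ⟨p.1.2.2, p.2.1⟩, by fun_prop⟩
  invFun := ⟨fun c => ⟨_, wave_mem_stripCover c.2⟩, by
    have h1 : Continuous fun c : cayleyTree Bool => typeWave c.1 :=
      continuousOn_iff_continuous_domRestrict.1 (continuousOn_treeWave _)
    have h2 : Continuous fun c : cayleyTree Bool => dualWave c.1 :=
      continuousOn_iff_continuous_domRestrict.1 (continuousOn_treeWave _)
    refine Continuous.subtype_mk (Continuous.prodMk ?_ (Continuous.prodMk ?_ (by fun_prop))) _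
    · exact continuous_lsign_mul h1 (by fun_prop) fun x hx => by simp [hx]
    · exact continuous_lsign_mul h2 (by fun_prop) fun x hx => by simp [hx]⟩
  left_inv := by
    refine ContinuousMap.Homotopic.symm ⟨?_⟩
    exact
      { toFun := fun p => ⟨_, hyperbola_mem_stripCover p.1.2.1 p.1.2.2 p.2.2⟩
        continuous_toFun := by
          refine Continuous.subtype_mk (Continuous.prodMk ?_ (Continuous.prodMk ?_ (by fun_prop))) _
          · exact continuous_lsign_mul (by fun_prop)
              (continuous_hyperbolaMap (by fun_prop) (by fun_prop) (by fun_prop))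
              fun x hx => by rw [hx, hyperbolaMap_of_left_eq_zero x.1.2.2]
          · exact continuous_lsign_mul (by fun_prop)
              (continuous_hyperbolaMap (by fun_prop) (by fun_prop) (by fun_prop))
              fun x hx => by rw [hx, hyperbolaMap_of_left_eq_zero x.1.2.2]
        map_zero_left := fun p => by
          refine Subtype.ext (Prod.ext ?_ (Prod.ext ?_ rfl))
          · show lsign _ * hyperbolaMap 0 _ _ = _
            rw [hyperbolaMap_zero, lsign_mul_abs]; rfl
          · show lsign _ * hyperbolaMap 0 _ _ = _
            rw [hyperbolaMap_zero, lsign_mul_abs]; rfl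
        map_one_left := fun p => by
          refine Subtype.ext (Prod.ext ?_ (Prod.ext ?_ rfl))
          · show lsign _ * hyperbolaMap 1 _ _ = _
            rw [hyperbolaMap_one]; exact (lsign_mul_sqrt_eq p.2).1
          · show lsign _ * hyperbolaMap 1 _ _ = _
            rw [hyperbolaMap_one, mul_comm p.1.2.1]; exact (lsign_mul_sqrt_eq p.2).2 }
  right_inv := by
    have : ∀ f : C(cayleyTree Bool, cayleyTree Bool), (∀ c, f c = c) →
        f.Homotopic (ContinuousMap.id _) := fun f hf => by
      have : f = ContinuousMap.id _ := ContinuousMap.ext hf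
      rw [this]
    exact this _ fun c => rfl

instance : ContractibleSpace stripCover := stripCoverHomotopyEquiv.contractibleSpace

/-! #### The action of the free group -/

instance : MulAction (FreeGroup Bool) stripCover where
  smul g p := ⟨(p.1.1, (-1) ^ height g * p.1.2.1, treeAct g p.1.2.2), by
    obtain ⟨⟨a, b, c⟩, h1, h2, h3, h4, h5⟩ := p
    refine ⟨treeAct_mem g h1, ?_, h3, ?_, ?_⟩
    · show a * ((-1) ^ height g * b) = Real.sin (Real.pi * treeHeight (treeAct g c))
      rw [treeHeight_treeAct g h1, sin_pi_mul_add_int]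
      change a * b = _ at h2
      rw [← h2]; ring
    · show |(-1) ^ height g * b| ≤ 2
      rw [abs_neg_one_zpow_mul]; exact h4
    · show 0 ≤ a * typeWave (treeAct g c)
      rw [typeWave, treeWave_treeAct _ g h1]; exact h5⟩
  one_smul p := by
    refine Subtype.ext (Prod.ext rfl (Prod.ext ?_ (treeAct_one _)))
    show (-1 : ℝ) ^ height (1 : FreeGroup Bool) * p.1.2.1 = p.1.2.1
    simp
  mul_smul g h p := by
    refine Subtype.ext (Prod.ext rfl (Prod.ext ?_ (treeAct_mul _ _ _)))
    show (-1 : ℝ) ^ height (g * h) * p.1.2.1 = (-1) ^ height g * ((-1) ^ height h * p.1.2.1)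
    rw [height_mul, zpow_add₀ (by norm_num), mul_assoc]

instance : ContinuousConstSMul (FreeGroup Bool) stripCover where
  continuous_const_smul g := by
    refine Continuous.subtype_mk (f := fun p : stripCover =>
      (p.1.1, (-1 : ℝ) ^ height g * p.1.2.1, treeAct g p.1.2.2)) ?_ _
    have := continuous_treeAct g
    fun_prop

theorem stripProj_smul (g : FreeGroup Bool) (p : stripCover) :
    stripProj (g • p) = height g +ᵥ stripProj p :=
  Subtype.ext (Prod.ext rfl (Prod.ext rfl (treeHeight_treeAct g p.2.1)))

theorem exists_smul_eq_of_stripProj {n : ℤ} {p q : stripCover}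
    (h : stripProj q = n +ᵥ stripProj p) : ∃ g : FreeGroup Bool, height g = n ∧ g • p = q := by
  obtain ⟨⟨a, b, c⟩, hp⟩ := p
  obtain ⟨⟨a', b', c'⟩, hq⟩ := q
  have h1 : (a', b', treeHeight c') = (a, (-1) ^ n * b, treeHeight c + n) := congrArg Subtype.val h
  simp only [Prod.mk.injEq] at h1
  obtain ⟨rfl, rfl, h3⟩ := h1
  have hk : |treeHeight c - round (treeHeight c)| < 1 :=
    (abs_sub_round _).trans_lt (by norm_num)
  have hk' : |treeHeight c' - (round (treeHeight c) + n : ℤ)| < 1 := by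
    rw [h3]; push_cast; rwa [add_sub_add_right_eq_sub]
  obtain ⟨v, hv, hcv⟩ := exists_mem_openStar_of_height hp.1 hk
  obtain ⟨w, hw, hcw⟩ := exists_mem_openStar_of_height hq.1 hk'
  have e1 := eq_treeNear_of_mem_stripCover hp hcv
  have e2 := eq_treeNear_of_mem_stripCover hq hcw
  refine ⟨w * v⁻¹, by rw [height_mul, height_inv, hv, hw]; ring, ?_⟩
  refine Subtype.ext (Prod.ext rfl (Prod.ext ?_ ?_))
  · show (-1) ^ height (w * v⁻¹) * b = (-1) ^ n * b
    rw [height_mul, height_inv, hv, hw, add_comm _ n, add_neg_cancel_right]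
  · show treeAct (w * v⁻¹) c = c'
    rw [e1, e2, treeAct_treeNear, inv_mul_cancel_right, h3, hv, hw]
    push_cast
    rw [add_sub_add_right_eq_sub]

theorem smul_stripCover_free (g : FreeGroup Bool) (p : stripCover) (h : g • p = p) : g = 1 := by
  obtain ⟨⟨a, b, c⟩, hp⟩ := p
  have hc : treeAct g c = c := congrArg (fun p : stripCover => p.1.2.2) h
  obtain ⟨w, hw⟩ := exists_mem_openStar hp.1
  have h1 := treeAct_mem_openStar g w hw
  rw [hc] at h1
  have h2 := treeHeight_treeAct g hp.1
  change treeHeight (treeAct g c) = treeHeight c + height g at h2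
  rw [hc] at h2
  have h3 : height g = 0 := by exact_mod_cast (left_eq_add.1 h2)
  have := eq_of_mem_openStar_of_height hp h1 hw (by simp [h3])
  simpa using this

end FreeGroup

end

noncomputable section

/-! ### The bundle over the circle with fibre the product of `F` and a sphere with four holes -/

/-- The product of `F` with the strip, with the action of `ℤ` that is generated by
`(x, (a, b, h)) ↦ (φ x, (a, b, h + 2))`. -/
def StripBundleCover {F : Type*} [TopologicalSpace F] (_φ : F ≃ₜ F) : Type _ := F × saddleStrip

theorem isClosed_saddleStrip : IsClosed saddleStrip :=
  (isClosed_eq (f := fun p : ℝ × ℝ × ℝ => p.1 * p.2.1)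
    (g := fun p => Real.sin (Real.pi * p.2.2)) (by fun_prop) (by fun_prop)).inter
    ((isClosed_le (f := fun p : ℝ × ℝ × ℝ => |p.1|) (by fun_prop) continuous_const).inter
      (isClosed_le (f := fun p : ℝ × ℝ × ℝ => |p.2.1|) (by fun_prop) continuous_const))

instance : LocallyCompactSpace saddleStrip := isClosed_saddleStrip.locallyCompactSpace

namespace StripBundleCover

variable {F : Type*} [TopologicalSpace F] (φ : F ≃ₜ F)

instance : TopologicalSpace (StripBundleCover φ) :=
  inferInstanceAs (TopologicalSpace (F × saddleStrip))

instance [T2Space F] : T2Space (StripBundleCover φ) :=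
  inferInstanceAs (T2Space (F × saddleStrip))

instance [LocallyCompactSpace F] : LocallyCompactSpace (StripBundleCover φ) :=
  inferInstanceAs (LocallyCompactSpace (F × saddleStrip))

instance : AddAction ℤ (StripBundleCover φ) where
  vadd n p := ((φ ^ n) p.1, (2 * n) +ᵥ p.2)
  zero_vadd p := by
    show ((φ ^ (0 : ℤ)) p.1, (2 * (0 : ℤ)) +ᵥ p.2) = p
    rw [mul_zero, zero_vadd]; rfl
  add_vadd m n p := by
    show ((φ ^ (m + n)) p.1, (2 * (m + n)) +ᵥ p.2) =
      ((φ ^ m) ((φ ^ n) p.1), (2 * m) +ᵥ ((2 * n) +ᵥ p.2))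
    rw [zpow_add, mul_add, add_vadd]; rfl

instance : ContinuousConstVAdd ℤ (StripBundleCover φ) where
  continuous_const_vadd n := by
    have h : Continuous fun p : F × saddleStrip => ((φ ^ n) p.1, (2 * n) +ᵥ p.2) := by fun_prop
    exact h

/-- The height of a point. -/
def height (p : StripBundleCover φ) : ℝ := p.2.1.2.2

theorem continuous_height : Continuous (height φ) := by
  have h : Continuous fun p : F × saddleStrip => p.2.1.2.2 := by fun_prop
  exact h

theorem height_vadd (n : ℤ) (p : StripBundleCover φ) : height φ (n +ᵥ p) = height φ p + 2 * n := by
  show p.2.1.2.2 + ((2 * n : ℤ) : ℝ) = _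
  push_cast; rfl

instance : IsCancelVAdd ℤ (StripBundleCover φ) where
  left_cancel' _ _ _ h := vadd_left_cancel _ h
  right_cancel' a b p h := by
    have h2 := congrArg (height φ) h
    rw [height_vadd, height_vadd] at h2
    have : (a : ℝ) = b := by linarith
    exact_mod_cast this

instance : ProperlyDiscontinuousVAdd ℤ (StripBundleCover φ) where
  finite_disjoint_inter_image {K L} hK hL := by
    have hc := continuous_height φ
    obtain ⟨a, ha⟩ := (hK.image hc).isBounded.exists_norm_le
    obtain ⟨b, hb⟩ := (hL.image hc).isBounded.exists_norm_le
    obtain ⟨N, hN⟩ := exists_nat_ge (a + b)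
    refine (Set.finite_Icc (-(N : ℤ)) N).subset ?_
    rintro n ⟨_, ⟨p, hp, rfl⟩, hq⟩
    have h1 : |height φ p| ≤ a := ha _ ⟨p, hp, rfl⟩
    have h2 : |height φ (n +ᵥ p)| ≤ b := hb _ ⟨_, hq, rfl⟩
    rw [height_vadd] at h2
    have h0 : (0 : ℝ) ≤ a := (abs_nonneg _).trans h1
    have h0' : (0 : ℝ) ≤ b := (abs_nonneg _).trans h2
    rw [abs_le] at h1 h2
    constructor
    · have h : (-(N : ℝ)) ≤ n := by linarith
      exact_mod_cast h
    · have h : (n : ℝ) ≤ N := by linarith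
      exact_mod_cast h

end StripBundleCover

/-- The bundle over the circle whose fibre is the product of `F` with a sphere with four holes, and
whose monodromy is `φ × id`. -/
abbrev StripBundle {F : Type*} [TopologicalSpace F] (φ : F ≃ₜ F) : Type _ :=
  AddAction.orbitRel.Quotient ℤ (StripBundleCover φ)

namespace StripBundle

variable {F : Type*} [TopologicalSpace F] (φ : F ≃ₜ F)

/-- The quotient map. -/
def proj (p : F × saddleStrip) : StripBundle φ :=
  Quotient.mk (AddAction.orbitRel ℤ (StripBundleCover φ)) p

theorem proj_surjective : Function.Surjective (proj φ) := Quotient.mk_surjective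

theorem continuous_proj : Continuous (proj φ) := continuous_quot_mk

theorem proj_eq_iff {p q : F × saddleStrip} :
    proj φ p = proj φ q ↔ ∃ n : ℤ, ((φ ^ n) q.1, (2 * n) +ᵥ q.2) = p :=
  Quotient.eq (r := AddAction.orbitRel ℤ (StripBundleCover φ))

theorem proj_vadd (n : ℤ) (p : F × saddleStrip) :
    proj φ ((φ ^ n) p.1, (2 * n) +ᵥ p.2) = proj φ p := (proj_eq_iff φ).2 ⟨n, rfl⟩

theorem isCoveringMap_proj [T2Space F] [LocallyCompactSpace F] : IsCoveringMap (proj φ) :=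
  (isAddQuotientCoveringMap_quotientMk_of_properlyDiscontinuousVAdd (G := ℤ)
    (E := StripBundleCover φ)).isCoveringMap

instance [CompactSpace F] : CompactSpace (StripBundle φ) := by
  have hK : IsCompact (saddleStrip ∩ Set.Icc ((-2 : ℝ), ((-2 : ℝ), (0 : ℝ))) (2, 2, 2)) :=
    isCompact_Icc.inter_left isClosed_saddleStrip
  have hK' : IsCompact {σ : saddleStrip | σ.1 ∈ Set.Icc ((-2 : ℝ), ((-2 : ℝ), (0 : ℝ))) (2, 2, 2)} := by
    rw [Subtype.isCompact_iff]
    convert hK using 1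
    ext p; simp only [Set.mem_image, Set.mem_ofPred_eq, Subtype.exists, exists_and_left,
      exists_prop, exists_eq_right_right, Set.mem_inter_iff]; exact and_comm
  refine ⟨?_⟩
  have := (isCompact_univ.prod hK').image (continuous_proj φ)
  convert this
  refine (Set.eq_univ_of_forall fun q => ?_).symm
  obtain ⟨⟨x, σ⟩, rfl⟩ := proj_surjective φ q
  refine ⟨((φ ^ (-⌊σ.1.2.2 / 2⌋)) x, (2 * -⌊σ.1.2.2 / 2⌋) +ᵥ σ), ⟨trivial, ?_⟩, proj_vadd φ _ (x, σ)⟩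
  have h1 := Int.floor_le (σ.1.2.2 / 2)
  have h2 := Int.lt_floor_add_one (σ.1.2.2 / 2)
  have ha := abs_le.1 σ.2.2.1
  have hb : |(-1 : ℝ) ^ (2 * -⌊σ.1.2.2 / 2⌋) * σ.1.2.1| ≤ 2 := by
    rw [abs_neg_one_zpow_mul]; exact σ.2.2.2
  have hb := abs_le.1 hb
  refine ⟨⟨ha.1, hb.1, ?_⟩, ⟨ha.2, hb.2, ?_⟩⟩
  · show 0 ≤ σ.1.2.2 + ((2 * -⌊σ.1.2.2 / 2⌋ : ℤ) : ℝ)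
    push_cast; linarith
  · show σ.1.2.2 + ((2 * -⌊σ.1.2.2 / 2⌋ : ℤ) : ℝ) ≤ 2
    push_cast; linarith

theorem hasAsphericalComponents_saddleStrip : HasAsphericalComponents saddleStrip :=
  HasAsphericalComponents.of_contractibleSpace.of_isCoveringMap FreeGroup.isCoveringMap_stripProj
    FreeGroup.stripProj_surjective

theorem isAspherical [T2Space F] [LocallyCompactSpace F] (hF : IsAspherical F) :
    IsAspherical (StripBundle φ) := by
  have h1 : PathConnectedSpace F := hF.1
  have h2 : PathConnectedSpace saddleStrip :=
    FreeGroup.stripProj_surjective.pathConnectedSpace FreeGroup.stripProj.continuous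
  exact ⟨(proj_surjective φ).pathConnectedSpace (continuous_proj φ),
    (hF.2.prod hasAsphericalComponents_saddleStrip).of_isCoveringMap (isCoveringMap_proj φ)
      (proj_surjective φ)⟩

/-! #### The Euler characteristic -/

/-- A square root of the homeomorphism `φ × id` of `F × Bool`. -/
def sqrtShift : F × Bool ≃ₜ F × Bool where
  toFun y := if y.2 then (φ y.1, false) else (y.1, true)
  invFun y := if y.2 then (y.1, false) else (φ.symm y.1, true)
  left_inv := by rintro ⟨x, _ | _⟩ <;> simp
  right_inv := by rintro ⟨x, _ | _⟩ <;> simp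
  continuous_toFun := by
    rw [continuous_prod_of_discrete_right]
    rintro (_ | _)
    · exact continuous_id.prodMk continuous_const
    · exact φ.continuous.prodMk continuous_const
  continuous_invFun := by
    rw [continuous_prod_of_discrete_right]
    rintro (_ | _)
    · exact φ.symm.continuous.prodMk continuous_const
    · exact continuous_id.prodMk continuous_const

/-- The map `(σ, (x, ε)) ↦ [(x, σ - ε)]`, where `σ - ε` is defined by the half shift. -/
def halfProj (p : saddleStrip × (F × Bool)) : StripBundle φ :=
  proj φ (p.2.1, (if p.2.2 then (-1 : ℤ) else 0) +ᵥ p.1)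

theorem halfProj_sqrtShift (σ : saddleStrip) (y : F × Bool) :
    halfProj φ ((1 : ℤ) +ᵥ σ, sqrtShift φ y) = halfProj φ (σ, y) := by
  obtain ⟨x, _ | _⟩ := y
  · show proj φ (x, (-1 : ℤ) +ᵥ ((1 : ℤ) +ᵥ σ)) = proj φ (x, (0 : ℤ) +ᵥ σ)
    rw [vadd_vadd]; rfl
  · show proj φ (φ x, (0 : ℤ) +ᵥ ((1 : ℤ) +ᵥ σ)) = proj φ (x, (-1 : ℤ) +ᵥ σ)
    rw [← proj_vadd φ 1 (x, (-1 : ℤ) +ᵥ σ), vadd_vadd, vadd_vadd, zpow_one]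
    rfl

theorem halfProj_sqrtShift_zpow (n : ℤ) (σ : saddleStrip) (y : F × Bool) :
    halfProj φ (n +ᵥ σ, (sqrtShift φ ^ n) y) = halfProj φ (σ, y) := by
  induction n with
  | zero => rw [zero_vadd, zpow_zero]; rfl
  | succ n ih =>
    rw [add_comm, add_vadd, zpow_add, zpow_one]
    exact (halfProj_sqrtShift φ _ _).trans ih
  | pred n ih =>
    rw [← ih, ← halfProj_sqrtShift φ]
    congr 2
    · rw [vadd_vadd]; congr 1; ring
    · show (sqrtShift φ * sqrtShift φ ^ (-(n : ℤ) - 1)) y = _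
      rw [← zpow_one_add]; congr 2; ring

theorem sqrtShift_sq_zpow (m : ℤ) (x : F) (b : Bool) :
    (sqrtShift φ ^ (2 * m)) (x, b) = ((φ ^ m) x, b) := by
  have h2 : ∀ y, (sqrtShift φ ^ (2 : ℤ)) y = (φ y.1, y.2) := by
    rintro ⟨x, _ | _⟩ <;> rfl
  induction m generalizing x with
  | zero => rfl
  | succ m ih =>
    rw [mul_add, zpow_add, zpow_add, mul_one, zpow_one]
    show (sqrtShift φ ^ (2 * (m : ℤ))) ((sqrtShift φ ^ (2 : ℤ)) (x, b)) = ((φ ^ (m : ℤ)) (φ x), b)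
    rw [h2, ih]
  | pred m ih =>
    have h3 := ih (φ.symm x)
    have h4 : (sqrtShift φ ^ (2 : ℤ)) (φ.symm x, b) = (x, b) := by rw [h2]; simp
    rw [← h4]
    show (sqrtShift φ ^ (2 * (-(m : ℤ) - 1)) * sqrtShift φ ^ (2 : ℤ)) (φ.symm x, b) = _
    rw [← zpow_add, show 2 * (-(m : ℤ) - 1) + 2 = 2 * -(m : ℤ) by ring, h3, zpow_sub, zpow_one]
    rfl

theorem exists_of_halfProj_eq {σ σ' : saddleStrip} {y y' : F × Bool}
    (h : halfProj φ (σ, y) = halfProj φ (σ', y')) :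
    ∃ n : ℤ, σ' = n +ᵥ σ ∧ y' = (sqrtShift φ ^ n) y := by
  obtain ⟨m, hm⟩ := (proj_eq_iff φ).1 h.symm
  obtain ⟨x, b⟩ := y
  obtain ⟨x', b'⟩ := y'
  obtain ⟨h1, h2⟩ := Prod.ext_iff.1 hm
  change (φ ^ m) x = x' at h1
  change (2 * m) +ᵥ ((if b then (-1 : ℤ) else 0) +ᵥ σ) = (if b' then (-1 : ℤ) else 0) +ᵥ σ' at h2
  have key : ∀ (b : Bool) (x : F),
      (x, b) = (sqrtShift φ ^ (-(if b then (-1 : ℤ) else 0))) (x, false) := by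
    rintro (_ | _) x <;> rfl
  refine ⟨-(if b' then (-1 : ℤ) else 0) + 2 * m + (if b then (-1 : ℤ) else 0), ?_, ?_⟩
  · rw [add_vadd, add_vadd, h2, vadd_vadd, neg_add_cancel, zero_vadd]
  · rw [zpow_add, zpow_add]
    show (x', b') = (sqrtShift φ ^ (-(if b' then (-1 : ℤ) else 0))) ((sqrtShift φ ^ (2 * m))
      ((sqrtShift φ ^ (if b then (-1 : ℤ) else 0)) (x, b)))
    have h3 : (sqrtShift φ ^ (if b then (-1 : ℤ) else 0)) (x, b) = (x, false) := by
      cases b <;> rfl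
    rw [h3, sqrtShift_sq_zpow, h1]
    exact key b' x'

theorem continuous_halfProj : Continuous (halfProj φ) := by
  refine (continuous_proj φ).comp ?_
  have h : ∀ n : ℤ, Continuous fun σ : saddleStrip => n +ᵥ σ := continuous_const_vadd
  have : Continuous fun p : (saddleStrip × F) × Bool =>
      (p.1.2, (if p.2 then (-1 : ℤ) else 0) +ᵥ p.1.1) := by
    rw [continuous_prod_of_discrete_right]
    intro b
    exact Continuous.prodMk continuous_snd ((h (if b then (-1 : ℤ) else 0)).comp continuous_fst)
  exact this.comp (f := fun p : saddleStrip × (F × Bool) => ((p.1, p.2.1), p.2.2)) (by fun_prop)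

/-- The quotient by the action of the free group. -/
def freeProj : C(FreeGroup.stripCover × (F × Bool), StripBundle φ) where
  toFun p := halfProj φ (FreeGroup.stripProj p.1, p.2)
  continuous_toFun := (continuous_halfProj φ).comp (by fun_prop)

theorem isLocallyInjective_freeProj [T2Space F] [LocallyCompactSpace F] :
    IsLocallyInjective (freeProj φ) := by
  rintro ⟨e, x, b⟩
  obtain ⟨U, hU, heU, hUi⟩ := FreeGroup.isCoveringMap_stripProj.isLocalHomeomorph.isLocallyInjective e
  obtain ⟨V, hV, hxV, hVi⟩ := (isCoveringMap_proj φ).isLocalHomeomorph.isLocallyInjective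
    (x, (if b then (-1 : ℤ) else 0) +ᵥ FreeGroup.stripProj e)
  have hf : Continuous fun p : FreeGroup.stripCover × (F × Bool) =>
      (p.2.1, (if b then (-1 : ℤ) else 0) +ᵥ FreeGroup.stripProj p.1) := by fun_prop
  refine ⟨(Prod.fst ⁻¹' U ∩ (fun p => p.2.2) ⁻¹' {b}) ∩ (fun p : FreeGroup.stripCover × (F × Bool) =>
      (p.2.1, (if b then (-1 : ℤ) else 0) +ᵥ FreeGroup.stripProj p.1)) ⁻¹' V,
    ((hU.preimage continuous_fst).inter ((isOpen_discrete {b}).preimage (by fun_prop))).inter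
      (hV.preimage hf), ⟨⟨heU, rfl⟩, hxV⟩, ?_⟩
  rintro ⟨e₁, x₁, b₁⟩ ⟨⟨h1, rfl : b₁ = b⟩, h2⟩ ⟨e₂, x₂, b₂⟩ ⟨⟨h3, rfl : b₂ = b₁⟩, h4⟩ h
  have h5 := hVi h2 h4 h
  obtain ⟨h6, h7⟩ := Prod.ext_iff.1 h5
  have h8 := hUi h1 h3 (vadd_left_cancel _ h7)
  change x₁ = x₂ at h6
  change e₁ = e₂ at h8
  rw [h6, h8]

theorem exists_isSimplexTorsor {F : Type} [TopologicalSpace F] [T2Space F] [LocallyCompactSpace F]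
    (φ : F ≃ₜ F) :
    ∃ (_ : MulAction (FreeGroup Bool) (FreeGroup.stripCover × (F × Bool)))
      (_ : ContinuousConstSMul (FreeGroup Bool) (FreeGroup.stripCover × (F × Bool))),
      IsSimplexTorsor (FreeGroup Bool) (freeProj φ) := by
  let A : MulAction (FreeGroup Bool) (FreeGroup.stripCover × (F × Bool)) :=
    { smul := fun g p => (g • p.1, (sqrtShift φ ^ FreeGroup.height g) p.2)
      one_smul := fun p => Prod.ext (one_smul _ p.1) (by
        show (sqrtShift φ ^ FreeGroup.height (1 : FreeGroup Bool)) p.2 = p.2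
        rw [FreeGroup.height_one, zpow_zero]; rfl)
      mul_smul := fun g h p => Prod.ext (mul_smul g h p.1) (by
        show (sqrtShift φ ^ FreeGroup.height (g * h)) p.2 = _
        rw [FreeGroup.height_mul, zpow_add]; rfl) }
  have hA : ∀ (g : FreeGroup Bool) (p : FreeGroup.stripCover × (F × Bool)),
      g • p = (g • p.1, (sqrtShift φ ^ FreeGroup.height g) p.2) := fun _ _ => rfl
  have C : ContinuousConstSMul (FreeGroup Bool) (FreeGroup.stripCover × (F × Bool)) := ⟨fun g => by
    simp only [hA]; fun_prop⟩
  refine ⟨A, C, IsSimplexTorsor.of_isLocallyInjective _ ?_ (isLocallyInjective_freeProj φ) ?_ ?_ ?_⟩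
  · intro n τ
    obtain ⟨f, hf⟩ := (isCoveringMap_proj φ).exists_lift_of_contractibleSpace (proj_surjective φ) τ
    obtain ⟨g, hg⟩ := FreeGroup.isCoveringMap_stripProj.exists_lift_of_contractibleSpace
      FreeGroup.stripProj_surjective (ContinuousMap.snd.comp f)
    refine ⟨g.prodMk ((ContinuousMap.fst.comp f).prodMk (ContinuousMap.const _ false)),
      ContinuousMap.ext fun a => ?_⟩
    rw [← hf]
    show proj φ ((f a).1, (0 : ℤ) +ᵥ FreeGroup.stripProj (g a)) = proj φ (f a)
    rw [hg, zero_vadd]; rfl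
  · intro g p
    show halfProj φ (FreeGroup.stripProj (g • p.1), _) = _
    rw [FreeGroup.stripProj_smul]
    exact halfProj_sqrtShift_zpow φ _ _ _
  · rintro ⟨e, y⟩ ⟨e', y'⟩ h
    obtain ⟨n, h1, h2⟩ := exists_of_halfProj_eq φ h
    obtain ⟨g, hg, hge⟩ := FreeGroup.exists_smul_eq_of_stripProj h1
    exact ⟨g, Prod.ext hge (by rw [h2, hA, hg])⟩
  · intro g p h
    exact FreeGroup.smul_stripCover_free g p.1 (congrArg Prod.fst h)

theorem hasVanishingEuler {F : Type} [TopologicalSpace F] [T2Space F] [LocallyCompactSpace F]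
    (hF : HasVanishingEuler F) (φ : F ≃ₜ F) : HasVanishingEuler (StripBundle φ) := by
  obtain ⟨A, C, hp⟩ := exists_isSimplexTorsor φ
  refine HasVanishingEuler.of_isSimplexTorsor hp ?_
  have h1 : HasVanishingEuler (F × Bool) := fun D _ _ _ =>
    (hF (Bool × D)).of_homotopyEquiv (Homeomorph.prodAssoc F Bool D).symm.toHomotopyEquiv
  obtain ⟨e⟩ := ContractibleSpace.hequiv_unit FreeGroup.stripCover
  exact h1.of_homotopyEquiv ((Homeomorph.uniqueProd Unit (F × Bool)).symm.toHomotopyEquiv.trans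
    (e.symm.prodCongr (.refl _)))

end StripBundle

/-! ### The torus -/

theorem HasVanishingEuler.circle_prod {X : Type} [TopologicalSpace X] [T2Space X]
    (hX : HasFiniteHomology X) : HasVanishingEuler (Circle × X) := by
  let p : C(ℝ × X, Circle × X) := Circle.exp.prodMap (ContinuousMap.id X)
  let A : MulAction (FreeGroup Unit) ℝ :=
    { smul := fun g t => t + FreeGroup.height g * (2 * Real.pi)
      one_smul := fun t => by
        show t + FreeGroup.height (1 : FreeGroup Unit) * (2 * Real.pi) = t
        simp
      mul_smul := fun g h t => by
        show t + FreeGroup.height (g * h) * (2 * Real.pi) = t + FreeGroup.height h * (2 * Real.pi) +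
          FreeGroup.height g * (2 * Real.pi)
        rw [FreeGroup.height_mul]; push_cast; ring }
  have hA : ∀ (g : FreeGroup Unit) (t : ℝ), g • t = t + FreeGroup.height g * (2 * Real.pi) :=
    fun _ _ => rfl
  have C : ContinuousConstSMul (FreeGroup Unit) ℝ := ⟨fun g => by simp only [hA]; fun_prop⟩
  have hs : Function.Surjective Circle.exp := Circle.exp_surjective
  have h1 : IsSimplexTorsor (FreeGroup Unit) (X := ℝ) Circle.exp := by
    refine IsSimplexTorsor.of_isLocallyInjective _ ?_
      Circle.isCoveringMap_exp.isLocalHomeomorph.isLocallyInjective ?_ ?_ ?_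
    · intro n τ
      obtain ⟨g, hg⟩ := Circle.isCoveringMap_exp.exists_lift_of_contractibleSpace hs τ
      exact ⟨g, ContinuousMap.ext hg⟩
    · intro g t
      rw [hA, Circle.exp_eq_exp]; exact ⟨FreeGroup.height g, rfl⟩
    · intro s t h
      obtain ⟨n, hn⟩ := Circle.exp_eq_exp.1 h.symm
      exact ⟨FreeGroup.of () ^ n, by rw [hA, hn]; simp⟩
    · intro g t h
      rw [hA] at h
      have h2 : FreeGroup.height g = 0 := by
        have := left_eq_add.1 h.symm
        simpa [Real.pi_ne_zero] using this
      obtain ⟨n, rfl⟩ : ∃ n : ℤ, FreeGroup.of () ^ n = g := by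
        clear h h2
        induction g using FreeGroup.induction_mul_left with
        | h1 => exact ⟨0, rfl⟩
        | hof s g hg =>
          obtain ⟨n, rfl⟩ := hg
          exact ⟨1 + n, by rw [zpow_add, zpow_one]⟩
        | hinv s g hg =>
          obtain ⟨n, rfl⟩ := hg
          exact ⟨-1 + n, by rw [zpow_add, zpow_neg_one]⟩
      simp at h2
      simp [h2]
  let B : MulAction (FreeGroup Unit) X :=
    { smul := fun _ x => x, one_smul := fun _ => rfl, mul_smul := fun _ _ _ => rfl }
  have : ContinuousConstSMul (FreeGroup Unit) X := ⟨fun _ => continuous_id⟩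
  refine HasVanishingEuler.of_isSimplexTorsor_of_unique (h1.prod_trivial (D := X) fun _ _ => rfl) ?_
  obtain ⟨e⟩ := ContractibleSpace.hequiv_unit ℝ
  exact hX.of_homotopyEquiv ((Homeomorph.uniqueProd Unit X).symm.toHomotopyEquiv.trans
    (e.symm.prodCongr (.refl _)))

theorem HasFiniteHomology.circle : HasFiniteHomology Circle :=
  ((HasVanishingEuler.circle_prod (.of_discrete Unit)).of_homotopyEquiv
    (Homeomorph.prodUnique Circle Unit).toHomotopyEquiv).hasFiniteHomology

theorem HasVanishingEuler.torus : HasVanishingEuler Torus :=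
  HasVanishingEuler.circle_prod HasFiniteHomology.circle

theorem isAspherical_circle : IsAspherical Circle :=
  ⟨Circle.exp_surjective.pathConnectedSpace Circle.exp.continuous,
    HasAsphericalComponents.of_contractibleSpace.of_isCoveringMap Circle.isCoveringMap_exp
      Circle.exp_surjective⟩

theorem isAspherical_torus : IsAspherical Torus := by
  have := isAspherical_circle.1
  exact ⟨inferInstance, isAspherical_circle.2.prod isAspherical_circle.2⟩

end

noncomputable section

/-! ### Orientations as signs -/

section Orientation

variable {V : Type*} [AddCommGroup V] [Module ℝ V] {n : ℕ}

open Classical in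
/-- The sign of an orientation with respect to a basis. -/
def orientationSign (b : Module.Basis (Fin n) ℝ V) (o : Orientation ℝ V (Fin n)) : ℝ :=
  if o = b.orientation then 1 else -1

/-- The orientation with a given sign with respect to a basis. -/
def orientationOfSign (b : Module.Basis (Fin n) ℝ V) (s : ℝ) : Orientation ℝ V (Fin n) :=
  if 0 < s then b.orientation else -b.orientation

theorem isPositiveFrame_iff_orientationSign (b : Module.Basis (Fin n) ℝ V)
    (o : Orientation ℝ V (Fin n)) (v : Fin n → V) :
    IsPositiveFrame o v ↔ 0 < orientationSign b o * b.det v := by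
  have key : ∀ b' : Module.Basis (Fin n) ℝ V,
      b'.orientation = o ↔ 0 < orientationSign b o * b.det b' := by
    intro b'
    have h1 := b.orientation_eq_iff_det_pos b'
    have h2 : b.det b' ≠ 0 := (b.isUnit_det b').ne_zero
    have h4 : b.orientation ≠ -b.orientation := (Module.Ray.ne_neg_self _)
    unfold orientationSign
    rcases b.orientation_eq_or_eq_neg o with rfl | rfl
    · rw [if_pos rfl, one_mul, ← h1, eq_comm]
    · rw [if_neg h4.symm, neg_one_mul, neg_pos]
      constructor
      · intro h
        have h5 : ¬ 0 < b.det b' := fun hp => h4 ((h1.2 hp).trans h)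
        exact lt_of_le_of_ne (not_lt.1 h5) h2
      · intro h
        have h5 : b'.orientation ≠ b.orientation := fun he => (h1.1 he.symm).not_gt h
        exact (b'.orientation_eq_or_eq_neg b.orientation).elim (fun he => absurd he.symm h5)
          fun he => by rw [he]; exact (neg_neg (b'.orientation)).symm
  constructor
  · rintro ⟨b', rfl, h⟩
    exact (key b').1 h
  · intro h
    have hu : IsUnit (b.det v) := isUnit_iff_ne_zero.2 fun h0 => by simp [h0] at h
    obtain ⟨hl, hs⟩ := (Module.Basis.is_basis_iff_det b).2 hu
    refine ⟨Module.Basis.mk hl hs.ge, Module.Basis.coe_mk _ _, (key _).2 ?_⟩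
    rwa [Module.Basis.coe_mk]

theorem orientationSign_ne_zero (b : Module.Basis (Fin n) ℝ V) (o : Orientation ℝ V (Fin n)) :
    orientationSign b o ≠ 0 := by
  unfold orientationSign; split_ifs <;> simp

theorem isPositiveFrame_orientationOfSign (b : Module.Basis (Fin n) ℝ V) {s : ℝ} (hs : s ≠ 0)
    (v : Fin n → V) : IsPositiveFrame (orientationOfSign b s) v ↔ 0 < s * b.det v := by
  rw [isPositiveFrame_iff_orientationSign b]
  have h4 : b.orientation ≠ -b.orientation := (Module.Ray.ne_neg_self _)
  unfold orientationOfSign orientationSign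
  rcases hs.lt_or_gt with h | h
  · rw [if_neg h.not_gt, if_neg h4.symm, neg_one_mul, neg_pos]
    exact ⟨fun hd => mul_pos_of_neg_of_neg h hd, fun hd => (neg_iff_neg_of_mul_pos hd).1 h⟩
  · rw [if_pos h, if_pos rfl, one_mul, mul_pos_iff_of_pos_left h]

end Orientation

section MDeriv

variable {E H M : Type*} [NormedAddCommGroup E] [NormedSpace ℝ E] [TopologicalSpace H]
  (I : ModelWithCorners ℝ E H) [TopologicalSpace M] [ChartedSpace H M]
  {E' H' M' : Type*} [NormedAddCommGroup E'] [NormedSpace ℝ E'] [TopologicalSpace H']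
  (I' : ModelWithCorners ℝ E' H') [TopologicalSpace M'] [ChartedSpace H' M']

/-- The differential of `f`, written in the preferred charts. -/
def coordDeriv (f : M → M') (x : M) : E →L[ℝ] E' := mfderiv I I' f x

theorem hasMFDerivAt_of_eventuallyEq {f : M → M'} {x : M} {A : E →L[ℝ] E'}
    (hf : ContinuousAt f x) {g : E → E'} (hg : HasFDerivWithinAt g A (Set.range I) (extChartAt I x x))
    (h : ∀ᶠ y in 𝓝[Set.range I] (extChartAt I x x),
      extChartAt I' (f x) (f ((extChartAt I x).symm y)) = g y) :
    HasMFDerivAt I I' f x A :=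
  ⟨hf, hg.congr_of_eventuallyEq h (h.self_of_nhdsWithin (Set.mem_range_self _))⟩

theorem coordDeriv_eq {f : M → M'} {x : M} {A : E →L[ℝ] E'} (h : HasMFDerivAt I I' f x A) :
    coordDeriv I I' f x = A := h.mfderiv

theorem hasMFDerivAt_extChartAt_self (x : M) :
    HasMFDerivAt I 𝓘(ℝ, E) (extChartAt I x) x (ContinuousLinearMap.id ℝ E) := by
  refine hasMFDerivAt_of_eventuallyEq I 𝓘(ℝ, E) (continuousAt_extChartAt x) (g := id)
    (hasFDerivWithinAt_id _ _) ?_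
  filter_upwards [extChartAt_target_mem_nhdsWithin (I := I) x] with y hy
  exact (extChartAt I x).right_inv hy

theorem mdifferentiableAt_extChartAt' [IsManifold I ∞ M] {x y : M} (h : y ∈ (chartAt H x).source) :
    MDifferentiableAt I 𝓘(ℝ, E) (extChartAt I x) y :=
  (contMDiffAt_extChartAt' (n := ∞) h).mdifferentiableAt (by simp)

/-- `s` is the sign of an orientation of `M` with respect to a fixed orientation of the model
space. -/
def IsOrientationSign (s : M → ℝ) : Prop :=
  ∀ x₀, ∀ᶠ x in 𝓝 x₀, 0 < s x₀ * s x * (coordDeriv I 𝓘(ℝ, E) (extChartAt I x₀) x).det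

variable {I}

theorem IsOrientationSign.ne_zero {s : M → ℝ} (hs : IsOrientationSign I s) (x : M) : s x ≠ 0 := by
  intro h
  have := (hs x).self_of_nhds
  rw [h] at this
  simp at this

theorem det_frame_comp {n : ℕ} (b : Module.Basis (Fin n) ℝ E) (A : E →L[ℝ] E) (v : Fin n → E) :
    b.det (fun i => A (v i)) = A.det * b.det v := b.det_comp (A : E →ₗ[ℝ] E) v

/-- The orientation of a manifold with a given sign. -/
def ManifoldOrientation.ofSign {n : ℕ} (b : Module.Basis (Fin n) ℝ E) {s : M → ℝ}
    (hs : IsOrientationSign I s) : ManifoldOrientation I M n where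
  orient x := orientationOfSign (V := E) b (s x)
  locallyConstant x₀ := by
    refine ⟨orientationOfSign b (s x₀), ?_⟩
    filter_upwards [hs x₀] with x hx v hv
    have hv' : 0 < s x * b.det v := (isPositiveFrame_orientationOfSign b (hs.ne_zero x) v).1 hv
    refine (isPositiveFrame_orientationOfSign b (hs.ne_zero x₀) _).2 ?_
    refine lt_of_lt_of_eq ?_ (congrArg (s x₀ * ·)
      (det_frame_comp b (coordDeriv I 𝓘(ℝ, E) (extChartAt I x₀) x) v).symm)
    show 0 < s x₀ * (_ * b.det (M := E) v)
    have h1 := mul_pos hx hv'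
    have h2 : 0 < s x ^ 2 := by have := hs.ne_zero x; positivity
    refine (pos_iff_pos_of_mul_pos (a := s x ^ 2) ?_).1 h2
    linarith

theorem ManifoldOrientation.isPositiveFrame_ofSign {n : ℕ} (b : Module.Basis (Fin n) ℝ E)
    {s : M → ℝ} (hs : IsOrientationSign I s) (x : M) (v : Fin n → TangentSpace I x) :
    IsPositiveFrame ((ManifoldOrientation.ofSign b hs).orient x) v ↔
      0 < s x * b.det (M := E) v :=
  isPositiveFrame_orientationOfSign b (hs.ne_zero x) v

/-- The sign of an orientation of a manifold. -/
def ManifoldOrientation.sign {n : ℕ} (o : ManifoldOrientation I M n)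
    (b : Module.Basis (Fin n) ℝ E) (x : M) : ℝ := orientationSign (V := E) b (o.orient x)

theorem ManifoldOrientation.isPositiveFrame_iff {n : ℕ} (o : ManifoldOrientation I M n)
    (b : Module.Basis (Fin n) ℝ E) (x : M) (v : Fin n → TangentSpace I x) :
    IsPositiveFrame (o.orient x) v ↔ 0 < o.sign b x * b.det (M := E) v :=
  isPositiveFrame_iff_orientationSign (V := E) b _ v

theorem ManifoldOrientation.sign_ne_zero {n : ℕ} (o : ManifoldOrientation I M n)
    (b : Module.Basis (Fin n) ℝ E) (x : M) : o.sign b x ≠ 0 := orientationSign_ne_zero b _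

theorem exists_det_eq {n : ℕ} (b : Module.Basis (Fin (n + 1)) ℝ E) (c : ℝ) :
    ∃ v : Fin (n + 1) → E, b.det v = c := by
  refine ⟨Function.update b 0 (c • b 0), ?_⟩
  rw [b.det.map_update_smul, Function.update_eq_self, b.det_self, smul_eq_mul, mul_one]

theorem ManifoldOrientation.isOrientationSign {n : ℕ} (o : ManifoldOrientation I M (n + 1))
    (b : Module.Basis (Fin (n + 1)) ℝ E) : IsOrientationSign I (o.sign b) := by
  intro x₀
  obtain ⟨w, hw⟩ := o.locallyConstant x₀
  have key : ∀ x, (∀ v : Fin (n + 1) → TangentSpace I x, IsPositiveFrame (o.orient x) v →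
      IsPositiveFrame w (fun i => mvfderiv I (extChartAt I x₀) x (v i))) →
      0 < orientationSign b w * (o.sign b x *
        (coordDeriv I 𝓘(ℝ, E) (extChartAt I x₀) x).det) := by
    intro x hx
    obtain ⟨v, hv⟩ := exists_det_eq b (o.sign b x)
    have h1 := hx v ((o.isPositiveFrame_iff b x v).2
      (by rw [hv]; exact mul_self_pos.2 (o.sign_ne_zero b x)))
    rw [isPositiveFrame_iff_orientationSign b] at h1
    change 0 < _ * b.det (fun i => coordDeriv I 𝓘(ℝ, E) (extChartAt I x₀) x (v i)) at h1
    rw [det_frame_comp, hv] at h1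
    linarith
  have h0 := key x₀ hw.self_of_nhds
  rw [coordDeriv_eq _ _ (hasMFDerivAt_extChartAt_self I x₀)] at h0
  filter_upwards [hw] with x hx
  have h1 := key x hx
  have h2 : (ContinuousLinearMap.id ℝ E).det = 1 := LinearMap.det_id
  rw [h2, mul_one] at h0
  have h3 := mul_pos h0 h1
  have h4 : 0 < orientationSign b w ^ 2 := by have := orientationSign_ne_zero b w; positivity
  refine (pos_iff_pos_of_mul_pos (a := orientationSign b w ^ 2) ?_).1 h4
  linarith

/-- The map `f` preserves orientations with given signs. -/
def PreservesSign {M' : Type*} [TopologicalSpace M'] [ChartedSpace H M'] (I : ModelWithCorners ℝ E H)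
    (s : M → ℝ) (s' : M' → ℝ) (f : M → M') : Prop :=
  ∀ x, 0 < s x * s' (f x) * (coordDeriv I I f x).det

theorem preservesSign_of_preservesOrientation {M' : Type*} [TopologicalSpace M']
    [ChartedSpace H M'] {n : ℕ} {o : ManifoldOrientation I M (n + 1)}
    {o' : ManifoldOrientation I M' (n + 1)} (b : Module.Basis (Fin (n + 1)) ℝ E) {f : M → M'}
    (hf : PreservesOrientation o o' f) : PreservesSign I (o.sign b) (o'.sign b) f := by
  intro x
  obtain ⟨v, hv⟩ := exists_det_eq b (o.sign b x)
  have h1 := hf x v ((o.isPositiveFrame_iff b x v).2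
      (by rw [hv]; exact mul_self_pos.2 (o.sign_ne_zero b x)))
  rw [o'.isPositiveFrame_iff b] at h1
  change 0 < _ * b.det (fun i => coordDeriv I I f x (v i)) at h1
  rw [det_frame_comp, hv] at h1
  linarith

theorem coordDeriv_comp {E'' H'' M'' : Type*} [NormedAddCommGroup E''] [NormedSpace ℝ E'']
    [TopologicalSpace H''] {I'' : ModelWithCorners ℝ E'' H''} [TopologicalSpace M'']
    [ChartedSpace H'' M''] {g : M' → M''} {f : M → M'} (x : M)
    (hg : MDifferentiableAt I' I'' g (f x)) (hf : MDifferentiableAt I I' f x) :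
    coordDeriv I I'' (g ∘ f) x = (coordDeriv I' I'' g (f x)).comp (coordDeriv I I' f x) :=
  mfderiv_comp x hg hf

theorem ContinuousLinearMap.det_comp' (A B : E →L[ℝ] E) : (A.comp B).det = A.det * B.det :=
  LinearMap.det_comp (A : E →ₗ[ℝ] E) (B : E →ₗ[ℝ] E)

theorem PreservesSign.comp {M' M'' : Type*} [TopologicalSpace M'] [ChartedSpace H M']
    [TopologicalSpace M''] [ChartedSpace H M''] {s : M → ℝ} {s' : M' → ℝ} {s'' : M'' → ℝ}
    {g : M' → M''} {f : M → M'} (hg : PreservesSign I s' s'' g) (hf : PreservesSign I s s' f)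
    (hgd : MDifferentiable I I g) (hfd : MDifferentiable I I f) :
    PreservesSign I s s'' (g ∘ f) := by
  intro x
  rw [coordDeriv_comp I x (hgd _) (hfd _), ContinuousLinearMap.det_comp']
  have h1 := mul_pos (hf x) (hg (f x))
  have h0 : s' (f x) ≠ 0 := by
    intro h; have := hf x; rw [h] at this; simp at this
  have h2 : 0 < s' (f x) ^ 2 := by positivity
  refine (pos_iff_pos_of_mul_pos (a := s' (f x) ^ 2) ?_).1 h2
  simp only [Function.comp_apply]
  linarith

theorem PreservesSign.id {s : M → ℝ} (hs : ∀ x, s x ≠ 0) : PreservesSign I s s (fun x => x) := by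
  intro x
  have : coordDeriv I I (fun x : M => x) x = ContinuousLinearMap.id ℝ E := mfderiv_id
  rw [this]
  have h2 : (ContinuousLinearMap.id ℝ E).det = 1 := LinearMap.det_id
  rw [h2, mul_one]; exact mul_self_pos.2 (hs x)

end MDeriv

end

noncomputable section

set_option linter.unusedSectionVars false

/-! ### Orientations of products -/

section Product

variable {E H M : Type*} [NormedAddCommGroup E] [NormedSpace ℝ E] [TopologicalSpace H]
  {I : ModelWithCorners ℝ E H} [TopologicalSpace M] [ChartedSpace H M]
  {E' H' M' : Type*} [NormedAddCommGroup E'] [NormedSpace ℝ E'] [TopologicalSpace H']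
  {I' : ModelWithCorners ℝ E' H'} [TopologicalSpace M'] [ChartedSpace H' M']

theorem ContinuousLinearMap.det_prodMap' [FiniteDimensional ℝ E] [FiniteDimensional ℝ E']
    (A : E →L[ℝ] E) (B : E' →L[ℝ] E') : (A.prodMap B).det = A.det * B.det :=
  LinearMap.det_prodMap (A : E →ₗ[ℝ] E) (B : E' →ₗ[ℝ] E')

theorem coordDeriv_prodMap {E₁ H₁ N E₂ H₂ N' : Type*} [NormedAddCommGroup E₁] [NormedSpace ℝ E₁]
    [TopologicalSpace H₁] {I₁ : ModelWithCorners ℝ E₁ H₁} [TopologicalSpace N] [ChartedSpace H₁ N]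
    [NormedAddCommGroup E₂] [NormedSpace ℝ E₂]
    [TopologicalSpace H₂] {I₂ : ModelWithCorners ℝ E₂ H₂} [TopologicalSpace N'] [ChartedSpace H₂ N']
    {f : M → N} {g : M' → N'} {p : M × M'}
    (hf : MDifferentiableAt I I₁ f p.1) (hg : MDifferentiableAt I' I₂ g p.2) :
    coordDeriv (I.prod I') (I₁.prod I₂) (Prod.map f g) p =
      (coordDeriv I I₁ f p.1).prodMap (coordDeriv I' I₂ g p.2) := mfderiv_prodMap hf hg

theorem IsOrientationSign.prod [FiniteDimensional ℝ E] [FiniteDimensional ℝ E'] [IsManifold I ∞ M]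
    [IsManifold I' ∞ M'] {s : M → ℝ} {s' : M' → ℝ} (hs : IsOrientationSign I s)
    (hs' : IsOrientationSign I' s') :
    IsOrientationSign (I.prod I') fun p : M × M' => s p.1 * s' p.2 := by
  rintro ⟨x₀, y₀⟩
  have h1 : ∀ᶠ p : M × M' in 𝓝 (x₀, y₀), p.1 ∈ (chartAt H x₀).source :=
    continuous_fst.continuousAt.eventually (chart_source_mem_nhds H x₀)
  have h2 : ∀ᶠ p : M × M' in 𝓝 (x₀, y₀), p.2 ∈ (chartAt H' y₀).source :=
    continuous_snd.continuousAt.eventually (chart_source_mem_nhds H' y₀)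
  have h3 : ∀ᶠ p : M × M' in 𝓝 (x₀, y₀), _ := continuous_fst.continuousAt.eventually (hs x₀)
  have h4 : ∀ᶠ p : M × M' in 𝓝 (x₀, y₀), _ := continuous_snd.continuousAt.eventually (hs' y₀)
  filter_upwards [h1, h2, h3, h4] with p hp1 hp2 hp3 hp4
  have e : coordDeriv (I.prod I') 𝓘(ℝ, E × E') (extChartAt (I.prod I') (x₀, y₀)) p =
      (coordDeriv I 𝓘(ℝ, E) (extChartAt I x₀) p.1).prodMap
        (coordDeriv I' 𝓘(ℝ, E') (extChartAt I' y₀) p.2) := by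
    rw [← coordDeriv_prodMap (mdifferentiableAt_extChartAt' I hp1)
      (mdifferentiableAt_extChartAt' I' hp2), extChartAt_prod, modelWithCornersSelf_prod,
      ← chartedSpaceSelf_prod]
    rfl
  rw [e, ContinuousLinearMap.det_prodMap']
  have := mul_pos hp3 hp4
  linarith

theorem PreservesSign.prodMap [FiniteDimensional ℝ E] [FiniteDimensional ℝ E'] {N N' : Type*}
    [TopologicalSpace N] [ChartedSpace H N] [TopologicalSpace N'] [ChartedSpace H' N']
    {s : M → ℝ} {s' : M' → ℝ} {r : N → ℝ} {r' : N' → ℝ} {f : M → N} {g : M' → N'}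
    (hf : PreservesSign I s r f) (hg : PreservesSign I' s' r' g)
    (hfd : MDifferentiable I I f) (hgd : MDifferentiable I' I' g) :
    PreservesSign (I.prod I') (fun p : M × M' => s p.1 * s' p.2) (fun p : N × N' => r p.1 * r' p.2)
      (Prod.map f g) := by
  intro p
  rw [coordDeriv_prodMap (hfd _) (hgd _), ContinuousLinearMap.det_prodMap']
  have := mul_pos (hf p.1) (hg p.2)
  simp only [Prod.map_fst, Prod.map_snd]
  linarith

end Product

/-! ### Change of the model space -/

section

variable {E H E' : Type*} [NormedAddCommGroup E] [NormedSpace ℝ E] [TopologicalSpace H]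
  {I : ModelWithCorners ℝ E H} [NormedAddCommGroup E'] [NormedSpace ℝ E']

theorem ContinuousLinearMap.det_conj_equiv (L : E ≃L[ℝ] E') (A : E →L[ℝ] E) :
    ((L : E →L[ℝ] E').comp (A.comp (L.symm : E' →L[ℝ] E))).det = A.det :=
  LinearMap.det_conj (A : E →ₗ[ℝ] E) L.toLinearEquiv

theorem mem_contDiffGroupoid_iff {e : OpenPartialHomeomorph H H} :
    e ∈ contDiffGroupoid ∞ I ↔
      ContDiffOn ℝ ∞ (I ∘ e ∘ I.symm) (I.symm ⁻¹' e.source ∩ Set.range I) ∧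
      ContDiffOn ℝ ∞ (I ∘ e.symm ∘ I.symm) (I.symm ⁻¹' e.target ∩ Set.range I) := by
  rw [contDiffGroupoid, mem_groupoid_of_pregroupoid, contDiffPregroupoid]

end

section Transport

variable {E H E' H' : Type*} [NormedAddCommGroup E] [NormedSpace ℝ E] [TopologicalSpace H]
  (I : ModelWithCorners ℝ E H) [NormedAddCommGroup E'] [NormedSpace ℝ E'] [TopologicalSpace H']
  (I' : ModelWithCorners ℝ E' H') (K : H ≃ₜ H') (L : E ≃L[ℝ] E')
  (M : Type*) [TopologicalSpace M] [ChartedSpace H M] [ChartedSpace H' M]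

/-- The charts of `M` with values in `H'` are obtained from those with values in `H` by composition
with `K`, which is the restriction of `L`. -/
structure IsChartTransport : Prop where
  model : ∀ h, I' (K h) = L (I h)
  chart : ∀ x : M, chartAt H' x = (chartAt H x).transHomeomorph K
  atlas : atlas H' M = (fun e => e.transHomeomorph K) '' atlas H M

variable {I I' K L M} (hT : IsChartTransport I I' K L M)
include hT

namespace IsChartTransport

theorem extChartAt_apply (x y : M) : extChartAt I' x y = L (extChartAt I x y) := by
  rw [extChartAt_coe, extChartAt_coe, hT.chart]
  exact hT.model _

theorem hasMFDerivAt_id (x : M) : HasMFDerivAt I I' (fun y : M => y) x (L : E →L[ℝ] E') := by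
  refine hasMFDerivAt_of_eventuallyEq I I' continuousAt_id (g := L)
    L.hasFDerivWithinAt ?_
  filter_upwards [extChartAt_target_mem_nhdsWithin (I := I) x] with y hy
  rw [hT.extChartAt_apply, (extChartAt I x).right_inv hy]

theorem hasMFDerivAt_id' (x : M) :
    HasMFDerivAt I' I (fun y : M => y) x (L.symm : E' →L[ℝ] E) := by
  refine hasMFDerivAt_of_eventuallyEq I' I continuousAt_id (g := L.symm)
    L.symm.hasFDerivWithinAt ?_
  filter_upwards [extChartAt_target_mem_nhdsWithin (I := I') x] with y hy
  rw [← L.injective.eq_iff, ← hT.extChartAt_apply, (extChartAt I' x).right_inv hy]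
  simp

theorem contMDiff_id : ContMDiff I I' ∞ (fun y : M => y) := by
  intro x
  refine contMDiffAt_iff.2 ⟨continuousAt_id, ?_⟩
  refine (L.contDiff.contDiffWithinAt).congr_of_eventuallyEq (f := L) ?_ ?_
  · filter_upwards [extChartAt_target_mem_nhdsWithin (I := I) x] with y hy
    simp only [Function.comp_apply]
    rw [hT.extChartAt_apply, (extChartAt I x).right_inv hy]
  · simp only [Function.comp_apply]
    rw [hT.extChartAt_apply, extChartAt_to_inv]

theorem contMDiff_id' : ContMDiff I' I ∞ (fun y : M => y) := by
  intro x
  refine contMDiffAt_iff.2 ⟨continuousAt_id, ?_⟩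
  have key : ∀ y ∈ (extChartAt I' x).target,
      extChartAt I x ((extChartAt I' x).symm y) = L.symm y := fun y hy => by
    rw [← L.injective.eq_iff, ← hT.extChartAt_apply, (extChartAt I' x).right_inv hy]
    simp
  refine (L.symm.contDiff.contDiffWithinAt).congr_of_eventuallyEq (f := L.symm) ?_ ?_
  · filter_upwards [extChartAt_target_mem_nhdsWithin (I := I') x] with y hy
    exact key y hy
  · exact key _ (mem_extChartAt_target x)

theorem symm_apply (h : H) : I.symm (L.symm (I' (K h))) = h := by
  rw [hT.model]; simp

theorem isManifold [IsManifold I ∞ M] : IsManifold I' ∞ M := by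
  refine isManifold_of_contDiffOn _ _ _ ?_
  rw [hT.atlas]
  rintro _ _ ⟨e, he, rfl⟩ ⟨e', he', rfl⟩
  have h1 : e.symm ≫ₕ e' ∈ contDiffGroupoid ∞ I := HasGroupoid.compatible he he'
  have h2 : ContDiffOn ℝ ∞ (I ∘ (e.symm ≫ₕ e') ∘ I.symm)
      (I.symm ⁻¹' (e.symm ≫ₕ e').source ∩ Set.range I) := (mem_contDiffGroupoid_iff.1 h1).1
  have h3 : ContDiffOn ℝ ∞ (L ∘ (I ∘ (e.symm ≫ₕ e') ∘ I.symm) ∘ L.symm)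
      (L.symm ⁻¹' (I.symm ⁻¹' (e.symm ≫ₕ e').source ∩ Set.range I)) :=
    L.contDiff.comp_contDiffOn (h2.comp L.symm.contDiff.contDiffOn (Set.mapsTo_preimage _ _))
  refine (h3.mono ?_).congr ?_
  · rintro _ ⟨hz, ⟨w, rfl⟩⟩
    obtain ⟨h, rfl⟩ := K.surjective w
    simp only [Set.mem_preimage, I'.left_inv] at hz
    refine ⟨?_, ?_⟩
    · rw [Set.mem_preimage, hT.symm_apply]
      simpa using hz
    · exact ⟨h, by rw [hT.model]; simp⟩
  · rintro _ ⟨hz, ⟨w, rfl⟩⟩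
    obtain ⟨h, rfl⟩ := K.surjective w
    simp only [Function.comp_apply, I'.left_inv, hT.symm_apply]
    rw [← hT.model]
    simp

theorem coordDeriv_conj {f : M → M} {x : M} (hf : MDifferentiableAt I I f x) :
    coordDeriv I' I' f x = (L : E →L[ℝ] E').comp ((coordDeriv I I f x).comp
      (L.symm : E' →L[ℝ] E)) :=
  ((hT.hasMFDerivAt_id (f x)).comp x (hf.hasMFDerivAt.comp x (hT.hasMFDerivAt_id' x))).mfderiv

theorem contMDiff {f : M → M} (hf : ContMDiff I I ∞ f) : ContMDiff I' I' ∞ f :=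
  hT.contMDiff_id.comp (hf.comp hT.contMDiff_id')

theorem isOrientationSign [IsManifold I ∞ M] {s : M → ℝ} (hs : IsOrientationSign I s) :
    IsOrientationSign I' s := by
  intro x₀
  filter_upwards [hs x₀, chart_source_mem_nhds H x₀] with x hx hx'
  have h1 := (mdifferentiableAt_extChartAt' I hx').hasMFDerivAt
  have h2 : HasMFDerivAt 𝓘(ℝ, E) 𝓘(ℝ, E') L (extChartAt I x₀ x) (L : E →L[ℝ] E') :=
    L.hasFDerivAt.hasMFDerivAt
  have h3 := h2.comp x (h1.comp x (hT.hasMFDerivAt_id' x))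
  have e : coordDeriv I' 𝓘(ℝ, E') (extChartAt I' x₀) x = (L : E →L[ℝ] E').comp
      ((coordDeriv I 𝓘(ℝ, E) (extChartAt I x₀) x).comp (L.symm : E' →L[ℝ] E)) := by
    have e0 : (extChartAt I' x₀ : M → E') = L ∘ extChartAt I x₀ :=
      funext (hT.extChartAt_apply x₀)
    rw [e0]
    exact coordDeriv_eq I' 𝓘(ℝ, E') h3
  rw [e, ContinuousLinearMap.det_conj_equiv]
  exact hx

theorem preservesSign {s : M → ℝ} {f : M → M} (hf : PreservesSign I s s f)
    (hfd : MDifferentiable I I f) : PreservesSign I' s s f := by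
  intro x
  rw [hT.coordDeriv_conj (hfd x), ContinuousLinearMap.det_conj_equiv]
  exact hf x

end IsChartTransport

end Transport

/-! ### Quotients of manifolds by actions of `ℤ` -/

namespace OrbitManifold

variable {E H : Type*} [NormedAddCommGroup E] [NormedSpace ℝ E] [TopologicalSpace H]
  {I : ModelWithCorners ℝ E H} {M : Type*} [TopologicalSpace M] [AddAction ℤ M]
  [ProperlyDiscontinuousVAdd ℤ M] [ContinuousConstVAdd ℤ M] [IsCancelVAdd ℤ M] [T2Space M]
  [LocallyCompactSpace M] [ChartedSpace H M]

/-- The quotient map. -/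
def mk (x : M) : AddAction.orbitRel.Quotient ℤ M := Quotient.mk (AddAction.orbitRel ℤ M) x

theorem isCoveringMap_mk : IsCoveringMap (mk (M := M)) :=
  isAddQuotientCoveringMap_quotientMk_of_properlyDiscontinuousVAdd.isCoveringMap

/-- The quotient map is a local homeomorphism. -/
theorem isLocalHomeomorph_mk : IsLocalHomeomorph (mk (M := M)) := isCoveringMap_mk.isLocalHomeomorph

/-- The representative of an orbit that is used in the definition of the charts. -/
def rep (q : AddAction.orbitRel.Quotient ℤ M) : M :=
  Exists.choose Quotient.mk_surjective.hasRightInverse q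

theorem mk_rep (q : AddAction.orbitRel.Quotient ℤ M) : mk (rep q) = q :=
  (Exists.choose_spec Quotient.mk_surjective.hasRightInverse :
    Function.RightInverse _ (Quotient.mk (AddAction.orbitRel ℤ M))) q

/-- A local inverse of the quotient map. -/
abbrev localSection (x : M) : OpenPartialHomeomorph (AddAction.orbitRel.Quotient ℤ M) M :=
  (isLocalHomeomorph_mk (M := M)).localInverseAt x

theorem chartAt_eq (q : AddAction.orbitRel.Quotient ℤ M) :
    chartAt H q = (localSection (rep q)).trans (chartAt H (rep q)) := rfl

theorem mk_vadd (n : ℤ) (x : M) : mk (n +ᵥ x) = mk x :=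
  (Quotient.sound ⟨n, rfl⟩ : Quotient.mk (AddAction.orbitRel ℤ M) (n +ᵥ x) = Quotient.mk _ x)

theorem exists_vadd_of_mk_eq {x y : M} (h : mk x = mk y) : ∃ n : ℤ, n +ᵥ y = x := Quotient.exact h

theorem localSection_mk {x y : M} (h : y ∈ (localSection x).target) : localSection x (mk y) = y := by
  have := (localSection x).right_inv h
  rwa [isLocalHomeomorph_mk.localInverseAt_symm] at this

theorem eventually_localSection {x q : M} (h : mk x ∈ (localSection q).source) {n : ℤ}
    (hn : n +ᵥ x = localSection q (mk x)) : ∀ᶠ y in 𝓝 x, localSection q (mk y) = n +ᵥ y := by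
  have hloc := isLocalHomeomorph_mk (M := M)
  have ht : n +ᵥ x ∈ (localSection q).target := by
    rw [hn]; exact (localSection q).map_source h
  have e1 : ∀ᶠ y in 𝓝 x, n +ᵥ y ∈ (localSection q).target :=
    (continuous_const_vadd n).continuousAt.preimage_mem_nhds ((localSection q).open_target.mem_nhds ht)
  filter_upwards [e1] with y hy1
  rw [← mk_vadd n y, localSection_mk hy1]

variable (hdeck : ∀ n : ℤ, ContMDiff I I ∞ (fun p : M => n +ᵥ p))

include hdeck in
theorem contMDiffAt_localSection_mk {q x : M} (hx : mk x ∈ (localSection q).source) :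
    ContMDiffAt I I ∞ (fun y : M => localSection q (mk y)) x := by
  obtain ⟨n, hn⟩ := exists_vadd_of_mk_eq (isLocalHomeomorph_mk.apply_localInverseAt_of_mem hx)
  exact (hdeck n x).congr_of_eventuallyEq (eventually_localSection hx hn)

/-- The chart of the quotient that is obtained from the chart of `M` at `p`. -/
abbrev chartOf (H : Type*) [TopologicalSpace H] [ChartedSpace H M] (p : M) :
    OpenPartialHomeomorph (AddAction.orbitRel.Quotient ℤ M) H :=
  (localSection p).trans (chartAt H p)

include hdeck in
theorem transition_mem_contDiffGroupoid [IsManifold I ∞ M] (p q : M) :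
    (chartOf H p).symm ≫ₕ chartOf H q ∈ contDiffGroupoid ∞ I := by
  have hloc := isLocalHomeomorph_mk (M := M)
  have hs : ∀ p q : M, ContMDiffOn I I ∞
      (((localSection p).trans (chartAt H p)).symm ≫ₕ ((localSection q).trans (chartAt H q)))
      (((localSection p).trans (chartAt H p)).symm ≫ₕ ((localSection q).trans (chartAt H q))).source := by
    intro p q z hz
    simp only [OpenPartialHomeomorph.trans_source, OpenPartialHomeomorph.symm_source,
      OpenPartialHomeomorph.trans_target, Set.mem_inter_iff, Set.mem_preimage,
      OpenPartialHomeomorph.coe_trans_symm, Function.comp_apply, hloc.localInverseAt_symm] at hz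
    obtain ⟨⟨hz1, -⟩, hz3, hz4⟩ := hz
    have a1 : ContMDiffAt I I ∞ (chartAt H p).symm z :=
      (contMDiffOn_chart_symm (I := I) (M := M)).contMDiffAt
        ((chartAt H p).open_target.mem_nhds hz1)
    have a2 := contMDiffAt_localSection_mk hdeck hz3
    have a3 := (contMDiffOn_chart (I := I) (n := ∞) (x := q)).contMDiffAt
        ((chartAt H q).open_source.mem_nhds hz4)
    have a4 := ContMDiffAt.comp z a3 (ContMDiffAt.comp z a2 a1)
    refine (a4.congr_of_eventuallyEq (.of_forall fun y => ?_)).contMDiffWithinAt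
    simp [hloc.localInverseAt_symm]
  have key : ∀ p q : M, ContDiffOn ℝ ∞ (I ∘ ((chartOf H p).symm ≫ₕ chartOf H q) ∘ I.symm)
      (I.symm ⁻¹' ((chartOf H p).symm ≫ₕ chartOf H q).source ∩ Set.range I) := by
    intro p q
    have h2 := (contMDiffOn_iff.1 (hs p q)).2
    by_cases hH : Nonempty H
    · obtain ⟨z⟩ := hH
      have h3 := h2 z z
      have hz : chartAt H z = OpenPartialHomeomorph.refl _ := chartAt_self_eq
      simp only [mfld_simps, extChartAt, hz] at h3
      simp only [mfld_simps, Function.comp_assoc] at h3 ⊢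
      rw [Set.inter_comm]
      exact h3
    · exact fun x hx => (hH ⟨I.symm x⟩).elim
  refine mem_contDiffGroupoid_iff.2 ⟨key p q, ?_⟩
  rw [← OpenPartialHomeomorph.symm_source, OpenPartialHomeomorph.trans_symm_eq_symm_trans_symm,
    OpenPartialHomeomorph.symm_symm]
  exact key q p

include hdeck in
theorem isManifold [IsManifold I ∞ M] : IsManifold I ∞ (AddAction.orbitRel.Quotient ℤ M) := by
  refine isManifold_of_contDiffOn _ _ _ ?_
  rintro e e' ⟨p, rfl⟩ ⟨q, rfl⟩
  exact (mem_contDiffGroupoid_iff.1 (transition_mem_contDiffGroupoid hdeck (rep p) (rep q))).1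

include hdeck in
theorem chartOf_mem_maximalAtlas [IsManifold I ∞ M] (p : M) :
    chartOf H p ∈ IsManifold.maximalAtlas I ∞ (AddAction.orbitRel.Quotient ℤ M) := by
  rintro _ ⟨q, rfl⟩
  exact ⟨transition_mem_contDiffGroupoid hdeck p (rep q),
    transition_mem_contDiffGroupoid hdeck (rep q) p⟩

end OrbitManifold

end

noncomputable section

set_option linter.unusedSectionVars false

namespace OrbitManifold

variable {E H : Type*} [NormedAddCommGroup E] [NormedSpace ℝ E] [TopologicalSpace H]
  {I : ModelWithCorners ℝ E H} {M : Type*} [TopologicalSpace M] [AddAction ℤ M]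
  [ProperlyDiscontinuousVAdd ℤ M] [ContinuousConstVAdd ℤ M] [IsCancelVAdd ℤ M] [T2Space M]
  [LocallyCompactSpace M] [ChartedSpace H M]

theorem mem_localSection_target (x : M) : x ∈ (localSection x).target :=
  isLocalHomeomorph_mk.self_mem_localInverseAt_target

theorem mk_mem_localSection_source {x p : M} (h : x ∈ (localSection p).target) :
    mk x ∈ (localSection p).source := by
  have := (localSection p).map_target h
  rwa [isLocalHomeomorph_mk.localInverseAt_symm] at this

theorem extChartAt_mk {q : AddAction.orbitRel.Quotient ℤ M} {x : M}
    (hx : x ∈ (localSection (rep q)).target) : extChartAt I q (mk x) = extChartAt I (rep q) x := by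
  change I (chartAt H (rep q) (localSection (rep q) (mk x))) = _
  rw [localSection_mk hx]
  rfl

theorem extChartAt_self (q : AddAction.orbitRel.Quotient ℤ M) :
    extChartAt I q q = extChartAt I (rep q) (rep q) := by
  have := extChartAt_mk (I := I) (mem_localSection_target (rep q))
  rwa [mk_rep] at this

theorem mk_mem_chartAt_source {q : AddAction.orbitRel.Quotient ℤ M} {x : M}
    (hx : x ∈ (localSection (rep q)).target) (hx' : x ∈ (chartAt H (rep q)).source) :
    mk x ∈ (chartAt H q).source := by
  rw [chartAt_eq, OpenPartialHomeomorph.trans_source]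
  refine ⟨mk_mem_localSection_source hx, ?_⟩
  rwa [Set.mem_preimage, localSection_mk hx]

theorem hasMFDerivAt_mk_rep (q : AddAction.orbitRel.Quotient ℤ M) :
    HasMFDerivAt I I (mk (M := M)) (rep q) (ContinuousLinearMap.id ℝ E) := by
  refine hasMFDerivAt_of_eventuallyEq I I isLocalHomeomorph_mk.continuous.continuousAt (g := id)
    (hasFDerivWithinAt_id _ _) ?_
  have h1 : ∀ᶠ y in 𝓝[Set.range I] (extChartAt I (rep q) (rep q)),
      (extChartAt I (rep q)).symm y ∈ (localSection (rep q)).target := by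
    refine (continuousAt_extChartAt_symm (I := I) (rep q)).continuousWithinAt.eventually ?_
    refine (localSection (rep q)).open_target.mem_nhds ?_
    rw [extChartAt_to_inv]
    exact mem_localSection_target _
  filter_upwards [h1, extChartAt_target_mem_nhdsWithin (I := I) (rep q)] with y hy hy'
  rw [mk_rep, extChartAt_mk hy, (extChartAt I (rep q)).right_inv hy', id]

theorem exists_eq_vadd_rep (x : M) : ∃ n : ℤ, n +ᵥ rep (mk x) = x :=
  exists_vadd_of_mk_eq (mk_rep _).symm

variable (hdeck : ∀ n : ℤ, ContMDiff I I ∞ (fun p : M => n +ᵥ p))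

include hdeck in
theorem hasMFDerivAt_mk {x : M} {q : AddAction.orbitRel.Quotient ℤ M} {n : ℤ}
    (hx : n +ᵥ x = rep q) :
    HasMFDerivAt I I (mk (M := M)) x (coordDeriv (E := E) (E' := E) I I (fun y : M => n +ᵥ y) x) := by
  have h1 : HasMFDerivAt I I (mk (M := M)) (n +ᵥ x) (ContinuousLinearMap.id ℝ E) := by
    rw [hx]; exact hasMFDerivAt_mk_rep q
  have h2 : HasMFDerivAt I I (fun y : M => n +ᵥ y) x (coordDeriv (E := E) (E' := E) I I (fun y : M => n +ᵥ y) x) :=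
    ((hdeck n).mdifferentiable (by simp) x).hasMFDerivAt
  have h3 := h1.comp x h2
  have e : mk (M := M) ∘ (fun y : M => n +ᵥ y) = mk := funext fun y => mk_vadd n y
  rw [e] at h3
  exact h3

include hdeck in
theorem contMDiff_mk [IsManifold I ∞ M] : ContMDiff I I ∞ (mk (M := M)) := by
  intro x
  refine contMDiffAt_iff_target.2 ⟨isLocalHomeomorph_mk.continuous.continuousAt, ?_⟩
  have hx : mk x ∈ (localSection (rep (mk x))).source := by
    have := mk_mem_localSection_source (mem_localSection_target (rep (mk x)))
    rwa [mk_rep] at this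
  have h1 := contMDiffAt_localSection_mk hdeck hx
  have h2 : localSection (rep (mk x)) (mk x) ∈ (chartAt H (rep (mk x))).source := by
    have := localSection_mk (mem_localSection_target (rep (mk x)))
    rw [mk_rep] at this
    rw [this]
    exact mem_chart_source _ _
  exact ContMDiffAt.comp (g := extChartAt I (rep (mk x)))
    (f := fun y : M => localSection (rep (mk x)) (mk y)) x (contMDiffAt_extChartAt' h2) h1

include hdeck in
theorem preservesSign_mk {s : M → ℝ} (hinv : ∀ n : ℤ, PreservesSign I s s fun p : M => n +ᵥ p) :
    PreservesSign I s (fun q : AddAction.orbitRel.Quotient ℤ M => s (rep q)) (mk (M := M)) := by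
  intro x
  obtain ⟨n, hn⟩ := exists_eq_vadd_rep x
  have h1 : -n +ᵥ x = rep (mk x) := by
    rw [neg_vadd_eq_iff]; exact hn.symm
  have h2 := hinv (-n) x
  rw [coordDeriv_eq I I (hasMFDerivAt_mk hdeck h1)]
  dsimp only
  rw [← h1]
  exact h2

include hdeck in
theorem isOrientationSign [FiniteDimensional ℝ E] [IsManifold I ∞ M] {s : M → ℝ}
    (hs : IsOrientationSign I s) (hinv : ∀ n : ℤ, PreservesSign I s s fun p : M => n +ᵥ p) :
    IsOrientationSign I (fun q : AddAction.orbitRel.Quotient ℤ M => s (rep q)) := by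
  have : IsManifold I ∞ (AddAction.orbitRel.Quotient ℤ M) := isManifold hdeck
  intro q₀
  have e : 𝓝 q₀ = Filter.map mk (𝓝 (rep q₀)) := by
    rw [isLocalHomeomorph_mk.map_nhds_eq, mk_rep]
  rw [e, Filter.eventually_map]
  filter_upwards [hs (rep q₀), chart_source_mem_nhds H (rep q₀),
    (localSection (rep q₀)).open_target.eventually_mem (mem_localSection_target (rep q₀)),
    ((localSection (rep q₀)).open_target.eventually_mem
      (mem_localSection_target (rep q₀))).eventually_nhds] with x h1 h2 h3 h4
  have h5 : MDifferentiableAt I 𝓘(ℝ, E) (extChartAt I q₀) (mk x) :=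
    mdifferentiableAt_extChartAt' I (mk_mem_chartAt_source h3 h2)
  have h6 : MDifferentiableAt I I (mk (M := M)) x := (contMDiff_mk hdeck).mdifferentiable (by simp) x
  have h7 : coordDeriv I 𝓘(ℝ, E) (extChartAt I (rep q₀)) x =
      (coordDeriv I 𝓘(ℝ, E) (extChartAt I q₀) (mk x)).comp (coordDeriv I I mk x) := by
    have h8 := h5.hasMFDerivAt.comp x h6.hasMFDerivAt
    refine coordDeriv_eq I 𝓘(ℝ, E) (h8.congr_of_eventuallyEq ?_)
    filter_upwards [h4] with y hy
    exact (extChartAt_mk hy).symm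
  have h9 := preservesSign_mk hdeck hinv x
  rw [h7, ContinuousLinearMap.det_comp'] at h1
  have h10 := mul_pos h1 h9
  by_contra h
  push Not at h
  refine absurd h10 (not_lt.2 ?_)
  have h11 := mul_nonpos_of_nonpos_of_nonneg h
    (sq_nonneg (s x * (coordDeriv I I mk x).det))
  refine le_trans (le_of_eq ?_) h11
  ring

end OrbitManifold

end

noncomputable section

set_option linter.unusedSectionVars false

/-! ### Surfaces with boundary in `ℝ³` -/

/-- The vector product. -/
def crossVec (X Y : ℝ × ℝ × ℝ) : ℝ × ℝ × ℝ :=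
  (X.2.1 * Y.2.2 - X.2.2 * Y.2.1, X.2.2 * Y.1 - X.1 * Y.2.2, X.1 * Y.2.1 - X.2.1 * Y.1)

/-- The scalar product. -/
def dotVec (X Y : ℝ × ℝ × ℝ) : ℝ := X.1 * Y.1 + X.2.1 * Y.2.1 + X.2.2 * Y.2.2

theorem dotVec_smul (w n : ℝ × ℝ × ℝ) (c : ℝ) : dotVec w (c • n) = c * dotVec w n := by
  simp only [dotVec, Prod.smul_fst, Prod.smul_snd, smul_eq_mul]; ring

theorem exists_crossVec_eq_smul {n X Y w : ℝ × ℝ × ℝ} (hw : 0 < dotVec w n)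
    (hX : dotVec n X = 0) (hY : dotVec n Y = 0) : ∃ c : ℝ, crossVec X Y = c • n := by
  refine ⟨dotVec w (crossVec X Y) / dotVec w n, ?_⟩
  have key : dotVec w n • crossVec X Y = dotVec w (crossVec X Y) • n := by
    obtain ⟨n₁, n₂, n₃⟩ := n
    obtain ⟨x₁, x₂, x₃⟩ := X
    obtain ⟨y₁, y₂, y₃⟩ := Y
    obtain ⟨w₁, w₂, w₃⟩ := w
    simp only [dotVec, crossVec] at *
    refine Prod.ext ?_ (Prod.ext ?_ ?_) <;> simp only [Prod.smul_mk, smul_eq_mul]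
    · linear_combination (w₂ * y₃ - w₃ * y₂) * hX - (w₂ * x₃ - w₃ * x₂) * hY
    · linear_combination (w₃ * y₁ - w₁ * y₃) * hX - (w₃ * x₁ - w₁ * x₃) * hY
    · linear_combination (w₁ * y₂ - w₂ * y₁) * hX - (w₁ * x₂ - w₂ * x₁) * hY
  rw [div_eq_inv_mul, mul_smul, ← key, smul_smul, inv_mul_cancel₀ hw.ne', one_smul]

theorem ContinuousLinearMap.det_euclideanPlane
    (A : EuclideanSpace ℝ (Fin 2) →L[ℝ] EuclideanSpace ℝ (Fin 2)) :
    A.det = A (EuclideanSpace.single 0 1) 0 * A (EuclideanSpace.single 1 1) 1 -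
      A (EuclideanSpace.single 0 1) 1 * A (EuclideanSpace.single 1 1) 0 := by
  have h := LinearMap.det_toMatrix (EuclideanSpace.basisFun (Fin 2) ℝ).toBasis
    (A : EuclideanSpace ℝ (Fin 2) →ₗ[ℝ] EuclideanSpace ℝ (Fin 2))
  rw [Matrix.det_fin_two] at h
  simp only [LinearMap.toMatrix_apply, OrthonormalBasis.coe_toBasis,
    EuclideanSpace.basisFun_apply, OrthonormalBasis.coe_toBasis_repr_apply,
    EuclideanSpace.basisFun_repr] at h
  refine h.symm.trans ?_
  simp only [ContinuousLinearMap.coe_coe]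
  ring

/-- The linear map to the plane with given coordinates. -/
def planeMap {V : Type*} [NormedAddCommGroup V] [NormedSpace ℝ V] (f g : V →L[ℝ] ℝ) :
    V →L[ℝ] EuclideanSpace ℝ (Fin 2) :=
  ((EuclideanSpace.equiv (Fin 2) ℝ).symm : (Fin 2 → ℝ) →L[ℝ] EuclideanSpace ℝ (Fin 2)).comp
    (ContinuousLinearMap.pi ![f, g])

@[simp]
theorem planeMap_apply_zero {V : Type*} [NormedAddCommGroup V] [NormedSpace ℝ V]
    (f g : V →L[ℝ] ℝ) (x : V) : planeMap f g x 0 = f x := rfl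

@[simp]
theorem planeMap_apply_one {V : Type*} [NormedAddCommGroup V] [NormedSpace ℝ V]
    (f g : V →L[ℝ] ℝ) (x : V) : planeMap f g x 1 = g x := rfl

/-- A parametrized patch of a surface with boundary `S` with normal field `ν` in `ℝ³`. -/
structure SurfacePatch (S : Set (ℝ × ℝ × ℝ)) (ν : ℝ × ℝ × ℝ → ℝ × ℝ × ℝ) where
  /-- An open subset of `ℝ³`; the patch is its intersection with `S`. -/
  U : Set (ℝ × ℝ × ℝ)
  /-- The domain of the parametrization. -/
  V : Set (EuclideanSpace ℝ (Fin 2))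
  /-- The first coordinate is `2 + f`. -/
  f : ℝ × ℝ × ℝ →L[ℝ] ℝ
  /-- The second coordinate. -/
  g : ℝ × ℝ × ℝ →L[ℝ] ℝ
  /-- The parametrization. -/
  Q : EuclideanSpace ℝ (Fin 2) → ℝ × ℝ × ℝ
  /-- The direction of the projection. -/
  w : ℝ × ℝ × ℝ
  isOpen_U : IsOpen U
  isOpen_V : IsOpen V
  contDiffOn_Q : ContDiffOn ℝ ∞ Q V
  nonneg : ∀ σ ∈ S, 0 ≤ 2 + f σ
  mem_V : ∀ σ ∈ S, σ ∈ U → EuclideanSpace.single 0 2 + planeMap f g σ ∈ V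
  left_inv : ∀ σ ∈ S, σ ∈ U → Q (EuclideanSpace.single 0 2 + planeMap f g σ) = σ
  mem_S : ∀ y ∈ V, 0 ≤ y 0 → Q y ∈ S
  mem_U : ∀ y ∈ V, Q y ∈ U
  right_inv : ∀ y ∈ V, EuclideanSpace.single 0 2 + planeMap f g (Q y) = y
  cross : ∀ X Y, f X * g Y - g X * f Y = dotVec w (crossVec X Y)
  pos : ∀ σ ∈ S, σ ∈ U → 0 < dotVec w (ν σ)
  orth : ∀ y ∈ V, ∀ u, dotVec (ν (Q y)) (fderiv ℝ Q y u) = 0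

namespace SurfacePatch

variable {S : Set (ℝ × ℝ × ℝ)} {ν : ℝ × ℝ × ℝ → ℝ × ℝ × ℝ} (c c' : SurfacePatch S ν)

/-- The coordinates. -/
def P (σ : ℝ × ℝ × ℝ) : EuclideanSpace ℝ (Fin 2) :=
  EuclideanSpace.single 0 2 + planeMap c.f c.g σ

theorem P_apply_zero (σ : ℝ × ℝ × ℝ) : c.P σ 0 = 2 + c.f σ := by simp [P]

theorem hasFDerivAt_P (σ : ℝ × ℝ × ℝ) : HasFDerivAt c.P (planeMap c.f c.g) σ :=
  ((planeMap c.f c.g).hasFDerivAt).const_add _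

theorem contDiff_P : ContDiff ℝ ∞ c.P := contDiff_const.add (planeMap c.f c.g).contDiff

/-- The change of coordinates, composed with a translation. -/
def transition (τ : ℝ × ℝ × ℝ) (y : EuclideanSpace ℝ (Fin 2)) : EuclideanSpace ℝ (Fin 2) :=
  c'.P (c.Q y + τ)

theorem contDiffOn_transition (τ : ℝ × ℝ × ℝ) : ContDiffOn ℝ ∞ (c.transition c' τ) c.V :=
  c'.contDiff_P.comp_contDiffOn (c.contDiffOn_Q.add contDiffOn_const)

theorem hasFDerivAt_Q {y : EuclideanSpace ℝ (Fin 2)} (hy : y ∈ c.V) :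
    HasFDerivAt c.Q (fderiv ℝ c.Q y) y :=
  ((c.contDiffOn_Q.contDiffAt (c.isOpen_V.mem_nhds hy)).differentiableAt (by simp)).hasFDerivAt

theorem hasFDerivAt_transition (τ : ℝ × ℝ × ℝ) {y : EuclideanSpace ℝ (Fin 2)} (hy : y ∈ c.V) :
    HasFDerivAt (c.transition c' τ) ((planeMap c'.f c'.g).comp (fderiv ℝ c.Q y)) y :=
  (c'.hasFDerivAt_P _).comp y ((c.hasFDerivAt_Q hy).add_const τ)

theorem det_transition_pos {τ : ℝ × ℝ × ℝ} {y : EuclideanSpace ℝ (Fin 2)} (hy : y ∈ c.V)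
    (hS : c.Q y ∈ S) (hS' : c.Q y + τ ∈ S) (hU' : c.Q y + τ ∈ c'.U)
    (hν : ν (c.Q y + τ) = ν (c.Q y)) :
    0 < ((planeMap c'.f c'.g).comp (fderiv ℝ c.Q y)).det := by
  set X := fderiv ℝ c.Q y (EuclideanSpace.single 0 1) with hX
  set Y := fderiv ℝ c.Q y (EuclideanSpace.single 1 1) with hY
  have hdet : ∀ d : SurfacePatch S ν,
      ((planeMap d.f d.g).comp (fderiv ℝ c.Q y)).det = dotVec d.w (crossVec X Y) := by
    intro d
    rw [ContinuousLinearMap.det_euclideanPlane, ← d.cross]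
    simp [← hX, ← hY]
  have hpos := c.pos _ hS (c.mem_U y hy)
  obtain ⟨l, hl⟩ := exists_crossVec_eq_smul hpos (c.orth y hy (EuclideanSpace.single 0 1))
    (c.orth y hy (EuclideanSpace.single 1 1))
  rw [← hX, ← hY] at hl
  have hid : (planeMap c.f c.g).comp (fderiv ℝ c.Q y) = ContinuousLinearMap.id ℝ _ := by
    have h1 := (c.hasFDerivAt_P _).comp y (c.hasFDerivAt_Q hy)
    have h2 : HasFDerivAt (c.P ∘ c.Q) (ContinuousLinearMap.id ℝ _) y := by
      refine (hasFDerivAt_id y).congr_of_eventuallyEq ?_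
      filter_upwards [c.isOpen_V.mem_nhds hy] with z hz
      exact c.right_inv z hz
    exact h1.unique h2
  have h1 := hdet c
  rw [hid, hl, dotVec_smul] at h1
  have h1' : (1 : ℝ) = l * dotVec c.w (ν (c.Q y)) := by
    rw [← h1]; exact (LinearMap.det_id (M := EuclideanSpace ℝ (Fin 2)) (A := ℝ)).symm
  have hlpos : 0 < l := by
    by_contra h
    push Not at h
    nlinarith [mul_nonpos_of_nonpos_of_nonneg h hpos.le]
  rw [hdet, hl, dotVec_smul, ← hν]
  exact mul_pos hlpos (c'.pos _ hS' hU')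

theorem mem_V' {σ : ℝ × ℝ × ℝ} (h : σ ∈ S) (h' : σ ∈ c.U) : c.P σ ∈ c.V := c.mem_V σ h h'

theorem Q_P {σ : ℝ × ℝ × ℝ} (h : σ ∈ S) (h' : σ ∈ c.U) : c.Q (c.P σ) = σ := c.left_inv σ h h'

theorem P_Q {y : EuclideanSpace ℝ (Fin 2)} (h : y ∈ c.V) : c.P (c.Q y) = y := c.right_inv y h

open Classical in
/-- The chart of the surface that is defined by a patch. -/
def chart [Inhabited S] : OpenPartialHomeomorph S (EuclideanHalfSpace 2) where
  toFun σ := ⟨c.P σ.1, (c.P_apply_zero σ.1).symm ▸ c.nonneg σ.1 σ.2⟩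
  invFun y := if h : c.Q y.1 ∈ S then ⟨c.Q y.1, h⟩ else default
  source := {σ | σ.1 ∈ c.U}
  target := {y | y.1 ∈ c.V}
  map_source' σ hσ := c.mem_V' σ.2 hσ
  map_target' y hy := by
    simp only [Set.mem_ofPred_eq, dif_pos (c.mem_S y.1 hy y.2)]
    exact c.mem_U _ hy
  left_inv' σ hσ := by
    have h := c.Q_P σ.2 hσ
    simp only [h, Subtype.coe_prop, dite_true]
  right_inv' y hy := by
    simp only [dif_pos (c.mem_S y.1 hy y.2)]
    exact Subtype.ext (c.P_Q hy)
  open_source := c.isOpen_U.preimage continuous_subtype_val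
  open_target := c.isOpen_V.preimage continuous_subtype_val
  continuousOn_toFun := (c.contDiff_P.continuous.comp continuous_subtype_val).subtype_mk _
    |>.continuousOn
  continuousOn_invFun := by
    rw [Topology.IsInducing.subtypeVal.continuousOn_iff]
    have h : ContinuousOn (fun y : EuclideanHalfSpace 2 => c.Q y.1) {y | y.1 ∈ c.V} :=
      c.contDiffOn_Q.continuousOn.comp continuous_subtype_val.continuousOn fun _ h => h
    refine h.congr fun y hy => ?_
    simp only [Function.comp_apply, dif_pos (c.mem_S y.1 hy y.2)]

open Classical in
theorem chart_symm_apply [Inhabited S] {y : EuclideanHalfSpace 2} (hy : y.1 ∈ c.V) :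
    (c.chart.symm y).1 = c.Q y.1 := by
  change (dite _ _ _ : S).1 = _
  rw [dif_pos (c.mem_S y.1 hy y.2)]

end SurfacePatch

/-- A covering of a surface by patches. -/
structure SurfaceAtlas (S : Set (ℝ × ℝ × ℝ)) (ν : ℝ × ℝ × ℝ → ℝ × ℝ × ℝ) where
  /-- The index set of the patches. -/
  ι : Type
  /-- The patches. -/
  patch : ι → SurfacePatch S ν
  /-- The preferred patch at a point. -/
  index : S → ι
  mem_U : ∀ σ : S, σ.1 ∈ (patch (index σ)).U

namespace SurfaceAtlas

variable {S : Set (ℝ × ℝ × ℝ)} {ν : ℝ × ℝ × ℝ → ℝ × ℝ × ℝ} (A : SurfaceAtlas S ν) [Inhabited S]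

/-- The charts that are defined by the patches. -/
abbrev chartedSpace : ChartedSpace (EuclideanHalfSpace 2) S where
  atlas := Set.range fun i => (A.patch i).chart
  chartAt σ := (A.patch (A.index σ)).chart
  mem_chart_source σ := A.mem_U σ
  chart_mem_atlas σ := ⟨A.index σ, rfl⟩

theorem isManifold : letI := A.chartedSpace; IsManifold (𝓡∂ 2) ∞ S := by
  let := A.chartedSpace
  refine isManifold_of_contDiffOn _ _ _ ?_
  rintro _ _ ⟨i, rfl⟩ ⟨j, rfl⟩
  refine ((((A.patch i).contDiffOn_transition (A.patch j) 0)).mono ?_).congr ?_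
  · rintro _ ⟨hz, y, rfl⟩
    simp only [Set.mem_preimage, (𝓡∂ 2).left_inv] at hz
    exact hz.1
  · rintro _ ⟨hz, y, rfl⟩
    simp only [Set.mem_preimage, (𝓡∂ 2).left_inv] at hz
    simp only [Function.comp_apply, (𝓡∂ 2).left_inv]
    change (A.patch j).P ((A.patch i).chart.symm y).1 = (A.patch j).P _
    rw [(A.patch i).chart_symm_apply hz.1, add_zero]
    rfl

theorem extChartAt_symm_apply (σ : S) {z : EuclideanSpace ℝ (Fin 2)}
    (hz : z ∈ (A.patch (A.index σ)).V) (hz' : 0 ≤ z 0) : letI := A.chartedSpace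
    ((extChartAt (𝓡∂ 2) σ).symm z).1 = (A.patch (A.index σ)).Q z := by
  let := A.chartedSpace
  have h : (𝓡∂ 2).symm ((𝓡∂ 2) (⟨z, hz'⟩ : EuclideanHalfSpace 2)) = ⟨z, hz'⟩ :=
    (𝓡∂ 2).left_inv _
  rw [extChartAt_coe_symm, Function.comp_apply]
  exact (congrArg (fun y => ((A.patch (A.index σ)).chart.symm y).1) h).trans
    ((A.patch (A.index σ)).chart_symm_apply (y := ⟨z, hz'⟩) hz)

theorem eventually_symm (σ : S) : letI := A.chartedSpace
    ∀ᶠ z in 𝓝[Set.range (𝓡∂ 2)] (extChartAt (𝓡∂ 2) σ σ),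
      ((extChartAt (𝓡∂ 2) σ).symm z).1 = (A.patch (A.index σ)).Q z := by
  let := A.chartedSpace
  have h1 : (A.patch (A.index σ)).V ∈ 𝓝 (extChartAt (𝓡∂ 2) σ σ) :=
    (A.patch (A.index σ)).isOpen_V.mem_nhds ((A.patch (A.index σ)).mem_V' σ.2 (A.mem_U σ))
  filter_upwards [nhdsWithin_le_nhds h1, self_mem_nhdsWithin] with z hz hz'
  obtain ⟨y, rfl⟩ := hz'
  exact A.extChartAt_symm_apply σ hz y.2

theorem mem_V (σ : S) : (A.patch (A.index σ)).P σ.1 ∈ (A.patch (A.index σ)).V :=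
  (A.patch (A.index σ)).mem_V' σ.2 (A.mem_U σ)

theorem Q_P (σ : S) : (A.patch (A.index σ)).Q ((A.patch (A.index σ)).P σ.1) = σ.1 :=
  (A.patch (A.index σ)).Q_P σ.2 (A.mem_U σ)

theorem hasMFDerivAt_translation {f : S → S} (hf : Continuous f) {τ : ℝ × ℝ × ℝ}
    (hτ : ∀ σ, (f σ).1 = σ.1 + τ) (σ : S) : letI := A.chartedSpace
    HasMFDerivAt (𝓡∂ 2) (𝓡∂ 2) f σ
      ((planeMap (A.patch (A.index (f σ))).f (A.patch (A.index (f σ))).g).comp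
        (fderiv ℝ (A.patch (A.index σ)).Q ((A.patch (A.index σ)).P σ.1))) := by
  let := A.chartedSpace
  refine hasMFDerivAt_of_eventuallyEq (𝓡∂ 2) (𝓡∂ 2) hf.continuousAt
    ((A.patch (A.index σ)).hasFDerivAt_transition (A.patch (A.index (f σ))) τ
      (A.mem_V σ)).hasFDerivWithinAt ?_
  filter_upwards [A.eventually_symm σ] with z hz
  change (A.patch (A.index (f σ))).P (f _).1 = _
  rw [hτ, hz]
  rfl

theorem contMDiff_translation {f : S → S} (hf : Continuous f) {τ : ℝ × ℝ × ℝ}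
    (hτ : ∀ σ, (f σ).1 = σ.1 + τ) : letI := A.chartedSpace
    ContMDiff (𝓡∂ 2) (𝓡∂ 2) ∞ f := by
  let := A.chartedSpace
  intro σ
  refine contMDiffAt_iff.2 ⟨hf.continuousAt, ?_⟩
  have h := (((A.patch (A.index σ)).contDiffOn_transition (A.patch (A.index (f σ))) τ).contDiffAt
    ((A.patch (A.index σ)).isOpen_V.mem_nhds (A.mem_V σ))).contDiffWithinAt (s := Set.range (𝓡∂ 2))
  refine h.congr_of_eventuallyEq_of_mem ?_ ⟨(A.patch (A.index σ)).chart σ, rfl⟩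
  filter_upwards [A.eventually_symm σ] with z hz
  change (A.patch (A.index (f σ))).P (f _).1 = _
  rw [hτ, hz]
  rfl

theorem preservesSign_translation {f : S → S} (hf : Continuous f) {τ : ℝ × ℝ × ℝ}
    (hτ : ∀ σ, (f σ).1 = σ.1 + τ) (hν : ∀ σ, ν (σ + τ) = ν σ) : letI := A.chartedSpace
    PreservesSign (𝓡∂ 2) (fun _ : S => 1) (fun _ : S => 1) f := by
  let := A.chartedSpace
  intro σ
  rw [coordDeriv_eq _ _ (A.hasMFDerivAt_translation hf hτ σ), one_mul, one_mul]
  refine (A.patch (A.index σ)).det_transition_pos (A.patch (A.index (f σ))) (τ := τ) (A.mem_V σ)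
    ?_ ?_ ?_ (hν _)
  · rw [A.Q_P]; exact σ.2
  · rw [A.Q_P, ← hτ]; exact (f σ).2
  · rw [A.Q_P, ← hτ]; exact A.mem_U _

theorem isOrientationSign : letI := A.chartedSpace
    IsOrientationSign (𝓡∂ 2) (fun _ : S => 1) := by
  let := A.chartedSpace
  intro σ₀
  filter_upwards [chart_source_mem_nhds (EuclideanHalfSpace 2) σ₀] with σ hσ
  have h : HasMFDerivAt (𝓡∂ 2) 𝓘(ℝ, EuclideanSpace ℝ (Fin 2)) (extChartAt (𝓡∂ 2) σ₀) σ
      ((planeMap (A.patch (A.index σ₀)).f (A.patch (A.index σ₀)).g).comp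
        (fderiv ℝ (A.patch (A.index σ)).Q ((A.patch (A.index σ)).P σ.1))) := by
    refine hasMFDerivAt_of_eventuallyEq (𝓡∂ 2) 𝓘(ℝ, EuclideanSpace ℝ (Fin 2)) ?_
      ((A.patch (A.index σ)).hasFDerivAt_transition (A.patch (A.index σ₀)) 0
      (A.mem_V σ)).hasFDerivWithinAt ?_
    · exact continuousAt_extChartAt' (by rwa [extChartAt_source])
    · filter_upwards [A.eventually_symm σ] with z hz
      change (A.patch (A.index σ₀)).P _ = (A.patch (A.index σ₀)).P _
      rw [hz, add_zero]
  rw [coordDeriv_eq _ _ h, one_mul, one_mul]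
  refine (A.patch (A.index σ)).det_transition_pos (A.patch (A.index σ₀)) (τ := 0) (A.mem_V σ)
    ?_ ?_ ?_ (by rw [add_zero])
  · rw [A.Q_P]; exact σ.2
  · rw [A.Q_P, add_zero]; exact σ.2
  · rw [A.Q_P, add_zero]; exact hσ

end SurfaceAtlas

end

noncomputable section

/-! ### The smooth structure of the strip -/

instance : Inhabited saddleStrip := ⟨⟨(0, 0, 0), by simp [saddleStrip]⟩⟩

/-- The gradient of `a b - sin (π h)`. -/
def saddleNormal (σ : ℝ × ℝ × ℝ) : ℝ × ℝ × ℝ :=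
  (σ.2.1, σ.1, -(Real.pi * Real.cos (Real.pi * σ.2.2)))

theorem saddleNormal_orth {Q : EuclideanSpace ℝ (Fin 2) → ℝ × ℝ × ℝ}
    {V : Set (EuclideanSpace ℝ (Fin 2))} (hV : IsOpen V) (hQ : ContDiffOn ℝ ∞ Q V)
    (hF : ∀ y ∈ V, (Q y).1 * (Q y).2.1 - Real.sin (Real.pi * (Q y).2.2) = 0)
    (y : EuclideanSpace ℝ (Fin 2)) (hy : y ∈ V) (u : EuclideanSpace ℝ (Fin 2)) :
    dotVec (saddleNormal (Q y)) (fderiv ℝ Q y u) = 0 := by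
  have hQ' : HasFDerivAt Q (fderiv ℝ Q y) y :=
    ((hQ.contDiffAt (hV.mem_nhds hy)).differentiableAt (by simp)).hasFDerivAt
  have h1 := hQ'.fst
  have h2 := hQ'.snd.fst
  have h3 := hQ'.snd.snd
  have h4 := (h1.mul h2).sub ((h3.const_mul Real.pi).sin)
  have h5 : HasFDerivAt (fun z => (Q z).1 * (Q z).2.1 - Real.sin (Real.pi * (Q z).2.2))
      (0 : EuclideanSpace ℝ (Fin 2) →L[ℝ] ℝ) y := by
    refine (hasFDerivAt_const (0 : ℝ) y).congr_of_eventuallyEq ?_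
    filter_upwards [hV.mem_nhds hy] with z hz
    exact hF z hz
  have h6 := DFunLike.congr_fun (h4.unique h5) u
  simp only [dotVec, saddleNormal]
  simp at h6
  linarith

/-- A sign as a real number. -/
def signReal (ε : ℤˣ) : ℝ := ((ε : ℤ) : ℝ)

theorem signReal_mul_self (ε : ℤˣ) : signReal ε * signReal ε = 1 := by
  have := Int.units_coe_mul_self ε
  simp only [signReal]
  exact_mod_cast this

theorem abs_signReal_mul (ε : ℤˣ) (x : ℝ) : |signReal ε * x| = |x| := by
  have h : |signReal ε| = 1 := by
    rw [← sq_eq_sq₀ (abs_nonneg _) zero_le_one, sq_abs, sq, signReal_mul_self, one_pow]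
  rw [abs_mul, h, one_mul]

theorem signReal_mul_signReal_mul (ε : ℤˣ) (x : ℝ) : signReal ε * (signReal ε * x) = x := by
  rw [← mul_assoc, signReal_mul_self, one_mul]

theorem signReal_ne_zero (ε : ℤˣ) : signReal ε ≠ 0 := left_ne_zero_of_mul_eq_one (signReal_mul_self ε)

theorem abs_lt_two_iff_of_mul_eq {x y s : ℝ} (h : x * y = s) (hx : 0 < x) :
    |y| < 2 ↔ |s| < 2 * x := by
  rw [← h, abs_mul, abs_of_pos hx, mul_comm 2 x, mul_lt_mul_iff_right₀ hx]

theorem contDiff_coord (i : Fin 2) : ContDiff ℝ ∞ fun y : EuclideanSpace ℝ (Fin 2) => y i :=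
  (EuclideanSpace.proj (𝕜 := ℝ) i : EuclideanSpace ℝ (Fin 2) →L[ℝ] ℝ).contDiff

theorem continuous_coord (i : Fin 2) : Continuous fun y : EuclideanSpace ℝ (Fin 2) => y i :=
  (contDiff_coord i).continuous

/-- The part of the half plane over which the strip is a graph near its boundary. -/
def collarDomain : Set (EuclideanSpace ℝ (Fin 2)) :=
  {y | y 0 < 2 ∧ |Real.sin (Real.pi * y 1)| < 2 * (2 - y 0)}

theorem isOpen_collarDomain : IsOpen collarDomain :=
  (isOpen_lt (continuous_coord 0) continuous_const).inter (isOpen_lt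
    (Real.continuous_sin.comp (continuous_const.mul (continuous_coord 1))).abs
    (continuous_const.mul (continuous_const.sub (continuous_coord 0))))

theorem contDiffOn_collar_div (ε : ℤˣ) (s : ℝ) :
    ContDiffOn ℝ ∞ (fun y : EuclideanSpace ℝ (Fin 2) =>
      Real.sin (s * (Real.pi * y 1)) / (signReal ε * (2 - y 0))) collarDomain := by
  refine ContDiffOn.div ?_ ?_ fun y hy => ?_
  · exact (Real.contDiff_sin.comp
      (contDiff_const.mul (contDiff_const.mul (contDiff_coord 1)))).contDiffOn
  · exact (contDiff_const.mul (contDiff_const.sub (contDiff_coord 0))).contDiffOn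
  · exact mul_ne_zero (signReal_ne_zero ε) (sub_pos.2 hy.1).ne'

theorem signReal_mul_sub_mul_div (ε : ℤˣ) {y : EuclideanSpace ℝ (Fin 2)} (hy : y ∈ collarDomain)
    (s : ℝ) : signReal ε * (2 - y 0) * (s / (signReal ε * (2 - y 0))) = s :=
  mul_div_cancel₀ _ (mul_ne_zero (signReal_ne_zero ε) (sub_pos.2 hy.1).ne')

theorem abs_collar_div_lt (ε : ℤˣ) {y : EuclideanSpace ℝ (Fin 2)} (hy : y ∈ collarDomain) {s : ℝ}
    (hs : |s| = |Real.sin (Real.pi * y 1)|) : |s / (signReal ε * (2 - y 0))| < 2 := by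
  have h := sub_pos.2 hy.1
  rw [abs_div, abs_signReal_mul, abs_of_pos h, div_lt_iff₀ h, hs]
  exact hy.2

theorem signReal_mul_le (ε : ℤˣ) {x : ℝ} (hx : |x| ≤ 2) : signReal ε * x ≤ 2 :=
  (le_abs_self _).trans ((abs_signReal_mul ε x).trans_le hx)

/-- The patches with `a ≠ 0`. -/
def saddlePatchA (ε : ℤˣ) : SurfacePatch saddleStrip saddleNormal where
  U := {σ | 0 < signReal ε * σ.1 ∧ |σ.2.1| < 2}
  V := collarDomain
  f := (-signReal ε) • ContinuousLinearMap.fst ℝ ℝ (ℝ × ℝ)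
  g := (ContinuousLinearMap.snd ℝ ℝ ℝ).comp (ContinuousLinearMap.snd ℝ ℝ (ℝ × ℝ))
  Q y := (signReal ε * (2 - y 0),
    Real.sin (1 * (Real.pi * y 1)) / (signReal ε * (2 - y 0)), y 1)
  w := (0, signReal ε, 0)
  isOpen_U := (isOpen_lt (f := fun _ => 0) (g := fun σ : ℝ × ℝ × ℝ => signReal ε * σ.1)
    (by fun_prop) (by fun_prop)).inter
    (isOpen_lt (f := fun σ : ℝ × ℝ × ℝ => |σ.2.1|) (g := fun _ => 2) (by fun_prop) (by fun_prop))
  isOpen_V := isOpen_collarDomain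
  contDiffOn_Q := (contDiff_const.mul (contDiff_const.sub (contDiff_coord 0))).contDiffOn.prodMk
    ((contDiffOn_collar_div ε 1).prodMk (contDiff_coord 1).contDiffOn)
  nonneg σ hσ := by
    have := signReal_mul_le ε hσ.2.1
    simp; linarith
  mem_V σ hσ hU := by
    have h1 : signReal ε * σ.1 * σ.2.1 = signReal ε * Real.sin (Real.pi * σ.2.2) := by
      rw [mul_assoc, hσ.1]
    have h2 := (abs_lt_two_iff_of_mul_eq h1 hU.1).1 hU.2
    rw [abs_signReal_mul] at h2
    have h3 := hU.1
    constructor <;> simp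
    · exact h3
    · exact h2
  left_inv σ hσ hU := by
    have h1 : signReal ε * (2 - (2 + -(signReal ε * σ.1))) = σ.1 := by
      rw [← signReal_mul_signReal_mul ε σ.1]; simp [signReal_mul_signReal_mul]
    have h2 : σ.1 ≠ 0 := fun h => by have := hU.1; rw [h, mul_zero] at this; exact this.false
    simp only [PiLp.add_apply, planeMap_apply_zero, planeMap_apply_one]
    refine Prod.ext ?_ (Prod.ext ?_ ?_) <;> simp
    · simpa using h1
    · rw [signReal_mul_signReal_mul, div_eq_iff h2, ← hσ.1, mul_comm]
  mem_S y hy h0 := by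
    refine ⟨?_, ?_, (abs_collar_div_lt ε hy (by rw [one_mul])).le⟩
    · dsimp only
      rw [signReal_mul_sub_mul_div ε hy, one_mul]
    · dsimp only
      rw [abs_signReal_mul, abs_of_pos (sub_pos.2 hy.1)]
      linarith
  mem_U y hy := by
    refine ⟨?_, abs_collar_div_lt ε hy (by rw [one_mul])⟩
    dsimp only
    rw [signReal_mul_signReal_mul]
    exact sub_pos.2 hy.1
  right_inv y hy := by
    ext i
    fin_cases i <;> simp [signReal_mul_signReal_mul]
  cross X Y := by
    simp [dotVec, crossVec]; ring
  pos σ hσ hU := by simpa [dotVec, saddleNormal] using hU.1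
  orth := by
    refine saddleNormal_orth isOpen_collarDomain ?_ fun y hy => ?_
    · exact (contDiff_const.mul (contDiff_const.sub (contDiff_coord 0))).contDiffOn.prodMk
        ((contDiffOn_collar_div ε 1).prodMk (contDiff_coord 1).contDiffOn)
    · dsimp only
      rw [signReal_mul_sub_mul_div ε hy, one_mul, sub_self]

/-- The patches with `b ≠ 0`. -/
def saddlePatchB (ε : ℤˣ) : SurfacePatch saddleStrip saddleNormal where
  U := {σ | 0 < signReal ε * σ.2.1 ∧ |σ.1| < 2}
  V := collarDomain
  f := (-signReal ε) • (ContinuousLinearMap.fst ℝ ℝ ℝ).comp (ContinuousLinearMap.snd ℝ ℝ (ℝ × ℝ))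
  g := -(ContinuousLinearMap.snd ℝ ℝ ℝ).comp (ContinuousLinearMap.snd ℝ ℝ (ℝ × ℝ))
  Q y := (Real.sin (-1 * (Real.pi * y 1)) / (signReal ε * (2 - y 0)),
    signReal ε * (2 - y 0), -y 1)
  w := (signReal ε, 0, 0)
  isOpen_U := (isOpen_lt (f := fun _ => 0) (g := fun σ : ℝ × ℝ × ℝ => signReal ε * σ.2.1)
    (by fun_prop) (by fun_prop)).inter
    (isOpen_lt (f := fun σ : ℝ × ℝ × ℝ => |σ.1|) (g := fun _ => 2) (by fun_prop) (by fun_prop))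
  isOpen_V := isOpen_collarDomain
  contDiffOn_Q := (contDiffOn_collar_div ε (-1)).prodMk
    ((contDiff_const.mul (contDiff_const.sub (contDiff_coord 0))).contDiffOn.prodMk
      (contDiff_coord 1).neg.contDiffOn)
  nonneg σ hσ := by
    have := signReal_mul_le ε hσ.2.2
    simp; linarith
  mem_V σ hσ hU := by
    have h1 : signReal ε * σ.2.1 * σ.1 = signReal ε * Real.sin (Real.pi * σ.2.2) := by
      rw [mul_assoc, mul_comm σ.2.1, hσ.1]
    have h2 := (abs_lt_two_iff_of_mul_eq h1 hU.1).1 hU.2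
    rw [abs_signReal_mul] at h2
    have h3 := hU.1
    constructor <;> simp
    · exact h3
    · exact h2
  left_inv σ hσ hU := by
    have h1 : signReal ε * (2 - (2 + -(signReal ε * σ.2.1))) = σ.2.1 := by
      rw [← signReal_mul_signReal_mul ε σ.2.1]; simp [signReal_mul_signReal_mul]
    have h2 : σ.2.1 ≠ 0 := fun h => by have := hU.1; rw [h, mul_zero] at this; exact this.false
    simp only [PiLp.add_apply, planeMap_apply_zero, planeMap_apply_one]
    refine Prod.ext ?_ (Prod.ext ?_ ?_) <;> simp
    · rw [signReal_mul_signReal_mul, div_eq_iff h2, ← hσ.1]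
    · simpa using h1
  mem_S y hy h0 := by
    refine ⟨?_, (abs_collar_div_lt ε hy (by rw [neg_one_mul, Real.sin_neg, abs_neg])).le, ?_⟩
    · dsimp only
      rw [mul_comm, signReal_mul_sub_mul_div ε hy, neg_one_mul, mul_neg]
    · dsimp only
      rw [abs_signReal_mul, abs_of_pos (sub_pos.2 hy.1)]
      linarith
  mem_U y hy := by
    refine ⟨?_, abs_collar_div_lt ε hy (by rw [neg_one_mul, Real.sin_neg, abs_neg])⟩
    dsimp only
    rw [signReal_mul_signReal_mul]
    exact sub_pos.2 hy.1
  right_inv y hy := by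
    ext i
    fin_cases i <;> simp [signReal_mul_signReal_mul]
  cross X Y := by
    simp [dotVec, crossVec]; ring
  pos σ hσ hU := by simpa [dotVec, saddleNormal] using hU.1
  orth := by
    refine saddleNormal_orth isOpen_collarDomain ?_ fun y hy => ?_
    · exact (contDiffOn_collar_div ε (-1)).prodMk
        ((contDiff_const.mul (contDiff_const.sub (contDiff_coord 0))).contDiffOn.prodMk
          (contDiff_coord 1).neg.contDiffOn)
    · dsimp only
      rw [mul_comm, signReal_mul_sub_mul_div ε hy, neg_one_mul, mul_neg, sub_self]

/-- The domain of the parametrization near a saddle point. -/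
def saddleDomain : Set (EuclideanSpace ℝ (Fin 2)) :=
  {y | |y 0 - 2| < 2 ∧ |y 1| < 2 ∧ |(y 0 - 2) * y 1| < 1}

theorem isOpen_saddleDomain : IsOpen saddleDomain :=
  (isOpen_lt ((continuous_coord 0).sub continuous_const).abs continuous_const).inter
    ((isOpen_lt (continuous_coord 1).abs continuous_const).inter
      (isOpen_lt (((continuous_coord 0).sub continuous_const).mul (continuous_coord 1)).abs
        continuous_const))

theorem contDiffOn_saddle_arcsin (k : ℝ) : ContDiffOn ℝ ∞ (fun y : EuclideanSpace ℝ (Fin 2) =>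
    k - Real.arcsin ((y 0 - 2) * y 1) / Real.pi) saddleDomain := by
  refine contDiffOn_const.sub (ContDiffOn.div_const (fun y hy => ?_) _)
  have h := abs_lt.1 hy.2.2
  exact (ContDiffAt.comp y (Real.contDiffAt_arcsin h.1.ne' h.2.ne)
    (((contDiff_coord 0).sub contDiff_const).mul (contDiff_coord 1)).contDiffAt).contDiffWithinAt

theorem sin_pi_mul_sub_arcsin (k : ℤ) {t : ℝ} (ht : |t| < 1) :
    Real.sin (Real.pi * (k - Real.arcsin t / Real.pi)) = -(-1 : ℝ) ^ k * t := by
  have h := abs_lt.1 ht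
  have e : (k : ℝ) - Real.arcsin t / Real.pi = -(Real.arcsin t / Real.pi) + k := by ring
  rw [e, sin_pi_mul_add_int, mul_neg, mul_div_cancel₀ _ Real.pi_ne_zero, Real.sin_neg,
    Real.sin_arcsin h.1.le h.2.le]
  ring

theorem neg_neg_one_zpow_mul_self (k : ℤ) (x : ℝ) : -(-1 : ℝ) ^ k * (-(-1 : ℝ) ^ k * x) = x := by
  rw [← mul_assoc, neg_mul_neg, neg_one_zpow_mul_self, one_mul]

/-- The patches around the saddle points. -/
def saddlePatchC (k : ℤ) : SurfacePatch saddleStrip saddleNormal where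
  U := {σ | |σ.2.2 - k| < 1 / 2 ∧ |σ.1| < 2 ∧ |σ.2.1| < 2}
  V := saddleDomain
  f := (-(-1 : ℝ) ^ k) • ContinuousLinearMap.fst ℝ ℝ (ℝ × ℝ)
  g := (ContinuousLinearMap.fst ℝ ℝ ℝ).comp (ContinuousLinearMap.snd ℝ ℝ (ℝ × ℝ))
  Q y := (-(-1 : ℝ) ^ k * (y 0 - 2), y 1, k - Real.arcsin ((y 0 - 2) * y 1) / Real.pi)
  w := (0, 0, -(-1 : ℝ) ^ k)
  isOpen_U := (isOpen_lt (f := fun σ : ℝ × ℝ × ℝ => |σ.2.2 - k|) (g := fun _ => 1 / 2)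
    (by fun_prop) (by fun_prop)).inter
    ((isOpen_lt (f := fun σ : ℝ × ℝ × ℝ => |σ.1|) (g := fun _ => 2) (by fun_prop)
      (by fun_prop)).inter (isOpen_lt (f := fun σ : ℝ × ℝ × ℝ => |σ.2.1|) (g := fun _ => 2)
      (by fun_prop) (by fun_prop)))
  isOpen_V := isOpen_saddleDomain
  contDiffOn_Q := (contDiff_const.mul ((contDiff_coord 0).sub contDiff_const)).contDiffOn.prodMk
    ((contDiff_coord 1).contDiffOn.prodMk (contDiffOn_saddle_arcsin k))
  nonneg σ hσ := by
    have h1 := hσ.2.1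
    rw [← abs_neg_one_zpow_mul k] at h1
    have := (abs_le.1 h1).2
    simp; linarith
  mem_V σ hσ hU := by
    obtain ⟨h1, h2, h3⟩ := hU
    refine ⟨?_, ?_, ?_⟩ <;> simp
    · exact h2
    · exact h3
    · rw [← abs_mul, hσ.1]
      have e : σ.2.2 = (σ.2.2 - k) + k := by ring
      rw [e, sin_pi_mul_add_int, abs_neg_one_zpow_mul]
      have h4 := abs_lt.1 h1
      have hpi := Real.pi_pos
      rw [abs_lt]
      constructor
      · rw [← Real.sin_pi_div_two, ← Real.sin_neg]
        exact Real.sin_lt_sin_of_lt_of_le_pi_div_two le_rfl (by nlinarith) (by nlinarith)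
      · rw [← Real.sin_pi_div_two]
        exact Real.sin_lt_sin_of_lt_of_le_pi_div_two (by nlinarith) le_rfl (by nlinarith)
  left_inv σ hσ hU := by
    have h4 := abs_lt.1 hU.1
    have hpi := Real.pi_pos
    have e : -(-1 : ℝ) ^ k * σ.1 * σ.2.1 = Real.sin (-(Real.pi * (σ.2.2 - k))) := by
      rw [mul_assoc, hσ.1, Real.sin_neg]
      have e : σ.2.2 = (σ.2.2 - k) + k := by ring
      rw [e, sin_pi_mul_add_int, add_sub_cancel_right, ← mul_assoc, neg_mul, neg_one_zpow_mul_self]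
      ring
    have e2 : 2 + -(-1 : ℝ) ^ k * σ.1 - 2 = -(-1 : ℝ) ^ k * σ.1 := by ring
    simp only [PiLp.add_apply, planeMap_apply_zero, planeMap_apply_one, PiLp.single_apply,
      if_true, smul_apply, ContinuousLinearMap.coe_fst', smul_eq_mul,
      ContinuousLinearMap.comp_apply, ContinuousLinearMap.coe_snd', one_ne_zero, if_false,
      zero_add, e2, neg_neg_one_zpow_mul_self]
    refine Prod.ext rfl (Prod.ext rfl ?_)
    dsimp only
    rw [e, Real.arcsin_sin (by nlinarith) (by nlinarith)]
    field_simp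
    ring
  mem_S y hy h0 := by
    refine ⟨?_, ?_, hy.2.1.le⟩
    · dsimp only
      rw [sin_pi_mul_sub_arcsin k hy.2.2, mul_assoc]
    · dsimp only
      rw [neg_mul, abs_neg, abs_neg_one_zpow_mul]
      exact hy.1.le
  mem_U y hy := by
    have h := abs_lt.1 hy.2.2
    refine ⟨?_, ?_, hy.2.1⟩
    · dsimp only
      rw [sub_sub_cancel_left, abs_neg, abs_div, abs_of_pos Real.pi_pos, div_lt_iff₀ Real.pi_pos,
        abs_lt]
      have h1 := Real.neg_pi_div_two_lt_arcsin.2 h.1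
      have h2 := Real.arcsin_lt_pi_div_two.2 h.2
      constructor <;> linarith
    · dsimp only
      rw [neg_mul, abs_neg, abs_neg_one_zpow_mul]
      exact hy.1
  right_inv y hy := by
    ext i
    fin_cases i
    · have := neg_neg_one_zpow_mul_self k (y 0 - 2)
      simp only [PiLp.add_apply, planeMap_apply_zero, Fin.zero_eta, PiLp.single_apply,
        if_true, smul_apply, ContinuousLinearMap.coe_fst', smul_eq_mul, this]
      ring
    · simp
  cross X Y := by
    simp [dotVec, crossVec]; ring
  pos σ hσ hU := by
    have h4 := abs_lt.1 hU.1
    have hpi := Real.pi_pos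
    have e : Real.pi * σ.2.2 = Real.pi * (σ.2.2 - k) + k * Real.pi := by ring
    have h5 : 0 < Real.cos (Real.pi * (σ.2.2 - k)) :=
      Real.cos_pos_of_mem_Ioo ⟨by nlinarith, by nlinarith⟩
    have h6 := neg_neg_one_zpow_mul_self k (Real.pi * Real.cos (Real.pi * (σ.2.2 - k)))
    simp only [dotVec, saddleNormal]
    rw [e, Real.cos_add_int_mul_pi]
    have h7 := mul_pos hpi h5
    rw [← h6] at h7
    refine h7.trans_eq ?_
    ring
  orth := by
    refine saddleNormal_orth isOpen_saddleDomain ?_ fun y hy => ?_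
    · exact (contDiff_const.mul ((contDiff_coord 0).sub contDiff_const)).contDiffOn.prodMk
        ((contDiff_coord 1).contDiffOn.prodMk (contDiffOn_saddle_arcsin k))
    · dsimp only
      rw [sin_pi_mul_sub_arcsin k hy.2.2, mul_assoc, sub_self]

/-- The sign of a real number. -/
def signUnit (x : ℝ) : ℤˣ := open Classical in if 0 < x then 1 else -1

theorem signReal_signUnit_mul (x : ℝ) : signReal (signUnit x) * x = |x| := by
  unfold signUnit signReal
  split_ifs with h
  · simp [abs_of_pos h]
  · simp [abs_of_nonpos (not_lt.1 h)]

open Classical in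
/-- The atlas of the strip. -/
def saddleAtlas : SurfaceAtlas saddleStrip saddleNormal where
  ι := ℤˣ ⊕ ℤˣ ⊕ ℤ
  patch := Sum.elim saddlePatchA (Sum.elim saddlePatchB saddlePatchC)
  index σ := if σ.1.1 ≠ 0 ∧ |σ.1.2.1| < 2 then .inl (signUnit σ.1.1)
    else if σ.1.2.1 ≠ 0 ∧ |σ.1.1| < 2 then .inr (.inl (signUnit σ.1.2.1))
    else .inr (.inr (round σ.1.2.2))
  mem_U σ := by
    obtain ⟨⟨a, b, h⟩, h1, h2, h3⟩ := σ
    simp only at h1 h2 h3 ⊢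
    split_ifs with h4 h5
    · exact ⟨by dsimp only; rw [signReal_signUnit_mul]; exact abs_pos.2 h4.1, h4.2⟩
    · exact ⟨by dsimp only; rw [signReal_signUnit_mul]; exact abs_pos.2 h5.1, h5.2⟩
    · have h6 : a = 0 := by
        by_contra ha
        have hb : |b| = 2 := le_antisymm h3 (not_lt.1 fun h => h4 ⟨ha, h⟩)
        have hb' : b ≠ 0 := by rintro rfl; simp at hb
        have ha' : |a| = 2 := le_antisymm h2 (not_lt.1 fun h => h5 ⟨hb', h⟩)
        have h7 := Real.abs_sin_le_one (Real.pi * h)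
        rw [← h1, abs_mul, ha', hb] at h7
        norm_num at h7
      have h7 : b = 0 := by
        by_contra hb
        exact h5 ⟨hb, by rw [h6]; simp⟩
      subst h6 h7
      refine ⟨?_, by simp, by simp⟩
      have h8 := abs_sub_round h
      rw [zero_mul] at h1
      have h9 := eq_intCast_of_sin_pi_mul_eq_zero h1.symm (h8.trans_lt (by norm_num))
      dsimp only
      rw [← h9]
      simp

instance : ChartedSpace (EuclideanHalfSpace 2) saddleStrip := saddleAtlas.chartedSpace

instance : IsManifold (𝓡∂ 2) ∞ saddleStrip := saddleAtlas.isManifold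

theorem saddleStrip.isOrientationSign : IsOrientationSign (𝓡∂ 2) (fun _ : saddleStrip => 1) :=
  saddleAtlas.isOrientationSign

theorem saddleStrip.even_vadd_coe (n : ℤ) (σ : saddleStrip) :
    ((2 * n) +ᵥ σ : saddleStrip).1 = σ.1 + (0, 0, ((2 * n : ℤ) : ℝ)) := by
  rw [saddleStrip.vadd_coe, Even.neg_one_zpow (even_two_mul n), one_mul]
  simp [Prod.ext_iff]

theorem saddleNormal_add (n : ℤ) (σ : ℝ × ℝ × ℝ) :
    saddleNormal (σ + (0, 0, ((2 * n : ℤ) : ℝ))) = saddleNormal σ := by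
  have e : Real.pi * (σ.2.2 + ((2 * n : ℤ) : ℝ)) = Real.pi * σ.2.2 + n * (2 * Real.pi) := by
    push_cast; ring
  simp only [saddleNormal, Prod.snd_add, Prod.fst_add, add_zero, e, Real.cos_add_int_mul_two_pi]

theorem saddleStrip.contMDiff_even_vadd (n : ℤ) :
    ContMDiff (𝓡∂ 2) (𝓡∂ 2) ∞ (fun σ : saddleStrip => (2 * n) +ᵥ σ) :=
  saddleAtlas.contMDiff_translation (continuous_const_vadd _) (saddleStrip.even_vadd_coe n)

theorem saddleStrip.preservesSign_even_vadd (n : ℤ) :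
    PreservesSign (𝓡∂ 2) (fun _ : saddleStrip => 1) (fun _ : saddleStrip => 1)
      (fun σ : saddleStrip => (2 * n) +ᵥ σ) :=
  saddleAtlas.preservesSign_translation (continuous_const_vadd _) (saddleStrip.even_vadd_coe n)
    (saddleNormal_add n)

end

noncomputable section

/-! ### Bases of products -/

/-- A basis of the product with a line, whose first vector spans the line. -/
def consBasis {V : Type*} [AddCommGroup V] [Module ℝ V] {n : ℕ} (b : Module.Basis (Fin n) ℝ V) :
    Module.Basis (Fin (n + 1)) ℝ (V × ℝ) :=
  Module.Basis.ofEquivFun ((LinearEquiv.prodComm ℝ V ℝ).trans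
    (((LinearEquiv.refl ℝ ℝ).prodCongr b.equivFun).trans
      (Fin.consLinearEquiv ℝ (fun _ : Fin (n + 1) => ℝ))))

theorem consBasis_repr_zero {V : Type*} [AddCommGroup V] [Module ℝ V] {n : ℕ}
    (b : Module.Basis (Fin n) ℝ V) (x : V × ℝ) : (consBasis b).repr x 0 = x.2 := by
  simp [consBasis]

theorem consBasis_repr_succ {V : Type*} [AddCommGroup V] [Module ℝ V] {n : ℕ}
    (b : Module.Basis (Fin n) ℝ V) (x : V × ℝ) (i : Fin n) :
    (consBasis b).repr x i.succ = b.repr x.1 i := by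
  simp [consBasis]

theorem consBasis_det_cons {V : Type*} [AddCommGroup V] [Module ℝ V] {n : ℕ}
    (b : Module.Basis (Fin n) ℝ V) (w : V × ℝ) (v : Fin n → V) :
    (consBasis b).det (Fin.cons w fun k => (v k, 0)) = w.2 * b.det v := by
  rw [Module.Basis.det_apply, Module.Basis.det_apply, Matrix.det_succ_row_zero, Fin.sum_univ_succ,
    Finset.sum_eq_zero]
  · have : ((consBasis b).toMatrix (Fin.cons w fun k => (v k, 0))).submatrix Fin.succ
        (Fin.succAbove 0) = b.toMatrix v := by
      ext i j
      simp [Module.Basis.toMatrix_apply, consBasis_repr_succ]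
    rw [this]
    simp [Module.Basis.toMatrix_apply, consBasis_repr_zero]
  · intro j _
    simp [Module.Basis.toMatrix_apply, consBasis_repr_zero]

theorem consBasis_det_snoc {V : Type*} [AddCommGroup V] [Module ℝ V]
    (b : Module.Basis (Fin 2) ℝ V) (v : Fin 2 → V) :
    (consBasis b).det (Fin.snoc (α := fun _ => V × ℝ) (fun k => (v k, 0)) (0, 1)) = b.det v := by
  have h1 : ∀ x, (consBasis b).repr x 1 = b.repr x.1 0 := fun x => consBasis_repr_succ b x 0
  have h2 : ∀ x, (consBasis b).repr x 2 = b.repr x.1 1 := fun x => consBasis_repr_succ b x 1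
  have e : (Fin.snoc (α := fun _ => V × ℝ) (fun k => (v k, 0)) (0, 1) : Fin 3 → V × ℝ) =
      ![(v 0, 0), (v 1, 0), (0, 1)] := by
    ext i <;> fin_cases i <;> rfl
  rw [e, Module.Basis.det_apply, Module.Basis.det_apply, Matrix.det_fin_three, Matrix.det_fin_two]
  simp [Module.Basis.toMatrix_apply, consBasis_repr_zero, h1, h2]

/-! ### Powers of diffeomorphisms -/

section Power

variable {E H F : Type*} [NormedAddCommGroup E] [NormedSpace ℝ E] [TopologicalSpace H]
  {I : ModelWithCorners ℝ E H} [TopologicalSpace F] [ChartedSpace H F]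

theorem PreservesSign.symm {s : F → ℝ} {χ : Diffeomorph I I F F ∞} (h : PreservesSign I s s χ) :
    PreservesSign I s s χ.symm := by
  intro x
  have h1 := h (χ.symm x)
  have h2 : (coordDeriv I I χ (χ.symm x)).comp (coordDeriv I I χ.symm x) =
      ContinuousLinearMap.id ℝ E := by
    rw [← coordDeriv_comp I x (χ.contMDiff.mdifferentiable (by simp) _)
      (χ.symm.contMDiff.mdifferentiable (by simp) _)]
    have : χ ∘ χ.symm = fun x => x := funext χ.apply_symm_apply
    rw [this]
    exact mfderiv_id
  have h3 := congrArg ContinuousLinearMap.det h2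
  rw [ContinuousLinearMap.det_comp',
    show (ContinuousLinearMap.id ℝ E).det = 1 from LinearMap.det_id] at h3
  rw [χ.apply_symm_apply] at h1
  have h4 := mul_pos h1 (mul_self_pos.2 (right_ne_zero_of_mul_eq_one h3))
  refine h4.trans_eq ?_
  linear_combination s (χ.symm x) * s x * (coordDeriv I I χ.symm x).det * h3

theorem PreservesSign.pow {s : F → ℝ} (hs : ∀ x, s x ≠ 0) {χ : Diffeomorph I I F F ∞}
    (h : PreservesSign I s s χ) (k : ℕ) :
    PreservesSign I s s (χ.toHomeomorph ^ k : F ≃ₜ F) := by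
  induction k with
  | zero => exact PreservesSign.id hs
  | succ k ih =>
    rw [pow_succ]
    have h1 : ContMDiff I I ∞ (χ.toHomeomorph ^ k : F ≃ₜ F) := by
      have := χ.contMDiff_zpow k
      rwa [zpow_natCast] at this
    exact ih.comp h (h1.mdifferentiable (by simp)) (χ.contMDiff.mdifferentiable (by simp))

theorem PreservesSign.zpow {s : F → ℝ} (hs : ∀ x, s x ≠ 0) {χ : Diffeomorph I I F F ∞}
    (h : PreservesSign I s s χ) (n : ℤ) :
    PreservesSign I s s (χ.toHomeomorph ^ n : F ≃ₜ F) := by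
  cases n with
  | ofNat k =>
    have := h.pow hs k
    rwa [← zpow_natCast] at this
  | negSucc k =>
    rw [zpow_negSucc, ← inv_pow]
    exact h.symm.pow hs (k + 1)

end Power

theorem isOrientationSign_real : IsOrientationSign 𝓘(ℝ, ℝ) (fun _ : ℝ => 1) := by
  intro x₀
  refine Filter.Eventually.of_forall fun x => ?_
  have : coordDeriv 𝓘(ℝ, ℝ) 𝓘(ℝ, ℝ) (extChartAt 𝓘(ℝ, ℝ) x₀) x = ContinuousLinearMap.id ℝ ℝ :=
    coordDeriv_eq _ _ (hasMFDerivAt_extChartAt_self (I := 𝓘(ℝ, ℝ)) x)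
  rw [this, show (ContinuousLinearMap.id ℝ ℝ).det = 1 from LinearMap.det_id]
  norm_num

theorem preservesSign_add_real (c : ℝ) :
    PreservesSign 𝓘(ℝ, ℝ) (fun _ : ℝ => 1) (fun _ : ℝ => 1) (fun t : ℝ => t + c) := by
  intro x
  have : coordDeriv 𝓘(ℝ, ℝ) 𝓘(ℝ, ℝ) (fun t : ℝ => t + c) x = ContinuousLinearMap.id ℝ ℝ :=
    coordDeriv_eq _ _ ((hasFDerivAt_id x).add_const c).hasMFDerivAt
  rw [this, show (ContinuousLinearMap.id ℝ ℝ).det = 1 from LinearMap.det_id]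
  norm_num

/-! ### The orientation of a mapping torus -/

namespace MappingTorusCover

variable {E H F : Type*} [NormedAddCommGroup E] [NormedSpace ℝ E] [TopologicalSpace H]
  {I : ModelWithCorners ℝ E H} [TopologicalSpace F] [ChartedSpace H F] (χ : Diffeomorph I I F F ∞)

instance [IsManifold I ∞ F] (φ : F ≃ₜ F) :
    IsManifold (I.prod 𝓘(ℝ, ℝ)) ∞ (MappingTorusCover φ) :=
  inferInstanceAs (IsManifold (I.prod 𝓘(ℝ, ℝ)) ∞ (F × ℝ))

theorem contMDiff_vadd (n : ℤ) : ContMDiff (I.prod 𝓘(ℝ, ℝ)) (I.prod 𝓘(ℝ, ℝ)) ∞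
    (fun p : MappingTorusCover χ.toHomeomorph => n +ᵥ p) := by
  have h := (χ.contMDiff_zpow n).prodMap
    ((contDiff_id.add contDiff_const).contMDiff (f := fun t : ℝ => t + (n : ℝ)) (n := ∞))
  exact h

/-- The sign of the product orientation. -/
def sign {φ : F ≃ₜ F} (s : F → ℝ) (p : MappingTorusCover φ) : ℝ := s p.1 * 1

theorem isOrientationSign [FiniteDimensional ℝ E] [IsManifold I ∞ F] {s : F → ℝ}
    (hs : IsOrientationSign I s) (φ : F ≃ₜ F) :
    IsOrientationSign (I.prod 𝓘(ℝ, ℝ)) (sign (φ := φ) s) :=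
  hs.prod isOrientationSign_real

theorem preservesSign_vadd [FiniteDimensional ℝ E] {s : F → ℝ} (hs : ∀ x, s x ≠ 0)
    (h : PreservesSign I s s χ) (n : ℤ) :
    PreservesSign (I.prod 𝓘(ℝ, ℝ)) (sign s) (sign s)
      (fun p : MappingTorusCover χ.toHomeomorph => n +ᵥ p) :=
  (h.zpow hs n).prodMap (preservesSign_add_real n)
    ((χ.contMDiff_zpow n).mdifferentiable (by simp))
    (((contDiff_id.add contDiff_const).contMDiff (f := fun t : ℝ => t + (n : ℝ))
      (n := ∞)).mdifferentiable (by simp))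

end MappingTorusCover

namespace MappingTorus

variable {E H F : Type*} [NormedAddCommGroup E] [NormedSpace ℝ E] [FiniteDimensional ℝ E]
  [TopologicalSpace H] {I : ModelWithCorners ℝ E H} [TopologicalSpace F] [ChartedSpace H F]
  [T2Space F] [LocallyCompactSpace F] [IsManifold I ∞ F]

/-- The product orientation of a mapping torus. -/
def orientation (o : ManifoldOrientation I F 2) (b : Module.Basis (Fin 2) ℝ E)
    (χ : Diffeomorph I I F F ∞) (h : PreservesSign I (o.sign b) (o.sign b) χ) :
    ManifoldOrientation (I.prod 𝓘(ℝ, ℝ)) (MappingTorus χ.toHomeomorph) 3 :=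
  .ofSign (consBasis b) (OrbitManifold.isOrientationSign (MappingTorusCover.contMDiff_vadd χ)
    (MappingTorusCover.isOrientationSign (o.isOrientationSign b) χ.toHomeomorph)
    (MappingTorusCover.preservesSign_vadd χ (o.sign_ne_zero b) h))

theorem isPositiveFrame_orientation_iff {o : ManifoldOrientation I F 2}
    {b : Module.Basis (Fin 2) ℝ E} {χ : Diffeomorph I I F F ∞}
    (h : PreservesSign I (o.sign b) (o.sign b) χ) (p : MappingTorusCover χ.toHomeomorph)
    (v : Fin 3 → E × ℝ) :
    IsPositiveFrame ((orientation o b χ h).orient (OrbitManifold.mk p))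
      (fun k => mfderiv (I.prod 𝓘(ℝ, ℝ)) (I.prod 𝓘(ℝ, ℝ)) OrbitManifold.mk p (v k)) ↔
      0 < o.sign b p.1 * (consBasis b).det v := by
  have h1 := OrbitManifold.preservesSign_mk (MappingTorusCover.contMDiff_vadd χ)
    (MappingTorusCover.preservesSign_vadd χ (o.sign_ne_zero b) h) p
  have h2 := det_frame_comp (consBasis b)
    (coordDeriv (I.prod 𝓘(ℝ, ℝ)) (I.prod 𝓘(ℝ, ℝ)) OrbitManifold.mk p) v
  refine (ManifoldOrientation.isPositiveFrame_ofSign _ _ _ _).trans ?_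
  refine (iff_of_eq (congrArg (fun c : ℝ => 0 < _ * c) h2)).trans ?_
  have e : MappingTorusCover.sign (o.sign b) p = o.sign b p.1 := mul_one _
  rw [e] at h1
  set s₁ := o.sign b p.1
  set s₂ := MappingTorusCover.sign (o.sign b) (OrbitManifold.rep (OrbitManifold.mk p))
  set d := (coordDeriv (I.prod 𝓘(ℝ, ℝ)) (I.prod 𝓘(ℝ, ℝ)) OrbitManifold.mk p).det
  set t := (consBasis b).det v
  have e2 : (s₁ * s₂ * d) * (s₁ * t) = (s₁ * s₁) * (s₂ * (d * t)) := by ring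
  have h3 : 0 < s₁ * s₁ := mul_self_pos.2 (o.sign_ne_zero b p.1)
  rw [← mul_pos_iff_of_pos_left h3, ← e2, mul_pos_iff_of_pos_left h1]

theorem isProductOrientation {o : ManifoldOrientation I F 2}
    {b : Module.Basis (Fin 2) ℝ E} {χ : Diffeomorph I I F F ∞}
    (h : PreservesSign I (o.sign b) (o.sign b) χ) :
    IsProductOrientation o χ.toHomeomorph (orientation o b χ h) := by
  intro x t v hv
  have h1 := (isPositiveFrame_orientation_iff h ((x, t) : F × ℝ)
    (Fin.snoc (α := fun _ => E × ℝ) (fun k => (v k, 0)) (0, 1))).2 (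
      ((o.isPositiveFrame_iff b x v).1 hv).trans_eq
        (congrArg (o.sign b x * ·) (consBasis_det_snoc (V := E) b v).symm))
  refine (congrArg (IsPositiveFrame _) (funext fun k => ?_)).mp h1
  refine Fin.lastCases ?_ (fun k => ?_) k
  · rw [Fin.snoc_last, Fin.snoc_last]; rfl
  · rw [Fin.snoc_castSucc, Fin.snoc_castSucc]; rfl

end MappingTorus

end

noncomputable section

/-! ### The smooth structure of the strip bundle -/

/-- The model vector space of the torus. -/
abbrev TorusSpace : Type := EuclideanSpace ℝ (Fin 1) × EuclideanSpace ℝ (Fin 1)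

/-- The model space of the torus. -/
abbrev TorusChartSpace : Type :=
  ModelProd (EuclideanSpace ℝ (Fin 1)) (EuclideanSpace ℝ (Fin 1))

/-- The linear identification of the models of the product of the torus with a surface. -/
def torusPlaneEquiv : (TorusSpace × EuclideanSpace ℝ (Fin 2)) ≃L[ℝ] EuclideanSpace ℝ (Fin 4) :=
  LinearEquiv.toContinuousLinearEquiv
    { toFun := fun x => !₂[x.2 0, x.1.1 0, x.1.2 0, x.2 1]
      invFun := fun z => ((!₂[z 1], !₂[z 2]), !₂[z 0, z 3])
      map_add' := fun x y => by ext i; fin_cases i <;> simp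
      map_smul' := fun c x => by ext i; fin_cases i <;> simp
      left_inv := fun x => by
        refine Prod.ext (Prod.ext ?_ ?_) ?_ <;> ext i <;> fin_cases i <;> simp
      right_inv := fun z => by ext i; fin_cases i <;> simp }

theorem torusPlaneEquiv_apply_zero (x : TorusSpace × EuclideanSpace ℝ (Fin 2)) :
    torusPlaneEquiv x 0 = x.2 0 := by
  simp [torusPlaneEquiv]

/-- The identification of the model spaces of the product of the torus with a surface. -/
def torusHalfPlaneHomeomorph :
    ModelProd TorusChartSpace (EuclideanHalfSpace 2) ≃ₜ EuclideanHalfSpace 4 where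
  toFun h := ⟨torusPlaneEquiv (torusModel h.1, h.2.1), by
    rw [torusPlaneEquiv_apply_zero]; exact h.2.2⟩
  invFun z := (torusModel.symm (torusPlaneEquiv.symm z.1).1, ⟨(torusPlaneEquiv.symm z.1).2, by
    rw [← torusPlaneEquiv_apply_zero, ContinuousLinearEquiv.apply_symm_apply]; exact z.2⟩)
  left_inv h := by
    refine Prod.ext ?_ (Subtype.ext ?_)
    · simp only [ContinuousLinearEquiv.symm_apply_apply]
      exact torusModel.left_inv _
    · simp only [ContinuousLinearEquiv.symm_apply_apply]
  right_inv z := by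
    refine Subtype.ext ?_
    dsimp only
    rw [torusModel.right_inv (by simp)]
    exact torusPlaneEquiv.apply_symm_apply _
  continuous_toFun := by
    refine (torusPlaneEquiv.continuous.comp ((torusModel.continuous.comp continuous_fst).prodMk
      (continuous_subtype_val.comp continuous_snd))).subtype_mk _
  continuous_invFun := by
    have h : Continuous fun z : EuclideanHalfSpace 4 => torusPlaneEquiv.symm z.1 :=
      torusPlaneEquiv.symm.continuous.comp continuous_subtype_val
    exact (torusModel.continuous_symm.comp h.fst).prodMk (h.snd.subtype_mk _)

namespace StripBundleCover

instance {H F : Type*} [TopologicalSpace H] [TopologicalSpace F] [ChartedSpace H F] (φ : F ≃ₜ F) :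
    ChartedSpace (ModelProd H (EuclideanHalfSpace 2)) (StripBundleCover φ) :=
  inferInstanceAs (ChartedSpace (ModelProd H (EuclideanHalfSpace 2)) (F × saddleStrip))

variable (φ : Torus ≃ₜ Torus) (ψ : Diffeomorph torusModel torusModel Torus Torus ∞)

instance : ChartedSpace (EuclideanHalfSpace 4) (StripBundleCover φ) where
  atlas := (fun e => e.transHomeomorph torusHalfPlaneHomeomorph) ''
    atlas (ModelProd TorusChartSpace (EuclideanHalfSpace 2)) (StripBundleCover φ)
  chartAt x := (chartAt (ModelProd TorusChartSpace (EuclideanHalfSpace 2)) x).transHomeomorph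
    torusHalfPlaneHomeomorph
  mem_chart_source x := mem_chart_source (ModelProd TorusChartSpace (EuclideanHalfSpace 2)) x
  chart_mem_atlas x := ⟨_, chart_mem_atlas _ x, rfl⟩

theorem isChartTransport : IsChartTransport (torusModel.prod (𝓡∂ 2)) (𝓡∂ 4)
    torusHalfPlaneHomeomorph torusPlaneEquiv (StripBundleCover φ) where
  model _ := rfl
  chart _ := rfl
  atlas := rfl

instance : IsManifold (torusModel.prod (𝓡∂ 2)) ∞ (StripBundleCover φ) :=
  inferInstanceAs (IsManifold (torusModel.prod (𝓡∂ 2)) ∞ (Torus × saddleStrip))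

instance : IsManifold (𝓡∂ 4) ∞ (StripBundleCover φ) := (isChartTransport φ).isManifold

theorem contMDiff_vadd_prod (n : ℤ) :
    ContMDiff (torusModel.prod (𝓡∂ 2)) (torusModel.prod (𝓡∂ 2)) ∞
      (fun p : StripBundleCover ψ.toHomeomorph => n +ᵥ p) :=
  (ψ.contMDiff_zpow n).prodMap (saddleStrip.contMDiff_even_vadd n)

theorem contMDiff_vadd (n : ℤ) : ContMDiff (𝓡∂ 4) (𝓡∂ 4) ∞
    (fun p : StripBundleCover ψ.toHomeomorph => n +ᵥ p) :=
  (isChartTransport ψ.toHomeomorph).contMDiff (contMDiff_vadd_prod ψ n)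

/-- The sign of the product orientation. -/
def sign {F : Type*} [TopologicalSpace F] {φ : F ≃ₜ F} (s : F → ℝ) (p : StripBundleCover φ) : ℝ :=
  s p.1 * 1

theorem isOrientationSign {s : Torus → ℝ} (hs : IsOrientationSign torusModel s) :
    IsOrientationSign (𝓡∂ 4) (sign (φ := φ) s) := by
  have h : IsOrientationSign (torusModel.prod (𝓡∂ 2)) (sign (φ := φ) s) :=
    hs.prod saddleStrip.isOrientationSign
  exact (isChartTransport φ).isOrientationSign h

theorem preservesSign_vadd {s : Torus → ℝ} (hs : ∀ x, s x ≠ 0)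
    (h : PreservesSign torusModel s s ψ) (n : ℤ) :
    PreservesSign (𝓡∂ 4) (sign s) (sign s)
      (fun p : StripBundleCover ψ.toHomeomorph => n +ᵥ p) := by
  have h1 : PreservesSign (torusModel.prod (𝓡∂ 2)) (sign s) (sign s)
      (fun p : StripBundleCover ψ.toHomeomorph => n +ᵥ p) :=
    (h.zpow hs n).prodMap (saddleStrip.preservesSign_even_vadd n)
      ((ψ.contMDiff_zpow n).mdifferentiable (by simp))
      ((saddleStrip.contMDiff_even_vadd n).mdifferentiable (by simp))
  exact (isChartTransport ψ.toHomeomorph).preservesSign h1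
    ((contMDiff_vadd_prod ψ n).mdifferentiable (by simp))

/-- The first coordinate in the chart at a point. -/
theorem extChartAt_apply (p q : StripBundleCover φ) : extChartAt (𝓡∂ 4) p q =
    torusPlaneEquiv (extChartAt torusModel p.1 q.1, extChartAt (𝓡∂ 2) p.2 q.2) := by
  have h := (isChartTransport φ).extChartAt_apply p q
  refine h.trans (congrArg torusPlaneEquiv ?_)
  have := extChartAt_prod (I := torusModel) (I' := 𝓡∂ 2) (p : Torus × saddleStrip)
  exact congrFun (congrArg (fun e : PartialEquiv (Torus × saddleStrip) _ =>
    (e : Torus × saddleStrip → _)) this) q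

end StripBundleCover

/-- Linear coordinates near the boundary. -/
def collarEquiv : ((TorusSpace × ℝ) × ℝ) ≃L[ℝ] EuclideanSpace ℝ (Fin 4) :=
  ((LinearEquiv.toContinuousLinearEquiv
    { toFun := fun x => (x.1.1, !₂[-x.2, 2 * x.1.2])
      invFun := fun z => ((z.1, z.2 1 / 2), -z.2 0)
      map_add' := fun x y => by
        refine Prod.ext rfl ?_
        ext i; fin_cases i <;> simp [mul_add, add_comm]
      map_smul' := fun c x => by
        refine Prod.ext rfl ?_
        ext i; fin_cases i <;> simp [mul_left_comm]
      left_inv := fun x => by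
        refine Prod.ext (Prod.ext rfl ?_) ?_ <;> simp
      right_inv := fun z => by
        refine Prod.ext rfl ?_
        ext i; fin_cases i <;> simp [mul_div_cancel₀] } :
    ((TorusSpace × ℝ) × ℝ) ≃L[ℝ] (TorusSpace × EuclideanSpace ℝ (Fin 2)))).trans torusPlaneEquiv

theorem collarEquiv_apply (x : (TorusSpace × ℝ) × ℝ) :
    collarEquiv x = torusPlaneEquiv (x.1.1, !₂[-x.2, 2 * x.1.2]) := rfl

theorem collarEquiv_symm_snd (z : EuclideanSpace ℝ (Fin 4)) : (collarEquiv.symm z).2 = -z 0 := by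
  obtain ⟨x, rfl⟩ := collarEquiv.surjective z
  rw [ContinuousLinearEquiv.symm_apply_apply, collarEquiv_apply, torusPlaneEquiv_apply_zero]
  simp

namespace StripBundle

variable (ψ : Diffeomorph torusModel torusModel Torus Torus ∞)

theorem isManifold : IsManifold (𝓡∂ 4) ∞ (StripBundle ψ.toHomeomorph) :=
  OrbitManifold.isManifold (StripBundleCover.contMDiff_vadd ψ)

/-- The basis of the model vector space that defines the orientation. -/
def modelBasis (b : Module.Basis (Fin 2) ℝ TorusSpace) :
    Module.Basis (Fin 4) ℝ (EuclideanSpace ℝ (Fin 4)) :=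
  (consBasis (consBasis b)).map collarEquiv.toLinearEquiv

theorem modelBasis_det_cons (b : Module.Basis (Fin 2) ℝ TorusSpace) (w : EuclideanSpace ℝ (Fin 4))
    (v : Fin 3 → TorusSpace × ℝ) :
    (modelBasis b).det (Fin.cons w fun k => collarEquiv (v k, 0)) =
      -w 0 * (consBasis b).det v := by
  rw [modelBasis, Module.Basis.det_map, ← collarEquiv_symm_snd, ← consBasis_det_cons]
  congr 1
  funext k
  refine Fin.cases ?_ (fun k => ?_) k
  · rfl
  · exact collarEquiv.symm_apply_apply _

variable {ψ} in
/-- The orientation of the strip bundle. -/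
def orientation (o : ManifoldOrientation torusModel Torus 2)
    (b : Module.Basis (Fin 2) ℝ TorusSpace) (h : PreservesSign torusModel (o.sign b) (o.sign b) ψ) :
    ManifoldOrientation (𝓡∂ 4) (StripBundle ψ.toHomeomorph) 4 :=
  .ofSign (modelBasis b) (OrbitManifold.isOrientationSign (StripBundleCover.contMDiff_vadd ψ)
    (StripBundleCover.isOrientationSign _ (o.isOrientationSign b))
    (StripBundleCover.preservesSign_vadd ψ (o.sign_ne_zero b) h))

/-- The subset of the strip that lies over the boundary. -/
def _root_.saddleStrip.IsEnd (σ : saddleStrip) : Prop := |σ.1.1| = 2 ∨ |σ.1.2.1| = 2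

theorem _root_.saddleStrip.extChartAt_self_eq_zero_iff (σ : saddleStrip) :
    extChartAt (𝓡∂ 2) σ σ 0 = 0 ↔ saddleStrip.IsEnd σ := by
  have h0 : extChartAt (𝓡∂ 2) σ σ = (saddleAtlas.patch (saddleAtlas.index σ)).P σ.1 := rfl
  have hU := saddleAtlas.mem_U σ
  rw [h0, SurfacePatch.P_apply_zero]
  generalize saddleAtlas.index σ = i at hU ⊢
  have hA : ∀ (ε : ℤˣ) (x : ℝ), 0 < signReal ε * x → (2 + -signReal ε * x = 0 ↔ |x| = 2) := by
    intro ε x hx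
    rw [← abs_signReal_mul ε x, abs_of_pos hx]
    constructor <;> intro h <;> linarith
  rcases i with ε | ε | k
  · have hU' : 0 < signReal ε * σ.1.1 ∧ |σ.1.2.1| < 2 := hU
    refine (hA ε σ.1.1 hU'.1).trans ⟨Or.inl, fun h => h.resolve_right hU'.2.ne⟩
  · have hU' : 0 < signReal ε * σ.1.2.1 ∧ |σ.1.1| < 2 := hU
    refine (hA ε σ.1.2.1 hU'.1).trans ⟨Or.inr, fun h => h.resolve_left hU'.2.ne⟩
  · have hU' : |σ.1.2.2 - k| < 1 / 2 ∧ |σ.1.1| < 2 ∧ |σ.1.2.1| < 2 := hU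
    refine iff_of_false ?_ ?_
    · change ¬(2 + -(-1 : ℝ) ^ k * σ.1.1 = 0)
      intro h
      have h1 := hU'.2.1
      rw [← abs_neg_one_zpow_mul k] at h1
      have := (abs_lt.1 h1).2
      linarith
    · rintro (h | h)
      · exact hU'.2.1.ne h
      · exact hU'.2.2.ne h

theorem _root_.saddleStrip.isEnd_even_vadd (n : ℤ) (σ : saddleStrip) :
    saddleStrip.IsEnd ((2 * n) +ᵥ σ) ↔ saddleStrip.IsEnd σ := by
  unfold saddleStrip.IsEnd
  rw [saddleStrip.even_vadd_coe]
  simp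

theorem proj_mem_boundary_iff (p : Torus × saddleStrip) :
    proj ψ.toHomeomorph p ∈ (𝓡∂ 4).boundary (StripBundle ψ.toHomeomorph) ↔ saddleStrip.IsEnd p.2 := by
  change ModelWithCorners.IsBoundaryPoint (I := 𝓡∂ 4) _ ↔ _
  rw [ModelWithCorners.isBoundaryPoint_iff, frontier_range_modelWithCornersEuclideanHalfSpace,
    OrbitManifold.extChartAt_self]
  obtain ⟨n, hn⟩ := OrbitManifold.exists_vadd_of_mk_eq (M := StripBundleCover ψ.toHomeomorph)
    (y := p) (OrbitManifold.mk_rep (proj ψ.toHomeomorph p))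
  rw [← hn]
  change 0 = _ ↔ _
  rw [StripBundleCover.extChartAt_apply, torusPlaneEquiv_apply_zero, eq_comm]
  exact (saddleStrip.extChartAt_self_eq_zero_iff _).trans (saddleStrip.isEnd_even_vadd n p.2)

end StripBundle

end

noncomputable section

/-! ### The boundary curves of the strip -/

namespace saddleStrip

/-- The patch at an end of the strip. -/
def endPatch : ℤˣ ⊕ ℤˣ → SurfacePatch saddleStrip saddleNormal :=
  Sum.elim saddlePatchA saddlePatchB

/-- The direction of a boundary curve. -/
def endSign : ℤˣ ⊕ ℤˣ → ℤ := Sum.elim (fun _ => 1) (fun _ => -1)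

theorem endSign_mul_self (i : ℤˣ ⊕ ℤˣ) : endSign i * endSign i = 1 := by
  rcases i with ε | ε <;> rfl

theorem mem_collarDomain (t : ℝ) : !₂[0, 2 * t] ∈ collarDomain := by
  have := Real.abs_sin_le_one (Real.pi * (2 * t))
  refine ⟨by simp, ?_⟩
  simp only [Matrix.cons_val_zero, Matrix.cons_val_one]
  linarith

theorem mem_endPatch (i : ℤˣ ⊕ ℤˣ) (t : ℝ) : !₂[0, 2 * t] ∈ (endPatch i).V := by
  rcases i with ε | ε <;> exact mem_collarDomain t

/-- The parametrized boundary curves of the strip. -/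
def endCurve (i : ℤˣ ⊕ ℤˣ) (t : ℝ) : saddleStrip :=
  ⟨(endPatch i).Q !₂[0, 2 * t], (endPatch i).mem_S _ (mem_endPatch i t) le_rfl⟩

theorem endCurve_inl (ε : ℤˣ) (t : ℝ) : (endCurve (.inl ε) t).1 =
    (signReal ε * 2, Real.sin (Real.pi * (2 * t)) / (signReal ε * 2), 2 * t) := by
  simp [endCurve, endPatch, saddlePatchA]

theorem endCurve_inr (ε : ℤˣ) (t : ℝ) : (endCurve (.inr ε) t).1 =
    (Real.sin (-(Real.pi * (2 * t))) / (signReal ε * 2), signReal ε * 2, -(2 * t)) := by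
  simp [endCurve, endPatch, saddlePatchB]

theorem continuous_endCurve (i : ℤˣ ⊕ ℤˣ) : Continuous (endCurve i) := by
  refine Continuous.subtype_mk ?_ _
  refine (endPatch i).contDiffOn_Q.continuousOn.comp_continuous ?_ (mem_endPatch i)
  refine (PiLp.continuous_toLp 2 _).comp (continuous_pi fun k => ?_)
  fin_cases k
  · exact continuous_const
  · exact continuous_const.mul continuous_id

theorem endCurve_height (i : ℤˣ ⊕ ℤˣ) (t : ℝ) :
    (endCurve i t).1.2.2 = 2 * (endSign i * t) := by
  rcases i with ε | ε
  · rw [endCurve_inl]; simp [endSign]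
  · rw [endCurve_inr]; simp [endSign]

theorem endCurve_add (i : ℤˣ ⊕ ℤˣ) (t : ℝ) (n : ℤ) :
    endCurve i (t + n) = (2 * (endSign i * n)) +ᵥ endCurve i t := by
  refine Subtype.ext ?_
  rw [even_vadd_coe]
  rcases i with ε | ε
  · rw [endCurve_inl, endCurve_inl]
    have e : Real.pi * (2 * (t + n)) = Real.pi * (2 * t) + n * (2 * Real.pi) := by ring
    rw [e, Real.sin_add_int_mul_two_pi]
    simp [endSign, mul_add]
  · rw [endCurve_inr, endCurve_inr]
    have e : -(Real.pi * (2 * (t + n))) = -(Real.pi * (2 * t)) - n * (2 * Real.pi) := by ring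
    rw [e, Real.sin_sub_int_mul_two_pi]
    simp [endSign, mul_add, add_comm]

theorem abs_signReal (ε : ℤˣ) : |signReal ε| = 1 := by
  have := abs_signReal_mul ε 1
  rwa [mul_one, abs_one] at this

theorem abs_endCurve_div_lt (ε : ℤˣ) (x : ℝ) : |Real.sin x / (signReal ε * 2)| < 2 := by
  have := Real.abs_sin_le_one x
  rw [abs_div, abs_mul, abs_signReal, one_mul, abs_two]
  linarith

theorem signUnit_signReal (ε : ℤˣ) : signUnit (signReal ε * 2) = ε := by
  rcases Int.units_eq_one_or ε with rfl | rfl <;> simp [signUnit, signReal]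

theorem index_endCurve (i : ℤˣ ⊕ ℤˣ) (t : ℝ) :
    saddleAtlas.index (endCurve i t) = Sum.map id Sum.inl i := by
  rcases i with ε | ε
  · have h : (endCurve (.inl ε) t).1.1 ≠ 0 ∧ |(endCurve (.inl ε) t).1.2.1| < 2 := by
      rw [endCurve_inl]
      exact ⟨mul_ne_zero (signReal_ne_zero ε) two_ne_zero, abs_endCurve_div_lt _ _⟩
    refine (if_pos h).trans ?_
    rw [endCurve_inl]
    exact congrArg Sum.inl (signUnit_signReal ε)
  · have h : ¬((endCurve (.inr ε) t).1.1 ≠ 0 ∧ |(endCurve (.inr ε) t).1.2.1| < 2) := by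
      rw [endCurve_inr]
      simp [abs_mul, abs_signReal]
    have h' : (endCurve (.inr ε) t).1.2.1 ≠ 0 ∧ |(endCurve (.inr ε) t).1.1| < 2 := by
      rw [endCurve_inr]
      exact ⟨mul_ne_zero (signReal_ne_zero ε) two_ne_zero, abs_endCurve_div_lt _ _⟩
    refine (if_neg h).trans ((if_pos h').trans ?_)
    rw [endCurve_inr]
    exact congrArg (fun ε => Sum.inr (Sum.inl ε)) (signUnit_signReal ε)

theorem patch_index_endCurve (i : ℤˣ ⊕ ℤˣ) (t : ℝ) :
    saddleAtlas.patch (saddleAtlas.index (endCurve i t)) = endPatch i := by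
  rw [index_endCurve]
  rcases i with ε | ε <;> rfl

theorem extChartAt_endCurve (i : ℤˣ ⊕ ℤˣ) (t t' : ℝ) :
    extChartAt (𝓡∂ 2) (endCurve i t) (endCurve i t') = !₂[0, 2 * t'] := by
  change (saddleAtlas.patch (saddleAtlas.index (endCurve i t))).P (endCurve i t').1 = _
  rw [patch_index_endCurve]
  exact (endPatch i).P_Q (mem_endPatch i t')

theorem isEnd_endCurve (i : ℤˣ ⊕ ℤˣ) (t : ℝ) : IsEnd (endCurve i t) := by
  rw [← extChartAt_self_eq_zero_iff, extChartAt_endCurve]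
  rfl

theorem endCurve_injective {i j : ℤˣ ⊕ ℤˣ} {t t' : ℝ} (h : endCurve i t = endCurve j t') :
    i = j ∧ t = t' := by
  have h1 : (Sum.map id Sum.inl i : ℤˣ ⊕ ℤˣ ⊕ ℤ) = Sum.map id Sum.inl j := by
    rw [← index_endCurve i t, ← index_endCurve j t', h]
  have h2 : i = j := Sum.map_injective.2 ⟨Function.injective_id, Sum.inl_injective⟩ h1
  subst h2
  refine ⟨rfl, ?_⟩
  have h3 := congrArg (fun σ : saddleStrip => σ.1.2.2) h
  simp only [endCurve_height] at h3
  have h4 : (endSign i : ℝ) ≠ 0 := by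
    have := left_ne_zero_of_mul_eq_one (endSign_mul_self i)
    exact_mod_cast this
  exact mul_left_cancel₀ h4 (mul_left_cancel₀ two_ne_zero h3)

theorem exists_endCurve {σ : saddleStrip} (h : IsEnd σ) : ∃ i t, endCurve i t = σ := by
  have h0 := (extChartAt_self_eq_zero_iff σ).2 h
  have hU := saddleAtlas.mem_U σ
  have key : ∀ i : ℤˣ ⊕ ℤˣ, saddleAtlas.patch (saddleAtlas.index σ) = endPatch i →
      ∃ t, endCurve i t = σ := by
    intro i hi
    change (saddleAtlas.patch (saddleAtlas.index σ)).P σ.1 0 = 0 at h0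
    rw [hi] at h0 hU
    refine ⟨(endPatch i).P σ.1 1 / 2, Subtype.ext ?_⟩
    have e : !₂[0, 2 * ((endPatch i).P σ.1 1 / 2)] = (endPatch i).P σ.1 := by
      ext k
      fin_cases k
      · exact h0.symm
      · exact mul_div_cancel₀ _ two_ne_zero
    change (endPatch i).Q _ = _
    rw [e, (endPatch i).Q_P σ.2 hU]
  rcases hi : saddleAtlas.index σ with ε | ε | k
  · exact ⟨.inl ε, key (.inl ε) (by rw [hi]; rfl)⟩
  · exact ⟨.inr ε, key (.inr ε) (by rw [hi]; rfl)⟩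
  · rw [hi] at hU
    have hU' : |σ.1.2.2 - k| < 1 / 2 ∧ |σ.1.1| < 2 ∧ |σ.1.2.1| < 2 := hU
    rcases h with h | h
    · exact absurd h hU'.2.1.ne
    · exact absurd h hU'.2.2.ne

end saddleStrip

open saddleStrip

/-! ### The embeddings of mapping tori in the boundary -/

namespace StripBundle

section Topology

variable {F : Type*} [TopologicalSpace F] {φ χ : F ≃ₜ F}

/-- The map of coverings that induces the embedding of a boundary component. -/
def endCover (φ χ : F ≃ₜ F) (i : ℤˣ ⊕ ℤˣ) (p : MappingTorusCover χ) : StripBundleCover φ :=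
  (p.1, endCurve i p.2)

theorem continuous_endCover (i : ℤˣ ⊕ ℤˣ) : Continuous (endCover φ χ i) := by
  have h : Continuous fun p : F × ℝ => (p.1, endCurve i p.2) :=
    continuous_fst.prodMk ((continuous_endCurve i).comp continuous_snd)
  exact h

theorem endCover_vadd {i : ℤˣ ⊕ ℤˣ} (hχ : χ = φ ^ endSign i) (n : ℤ) (p : MappingTorusCover χ) :
    endCover φ χ i (n +ᵥ p) = (endSign i * n) +ᵥ endCover φ χ i p := by
  refine Prod.ext ?_ (endCurve_add i p.2 n)
  change (χ ^ n) p.1 = (φ ^ (endSign i * n)) p.1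
  rw [zpow_mul, hχ]

theorem vadd_endCover {i : ℤˣ ⊕ ℤˣ} (hχ : χ = φ ^ endSign i) (n : ℤ) (p : MappingTorusCover χ) :
    n +ᵥ endCover φ χ i p = endCover φ χ i ((endSign i * n) +ᵥ p) := by
  rw [endCover_vadd hχ, ← mul_assoc, endSign_mul_self, one_mul]

theorem endCover_injective (i : ℤˣ ⊕ ℤˣ) : Function.Injective (endCover φ χ i) := by
  intro p q h
  exact Prod.ext (congrArg (fun x : F × saddleStrip => x.1) h)
    (endCurve_injective (congrArg (fun x : F × saddleStrip => x.2) h)).2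

/-- The embedding of a boundary component. -/
def endMap {i : ℤˣ ⊕ ℤˣ} (hχ : χ = φ ^ endSign i) : MappingTorus χ → StripBundle φ :=
  Quotient.lift (fun p => proj φ (endCover φ χ i p)) (by
    rintro _ q ⟨n, rfl⟩
    dsimp only
    rw [endCover_vadd hχ]
    exact Quotient.sound ⟨_, rfl⟩)

theorem continuous_endMap {i : ℤˣ ⊕ ℤˣ} (hχ : χ = φ ^ endSign i) : Continuous (endMap hχ) :=
  ((continuous_proj φ).comp (continuous_endCover i)).quotient_lift _

theorem eq_and_eq_of_endMap_eq {χ' : F ≃ₜ F} {i j : ℤˣ ⊕ ℤˣ} {hχ : χ = φ ^ endSign i}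
    {hχ' : χ' = φ ^ endSign j} {p : MappingTorusCover χ} {q : MappingTorusCover χ'}
    (h : endMap hχ (MappingTorus.proj χ p) = endMap hχ' (MappingTorus.proj χ' q)) :
    i = j ∧ ∃ n : ℤ, n +ᵥ endCover φ χ' j q = endCover φ χ i p := by
  obtain ⟨n, hn⟩ : ∃ n : ℤ, n +ᵥ endCover φ χ' j q = endCover φ χ i p := Quotient.exact h
  refine ⟨?_, n, hn⟩
  rw [vadd_endCover hχ'] at hn
  exact (endCurve_injective (congrArg (fun x : F × saddleStrip => x.2) hn)).1.symm

theorem endMap_injective {i : ℤˣ ⊕ ℤˣ} (hχ : χ = φ ^ endSign i) :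
    Function.Injective (endMap hχ) := by
  intro y z h
  obtain ⟨p, rfl⟩ := Quotient.mk_surjective y
  obtain ⟨q, rfl⟩ := Quotient.mk_surjective z
  obtain ⟨-, n, hn⟩ := eq_and_eq_of_endMap_eq (p := p) (q := q) h
  rw [vadd_endCover hχ] at hn
  rw [← endCover_injective i hn]
  exact Quotient.sound ⟨_, rfl⟩

theorem disjoint_range_endMap {χ' : F ≃ₜ F} {i j : ℤˣ ⊕ ℤˣ} (hχ : χ = φ ^ endSign i)
    (hχ' : χ' = φ ^ endSign j) (hij : i ≠ j) :
    Disjoint (Set.range (endMap hχ)) (Set.range (endMap hχ')) := by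
  rw [Set.disjoint_left]
  rintro _ ⟨y, rfl⟩ ⟨z, hz⟩
  obtain ⟨p, rfl⟩ := Quotient.mk_surjective y
  obtain ⟨q, rfl⟩ := Quotient.mk_surjective z
  exact hij (eq_and_eq_of_endMap_eq (p := q) (q := p) hz).1.symm

theorem compactSpace_mappingTorus [CompactSpace F] (χ : F ≃ₜ F) : CompactSpace (MappingTorus χ) := by
  have h : IsCompact (Set.univ ×ˢ Set.Icc (0 : ℝ) 1 : Set (F × ℝ)) :=
    isCompact_univ.prod isCompact_Icc
  have hc : Continuous (MappingTorus.proj χ) := continuous_quot_mk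
  refine ⟨?_⟩
  convert h.image hc
  refine (Set.eq_univ_of_forall fun y => ?_).symm
  obtain ⟨p, rfl⟩ := Quotient.mk_surjective y
  refine ⟨((χ ^ (-⌊p.2⌋)) p.1, p.2 + ((-⌊p.2⌋ : ℤ) : ℝ)), ⟨trivial, ?_⟩, Quotient.sound ⟨-⌊p.2⌋, rfl⟩⟩
  have h1 := Int.floor_le p.2
  have h2 := Int.lt_floor_add_one p.2
  constructor <;> push_cast <;> linarith

theorem isEmbedding_endMap [CompactSpace F] [T2Space F] [LocallyCompactSpace F] {i : ℤˣ ⊕ ℤˣ}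
    (hχ : χ = φ ^ endSign i) : Topology.IsEmbedding (endMap hχ) := by
  have := compactSpace_mappingTorus χ
  exact ((continuous_endMap hχ).isClosedEmbedding (endMap_injective hχ)).isEmbedding

end Topology

section Smooth

variable {φ : Torus ≃ₜ Torus} {ψ χ : Diffeomorph torusModel torusModel Torus Torus ∞}

theorem extChartAt_mappingTorusCover (χ : Torus ≃ₜ Torus) (p q : MappingTorusCover χ) :
    extChartAt (torusModel.prod 𝓘(ℝ, ℝ)) p q = (extChartAt torusModel p.1 q.1, q.2) := by
  have := extChartAt_prod (I := torusModel) (I' := 𝓘(ℝ, ℝ)) (p : Torus × ℝ)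
  exact congrFun (congrArg (fun e : PartialEquiv (Torus × ℝ) _ =>
    (e : Torus × ℝ → _)) this) q

theorem extChartAt_endCover (i : ℤˣ ⊕ ℤˣ) (χ : Torus ≃ₜ Torus) (p q : MappingTorusCover χ) :
    extChartAt (𝓡∂ 4) (endCover φ χ i p) (endCover φ χ i q) =
      collarEquiv (extChartAt (torusModel.prod 𝓘(ℝ, ℝ)) p q, 0) := by
  rw [StripBundleCover.extChartAt_apply, extChartAt_mappingTorusCover, collarEquiv_apply, neg_zero]
  exact congrArg (fun z => torusPlaneEquiv (extChartAt torusModel p.1 q.1, z))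
    (extChartAt_endCurve i p.2 q.2)

theorem hasMFDerivAt_endCover (i : ℤˣ ⊕ ℤˣ) (χ : Torus ≃ₜ Torus) (p : MappingTorusCover χ) :
    HasMFDerivAt (torusModel.prod 𝓘(ℝ, ℝ)) (𝓡∂ 4) (endCover φ χ i) p
      ((collarEquiv : ((TorusSpace × ℝ) × ℝ) →L[ℝ] EuclideanSpace ℝ (Fin 4)).comp
        (ContinuousLinearMap.inl ℝ (TorusSpace × ℝ) ℝ)) := by
  refine hasMFDerivAt_of_eventuallyEq (torusModel.prod 𝓘(ℝ, ℝ)) (𝓡∂ 4)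
    (continuous_endCover i).continuousAt (ContinuousLinearMap.hasFDerivWithinAt _) ?_
  filter_upwards [extChartAt_target_mem_nhdsWithin (I := torusModel.prod 𝓘(ℝ, ℝ)) p] with z hz
  rw [extChartAt_endCover, (extChartAt (torusModel.prod 𝓘(ℝ, ℝ)) p).right_inv hz]
  rfl

theorem exists_endCover_eq_rep {i : ℤˣ ⊕ ℤˣ} {χ : Torus ≃ₜ Torus} (hχ : χ = φ ^ endSign i)
    (y : MappingTorus χ) : ∃ p : MappingTorusCover χ, OrbitManifold.mk p = y ∧
      endCover φ χ i p = OrbitManifold.rep (endMap hχ y) := by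
  obtain ⟨p, rfl⟩ := Quotient.mk_surjective y
  obtain ⟨n, hn⟩ := OrbitManifold.exists_vadd_of_mk_eq (M := StripBundleCover φ)
    (y := endCover φ χ i p) (OrbitManifold.mk_rep (endMap hχ (MappingTorus.proj χ p)))
  refine ⟨(endSign i * n) +ᵥ p, OrbitManifold.mk_vadd _ p, ?_⟩
  rw [← vadd_endCover hχ]
  exact hn

theorem isImmersion_endMap {i : ℤˣ ⊕ ℤˣ} (hχ : χ.toHomeomorph = ψ.toHomeomorph ^ endSign i) :
    Manifold.IsImmersion (torusModel.prod 𝓘(ℝ, ℝ)) (𝓡∂ 4) ∞ (endMap hχ) := by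
  refine ⟨ℝ, inferInstance, inferInstance, fun y => ?_⟩
  have hM : IsManifold (𝓡∂ 4) ∞ (StripBundle ψ.toHomeomorph) := isManifold ψ
  obtain ⟨p, hp, hrep⟩ := exists_endCover_eq_rep hχ y
  set G := torusModel.prod 𝓘(ℝ, ℝ)
  set q := endMap hχ y
  let s : Set (MappingTorusCover χ.toHomeomorph) := (OrbitManifold.localSection p).target ∩
    endCover ψ.toHomeomorph χ.toHomeomorph i ⁻¹'
      (OrbitManifold.localSection (OrbitManifold.rep q)).target
  have hs : IsOpen s := (OrbitManifold.localSection p).open_target.inter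
    ((OrbitManifold.localSection (OrbitManifold.rep q)).open_target.preimage (continuous_endCover i))
  have hs' : IsOpen (OrbitManifold.mk '' s) := OrbitManifold.isLocalHomeomorph_mk.isOpenMap _ hs
  have hps : p ∈ s := by
    refine ⟨OrbitManifold.mem_localSection_target p, ?_⟩
    rw [Set.mem_preimage, hrep]
    exact OrbitManifold.mem_localSection_target _
  have hdom : OrbitManifold.mk p ∈
      (OrbitManifold.chartOf (ModelProd TorusChartSpace ℝ) p).source := by
    rw [OpenPartialHomeomorph.trans_source]
    refine ⟨OrbitManifold.mk_mem_localSection_source hps.1, ?_⟩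
    rw [Set.mem_preimage, OrbitManifold.localSection_mk hps.1]
    exact mem_chart_source _ p
  refine Manifold.IsImmersionAtOfComplement.mk_of_continuousAt
    (continuous_endMap hχ).continuousAt collarEquiv
    ((OrbitManifold.chartOf (ModelProd TorusChartSpace ℝ) p).restr (OrbitManifold.mk '' s))
    (chartAt (EuclideanHalfSpace 4) q) ?_ (mem_chart_source _ q)
    (restr_mem_maximalAtlas _ (OrbitManifold.chartOf_mem_maximalAtlas
      (MappingTorusCover.contMDiff_vadd χ) p) hs')
    (IsManifold.chart_mem_maximalAtlas q) ?_
  · rw [OpenPartialHomeomorph.restr_source, hs'.interior_eq, ← hp]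
    exact ⟨hdom, p, hps, rfl⟩
  · intro z hz
    set d := ((OrbitManifold.chartOf (ModelProd TorusChartSpace ℝ) p).restr
      (OrbitManifold.mk '' s)).extend G
    have h1 := d.map_target hz
    have h2 := d.right_inv hz
    simp only [Function.comp_apply]
    generalize d.symm z = w at h1 h2 ⊢
    rw [OpenPartialHomeomorph.extend_source, OpenPartialHomeomorph.restr_source,
      hs'.interior_eq] at h1
    obtain ⟨-, r, hr, rfl⟩ := h1
    have h3 : extChartAt G p r = z := by
      rw [← h2]
      change G (chartAt (ModelProd TorusChartSpace ℝ) p r) =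
        G (chartAt (ModelProd TorusChartSpace ℝ) p (OrbitManifold.localSection p (OrbitManifold.mk r)))
      rw [OrbitManifold.localSection_mk hr.1]
    rw [← h3, ← extChartAt_endCover (φ := ψ.toHomeomorph) i, hrep]
    exact OrbitManifold.extChartAt_mk (I := 𝓡∂ 4) hr.2

theorem isSmoothEmbedding_endMap {i : ℤˣ ⊕ ℤˣ}
    (hχ : χ.toHomeomorph = ψ.toHomeomorph ^ endSign i) :
    Manifold.IsSmoothEmbedding (torusModel.prod 𝓘(ℝ, ℝ)) (𝓡∂ 4) ∞ (endMap hχ) :=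
  ⟨isImmersion_endMap hχ, isEmbedding_endMap hχ⟩

end Smooth

end StripBundle

end

noncomputable section

/-! ### Orientation of the boundary -/

namespace StripBundle

theorem isPositiveFrame_orientation_iff
    {ψ : Diffeomorph torusModel torusModel Torus Torus ∞}
    {o : ManifoldOrientation torusModel Torus 2} {b : Module.Basis (Fin 2) ℝ TorusSpace}
    (h : PreservesSign torusModel (o.sign b) (o.sign b) ψ) (q : StripBundle ψ.toHomeomorph)
    (v : Fin 4 → EuclideanSpace ℝ (Fin 4)) :
    IsPositiveFrame ((orientation o b h).orient q) v ↔
      0 < StripBundleCover.sign (o.sign b) (OrbitManifold.rep q) * (modelBasis b).det v :=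
  ManifoldOrientation.isPositiveFrame_ofSign _ _ _ _

theorem preservesBoundaryOrientation_endMap
    {ψ χ : Diffeomorph torusModel torusModel Torus Torus ∞} {i : ℤˣ ⊕ ℤˣ}
    (hχ : χ.toHomeomorph = ψ.toHomeomorph ^ saddleStrip.endSign i)
    {o : ManifoldOrientation torusModel Torus 2} {b : Module.Basis (Fin 2) ℝ TorusSpace}
    (h : PreservesSign torusModel (o.sign b) (o.sign b) ψ)
    (h' : PreservesSign torusModel (o.sign b) (o.sign b) χ) :
    @PreservesBoundaryOrientation _ _ _ _ _ _ _ _ _ 3 (StripBundle ψ.toHomeomorph) _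
      (inferInstance : ChartedSpace (EuclideanHalfSpace 4) (StripBundle ψ.toHomeomorph))
      (MappingTorus.orientation o b χ h') (orientation o b h) (endMap hχ) := by
  intro y v w hv hw
  obtain ⟨p, rfl, hrep⟩ := exists_endCover_eq_rep hχ y
  let G := torusModel.prod 𝓘(ℝ, ℝ)
  let A : TorusSpace × ℝ →L[ℝ] TorusSpace × ℝ := coordDeriv G G
    (OrbitManifold.mk (M := MappingTorusCover χ.toHomeomorph)) p
  have hdet : A.det ≠ 0 := right_ne_zero_of_mul (OrbitManifold.preservesSign_mk
    (MappingTorusCover.contMDiff_vadd χ)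
    (MappingTorusCover.preservesSign_vadd χ (o.sign_ne_zero b) h') p).ne'
  have hsurj : Function.Surjective A :=
    (LinearMap.equivOfDetNeZero (A : TorusSpace × ℝ →ₗ[ℝ] TorusSpace × ℝ) hdet).surjective
  choose v' hv' using fun k => hsurj (v k)
  have hv1 : v = fun k => A (v' k) := funext fun k => (hv' k).symm
  have hpos : 0 < o.sign b p.1 * (consBasis b).det v' := by
    refine (MappingTorus.isPositiveFrame_orientation_iff h' p v').1 ?_
    exact (congrArg (IsPositiveFrame _) hv1).mp hv
  let q := endMap hχ (OrbitManifold.mk p)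
  have h1 : HasMFDerivAt G (𝓡∂ 4) (OrbitManifold.mk ∘ endCover ψ.toHomeomorph χ.toHomeomorph i) p
      ((ContinuousLinearMap.id ℝ (EuclideanSpace ℝ (Fin 4))).comp
        ((collarEquiv : ((TorusSpace × ℝ) × ℝ) →L[ℝ] EuclideanSpace ℝ (Fin 4)).comp
        (ContinuousLinearMap.inl ℝ (TorusSpace × ℝ) ℝ))) := by
    refine HasMFDerivAt.comp p (I' := 𝓡∂ 4) ?_ (hasMFDerivAt_endCover i χ.toHomeomorph p)
    rw [hrep]
    exact OrbitManifold.hasMFDerivAt_mk_rep q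
  have h2 : HasMFDerivAt G G (OrbitManifold.mk (M := MappingTorusCover χ.toHomeomorph)) p A :=
    ((OrbitManifold.contMDiff_mk
      (MappingTorusCover.contMDiff_vadd χ)).mdifferentiable (by simp) p).hasMFDerivAt
  have h3 : MDifferentiableAt G (𝓡∂ 4) (endMap hχ) (OrbitManifold.mk p) :=
    (isImmersion_endMap hχ).contMDiff.mdifferentiable (by simp) _
  have h4 := h3.hasMFDerivAt.comp p h2
  have h5 := h4.mfderiv.symm.trans h1.mfderiv
  have h6 : ∀ k, mfderiv G (𝓡∂ 4) (endMap hχ) (OrbitManifold.mk p) (v k) =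
      collarEquiv (v' k, 0) := by
    intro k
    rw [hv1]
    exact DFunLike.congr_fun h5 (v' k)
  let w' : EuclideanSpace ℝ (Fin 4) := w
  have hw' : w' 0 < 0 := by
    have e : coordDeriv (𝓡∂ 4) 𝓘(ℝ, EuclideanSpace ℝ (Fin 4)) (extChartAt (𝓡∂ 4) q) q =
        ContinuousLinearMap.id ℝ _ :=
      coordDeriv_eq _ _ (hasMFDerivAt_extChartAt_self (I := 𝓡∂ 4) q)
    have hw1 : (coordDeriv (𝓡∂ 4) 𝓘(ℝ, EuclideanSpace ℝ (Fin 4)) (extChartAt (𝓡∂ 4) q) q w') 0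
        < 0 := hw
    rw [e] at hw1
    exact hw1
  refine (isPositiveFrame_orientation_iff h q _).2 ?_
  have e1 : StripBundleCover.sign (o.sign b) (OrbitManifold.rep q) = o.sign b p.1 := by
    rw [← hrep]
    exact mul_one _
  have e2 := modelBasis_det_cons b w' v'
  have e3 : (Fin.cons w' (fun k => collarEquiv (v' k, 0)) : Fin 4 → EuclideanSpace ℝ (Fin 4)) =
      Fin.cons (α := fun _ => EuclideanSpace ℝ (Fin 4)) w'
        (fun k => mfderiv G (𝓡∂ 4) (endMap hχ) (OrbitManifold.mk p) (v k)) :=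
    congrArg (Fin.cons (α := fun _ => EuclideanSpace ℝ (Fin 4)) w') (funext fun k => (h6 k).symm)
  refine lt_of_lt_of_eq ?_ (congrArg₂ (fun (s : ℝ) f => s * (modelBasis b).det f) e1.symm e3)
  rw [e2]
  have := mul_pos (neg_pos.2 hw') hpos
  refine this.trans_eq ?_
  ring

end StripBundle

/-! ### The fundamental group of the boundary -/

theorem FundamentalGroup.map_injective_of_retraction {X : Type*} [TopologicalSpace X] {A : Set X}
    (κ : C(X, A)) {S : Set A} (hS : IsClopen S) (hκ : ∀ x ∈ S, κ x = x) {a : A} (ha : a ∈ S) :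
    Function.Injective
      (FundamentalGroup.map (⟨Subtype.val, continuous_subtype_val⟩ : C(A, X)) a) := by
  intro p q hpq
  obtain ⟨γ, rfl⟩ := Path.Homotopic.Quotient.mk_surjective p
  obtain ⟨δ, rfl⟩ := Path.Homotopic.Quotient.mk_surjective q
  have h1 : (γ.map continuous_subtype_val).Homotopic (δ.map continuous_subtype_val) :=
    Path.Homotopic.Quotient.exact hpq
  have key : ∀ γ : Path a a, ((γ.map continuous_subtype_val).map κ.continuous).cast
      (hκ a ha).symm (hκ a ha).symm = γ := by
    intro γ
    ext t
    have h2 : IsClopen (γ ⁻¹' S) := hS.preimage γ.continuous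
    have h3 := h2.eq_univ ⟨0, by simpa using ha⟩
    have h4 : γ t ∈ S := Set.eq_univ_iff_forall.1 h3 t
    exact congrArg Subtype.val (hκ _ h4)
  have h5 := (h1.map κ).pathCast (hκ a ha).symm (hκ a ha).symm
  have h6 : γ.Homotopic δ := by
    rw [← key γ, ← key δ]
    exact h5
  exact Path.Homotopic.Quotient.eq.2 h6

namespace StripBundle

section Retraction

variable {F : Type*} [TopologicalSpace F] {φ χ : F ≃ₜ F}

/-- The projection to the bundle over the circle with the same monodromy, up to orientation. -/
def retraction {i : ℤˣ ⊕ ℤˣ} (hχ : χ = φ ^ saddleStrip.endSign i) : StripBundle φ → MappingTorus χ :=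
  Quotient.lift (fun p : F × saddleStrip =>
    MappingTorus.proj χ (p.1, saddleStrip.endSign i * (p.2.1.2.2 / 2))) (by
    rintro _ q ⟨n, rfl⟩
    refine Quotient.sound ⟨saddleStrip.endSign i * n, ?_⟩
    refine Prod.ext ?_ ?_
    · change (χ ^ (saddleStrip.endSign i * n)) q.1 = (φ ^ n) q.1
      rw [hχ, ← zpow_mul, ← mul_assoc, saddleStrip.endSign_mul_self, one_mul]
    · change (saddleStrip.endSign i * (q.2.1.2.2 / 2) + ((saddleStrip.endSign i * n : ℤ) : ℝ) : ℝ) =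
        saddleStrip.endSign i * ((q.2.1.2.2 + ((2 * n : ℤ) : ℝ)) / 2)
      push_cast
      ring)

theorem continuous_retraction {i : ℤˣ ⊕ ℤˣ} (hχ : χ = φ ^ saddleStrip.endSign i) :
    Continuous (retraction hχ) := by
  have hc : Continuous (MappingTorus.proj χ) := continuous_quot_mk
  have h : Continuous fun p : F × saddleStrip =>
      (p.1, (saddleStrip.endSign i : ℝ) * (p.2.1.2.2 / 2)) := by fun_prop
  exact (hc.comp h).quotient_lift _

theorem retraction_endMap {i : ℤˣ ⊕ ℤˣ} (hχ : χ = φ ^ saddleStrip.endSign i) (y : MappingTorus χ) :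
    retraction hχ (endMap hχ y) = y := by
  obtain ⟨p, rfl⟩ := Quotient.mk_surjective y
  refine congrArg (MappingTorus.proj χ) (Prod.ext rfl ?_)
  change (saddleStrip.endSign i : ℝ) * ((saddleStrip.endCurve i p.2).1.2.2 / 2) = p.2
  have h : (saddleStrip.endSign i : ℝ) * saddleStrip.endSign i = 1 := by
    exact_mod_cast saddleStrip.endSign_mul_self i
  rw [saddleStrip.endCurve_height]
  linear_combination p.2 * h

end Retraction

end StripBundle

theorem isClopen_of_finite_closed_partition {ι Y : Type*} [Finite ι] [TopologicalSpace Y]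
    {S : ι → Set Y} (hS : ∀ i, IsClosed (S i)) (hd : Pairwise fun i j => Disjoint (S i) (S j))
    (hU : ∀ y, ∃ i, y ∈ S i) (i : ι) : IsClopen (S i) := by
  refine ⟨hS i, ?_⟩
  have h : IsClosed (⋃ j : {j // j ≠ i}, S j) := isClosed_iUnion_of_finite fun j => hS j
  convert h.isOpen_compl
  ext y
  constructor
  · rintro hy hy'
    obtain ⟨j, hj⟩ := Set.mem_iUnion.1 hy'
    exact Set.disjoint_left.1 (hd j.2) hj hy
  · intro hy
    obtain ⟨j, hj⟩ := hU y
    by_cases hij : j = i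
    · exact hij ▸ hj
    · exact absurd (Set.mem_iUnion.2 ⟨⟨j, hij⟩, hj⟩) hy

/-- The boundary of a space with finitely many compact boundary pieces, each of which is a retract
of the whole space. -/
theorem aspherical_and_isPi1Injective_of_retracts {ι X : Type*} [Finite ι] [TopologicalSpace X]
    [T2Space X] {N : ι → Type*} [∀ i, TopologicalSpace (N i)] [∀ i, CompactSpace (N i)] {A : Set X}
    {e : ∀ i, N i → X} {r : ∀ i, X → N i} (he : ∀ i, Topology.IsEmbedding (e i))
    (hr : ∀ i, Continuous (r i)) (hre : ∀ i y, r i (e i y) = y)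
    (hd : Pairwise fun i j => Disjoint (Set.range (e i)) (Set.range (e j)))
    (hA : ⋃ i, Set.range (e i) = A) (hN : ∀ i, HasAsphericalComponents (N i)) :
    HasAsphericalComponents A ∧ IsPi1Injective A := by
  have hmem : ∀ i y, e i y ∈ A := fun i y => hA ▸ Set.mem_iUnion.2 ⟨i, y, rfl⟩
  let e' : ∀ i, N i → A := fun i y => ⟨e i y, hmem i y⟩
  have he' : ∀ i, Topology.IsEmbedding (e' i) := fun i => (he i).codRestrict A (hmem i)
  have hU : ∀ a, ∃ i, a ∈ Set.range (e' i) := by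
    rintro ⟨x, hx⟩
    rw [← hA] at hx
    obtain ⟨i, y, rfl⟩ := Set.mem_iUnion.1 hx
    exact ⟨i, y, rfl⟩
  have hc : ∀ i, IsClopen (Set.range (e' i)) := by
    refine isClopen_of_finite_closed_partition
      (fun i => (isCompact_range (he' i).continuous).isClosed) (fun i j hij => ?_) hU
    refine Set.disjoint_left.2 ?_
    rintro _ ⟨y, rfl⟩ ⟨z, hz⟩
    exact Set.disjoint_left.1 (hd hij) ⟨y, rfl⟩ ⟨z, congrArg Subtype.val hz⟩
  refine ⟨HasAsphericalComponents.of_isClopen_range hN e' he' hc hU, fun a => ?_⟩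
  obtain ⟨i, hi⟩ := hU a
  refine FundamentalGroup.map_injective_of_retraction
    ⟨fun x => e' i (r i x), (he' i).continuous.comp (hr i)⟩ (hc i) ?_ hi
  rintro _ ⟨y, rfl⟩
  exact congrArg (e' i) (hre i y)

theorem hasAsphericalComponents_mappingTorus {F : Type*} [TopologicalSpace F] [T2Space F]
    [LocallyCompactSpace F] (hF : HasAsphericalComponents F) (χ : F ≃ₜ F) :
    HasAsphericalComponents (MappingTorus χ) :=
  HasAsphericalComponents.of_isCoveringMap (E := MappingTorusCover χ)
    (hF.prod (HasAsphericalComponents.of_contractibleSpace (X := ℝ)))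
    OrbitManifold.isCoveringMap_mk Quotient.mk_surjective

/-! ### The theorem -/

/-- The ends of the strip that correspond to the boundary components. -/
def boundaryEnd : Fin 4 → ℤˣ ⊕ ℤˣ := ![.inr 1, .inr (-1), .inl 1, .inl (-1)]

theorem boundaryEnd_injective : Function.Injective boundaryEnd := by decide

theorem boundaryEnd_surjective : Function.Surjective boundaryEnd := by decide

theorem mainTheorem5 (o : ManifoldOrientation torusModel Torus 2)
    (ψ : Diffeomorph torusModel torusModel Torus Torus ∞) (hψ : PreservesOrientation o o ψ) :
    ∃ (W : Type) (_ : TopologicalSpace W) (_ : ChartedSpace (EuclideanHalfSpace 4) W)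
      (oW : ManifoldOrientation (𝓡∂ 4) W 4)
      (oN : ∀ i : Fin 4, ManifoldOrientation (torusModel.prod 𝓘(ℝ, ℝ))
        (MappingTorus ((![ψ.symm, ψ.symm, ψ, ψ] i).toHomeomorph)) 3),
      IsManifold (𝓡∂ 4) ∞ W ∧ CompactSpace W ∧ T2Space W ∧
      IsAspherical W ∧ HasEulerCharacteristic W 0 ∧
      HasAsphericalComponents ((𝓡∂ 4).boundary W) ∧
      IsPi1Injective ((𝓡∂ 4).boundary W) ∧
      (∀ i : Fin 4, MappingTorus.IsProductOrientation o
        ((![ψ.symm, ψ.symm, ψ, ψ] i).toHomeomorph) (oN i)) ∧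
      IsOrientedBoundary oN oW := by
  have hrank : Module.finrank ℝ TorusSpace = 2 := by simp
  let b : Module.Basis (Fin 2) ℝ TorusSpace := Module.finBasisOfFinrankEq ℝ TorusSpace hrank
  have h : PreservesSign torusModel (o.sign b) (o.sign b) ψ :=
    preservesSign_of_preservesOrientation b hψ
  set φ : Torus ≃ₜ Torus := ψ.toHomeomorph with hφ
  set χ : Fin 4 → Diffeomorph torusModel torusModel Torus Torus ∞ := ![ψ.symm, ψ.symm, ψ, ψ] with hχ'
  have hχs : ∀ k, PreservesSign torusModel (o.sign b) (o.sign b) (χ k) := by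
    intro k
    fin_cases k
    exacts [h.symm, h.symm, h, h]
  have hχ : ∀ k, (χ k).toHomeomorph = φ ^ saddleStrip.endSign (boundaryEnd k) := by
    intro k
    fin_cases k
    exacts [(zpow_neg_one φ).symm, (zpow_neg_one φ).symm, (zpow_one φ).symm, (zpow_one φ).symm]
  have hU : ⋃ k, Set.range (StripBundle.endMap (hχ k)) =
      (𝓡∂ 4).boundary (StripBundle φ) := by
    ext y
    obtain ⟨⟨x, σ⟩, rfl⟩ := StripBundle.proj_surjective φ y
    rw [StripBundle.proj_mem_boundary_iff, Set.mem_iUnion]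
    constructor
    · rintro ⟨k, z, hz⟩
      obtain ⟨p, rfl⟩ := Quotient.mk_surjective z
      rw [← StripBundle.proj_mem_boundary_iff, ← hz]
      exact (StripBundle.proj_mem_boundary_iff ψ _).2 (saddleStrip.isEnd_endCurve _ _)
    · intro hσ
      obtain ⟨i, t, rfl⟩ := saddleStrip.exists_endCurve hσ
      obtain ⟨k, rfl⟩ := boundaryEnd_surjective i
      exact ⟨k, MappingTorus.proj _ (x, t), rfl⟩
  have hd : Pairwise fun j k => Disjoint (Set.range (StripBundle.endMap (hχ j)))
      (Set.range (StripBundle.endMap (hχ k))) := fun j k hjk =>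
    StripBundle.disjoint_range_endMap _ _ (boundaryEnd_injective.ne hjk)
  have hcompact : ∀ k, CompactSpace (MappingTorus (χ k).toHomeomorph) := fun k =>
    StripBundle.compactSpace_mappingTorus _
  have hboundary := aspherical_and_isPi1Injective_of_retracts
    (fun k => StripBundle.isEmbedding_endMap (hχ k))
    (fun k => StripBundle.continuous_retraction (hχ k))
    (fun k => StripBundle.retraction_endMap (hχ k)) hd hU
    (fun k => hasAsphericalComponents_mappingTorus isAspherical_torus.2 _)
  exact ⟨StripBundle φ, inferInstance, inferInstance, StripBundle.orientation o b h,
    fun k => MappingTorus.orientation o b (χ k) (hχs k), StripBundle.isManifold ψ, inferInstance,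
    inferInstance, StripBundle.isAspherical φ isAspherical_torus,
    (StripBundle.hasVanishingEuler .torus φ).hasEulerCharacteristic, hboundary.1, hboundary.2,
    fun k => MappingTorus.isProductOrientation (hχs k),
    fun k => StripBundle.endMap (hχ k), fun k => StripBundle.isSmoothEmbedding_endMap (hχ k), hd, hU,
    fun k => StripBundle.preservesBoundaryOrientation_endMap (hχ k) h (hχs k)⟩

end
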